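/- **Theorem 4.3 (Error upper bound).** Let $d\ge 1$, let $\Omega\subset\mathbb R^d$ be a bounded open set whose closure is the union of the $d$-dimensional cells of a finite conforming affine simplicial mesh $\mathcal T_h$ (for instance a Lipschitz polyhedron meshed exactly), and let $J=[0,+\infty)$. Write $(\cdot,\cdot)_\Omega$, $\|\cdot\|_\Omega$ for the inner product and norm of $L^2(\Omega)$ and of $L^2(\Omega)^d$, $V=H^1_0(\Omega)$, $\hat V=H^1_0(\Omega;\mathbb C)$, and for $\ell\in V'$ put $\|\ell\|_{V'}=\sup\{|\langle\ell,v\rangle| : v\in V,\ \|\nabla v\|_\Omega=1\}$. Let $V_h\subset V$ be the space of continuous functions that vanish on $\partial\Omega$ and are polynomials of degree at most $k\ge 1$ on each cell, and $\hat V_h\subset\hat V$ its complex-valued version. *Source and exact solution.* Let $r\ge 0$ be an integer and let $f\in C^r(J;L^2(\Omega))$ vanish near $t=0$ and have bounded $r$-th derivative $f^{(r)}$. Let $u\in C^2(J;L^2(\Omega))\cap C^0(J;V)$ satisfy $u(0)=\dot u(0)=0$ and $$(\ddot u(t),v)_\Omega+(\nabla u(t),\nabla v)_\Omega=(f(t),v)_\Omega\qquad\forall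 t\in J,\ \forall v\in V.$$ *Leapfrog scheme.* Let $\tau>0$, $t^n=n\tau$, $J_n=[t^n,t^{n+1})$, and let $(U^n)_{n\ge 0}$ in $V_h$ satisfy $U^0=U^1=0$ and $$\tfrac1{\tau^2}(U^{n+1}-2U^n+U^{n-1},v_h)_\Omega+(\nabla U^n,\nabla v_h)_\Omega=(f(t^n),v_h)_\Omega\qquad\forall n\ge 1,\ \forall v_h\in V_h.$$ *Time reconstructions.* Extend sequences $W=(W^n)_{n\ge 0}$ by $0$ to negative indices. For $n\ge0$, $t\in J_n$ and $x=t-t^n$, set $$R(W)(t)=W^n+\tfrac{W^{n+1}-W^{n-1}}{2\tau}x+\tfrac{W^{n+1}-2W^n+W^{n-1}}{\tau^2}\tfrac{x^2}{2},$$ $$L(W)(t)=\alpha^n+\beta^n x+\gamma^n\tfrac{x^2}2+\vartheta^n\tfrac{x^3}6+\epsilon^n\tfrac{x^4}{24},$$ where $$\alpha^n=\tfrac{3W^{n+1}+17W^n+5W^{n-1}-W^{n-2}}{24},\qquad \beta^n=\tfrac{5W^{n+1}+3W^n-9W^{n-1}+W^{n-2}}{12\tau},\qquad \gamma^n=\tfrac{W^{n+1}-2W^n+W^{n-1}}{\tau^2},$$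 $$\vartheta^n=\tfrac{W^{n+2}-2W^{n+1}+2W^{n-1}-W^{n-2}}{2\tau^3},\qquad \epsilon^n=\tfrac{W^{n+2}-4W^{n+1}+6W^n-4W^{n-1}+W^{n-2}}{\tau^4}.$$ Set $w_{h\tau}=L(U)$, $\delta_{h\tau}=R(U)-L(U)$ (with $\dot\delta_{h\tau}$ computed on each $J_n$), $f_\tau=R((f(t^n))_n)$, $\eta_f=f-f_\tau$, $e=u-w_{h\tau}$, and define the residual $\mathcal R(t)\in V'$ by $$\langle\mathcal R(t),v\rangle=(f_\tau(t),v)_\Omega-(\ddot w_{h\tau}(t),v)_\Omega-(\nabla w_{h\tau}(t),\nabla v)_\Omega .$$ *Approximation factor.* Let $\rho>0$ and $\omega>0$. For $s\in\mathbb C$ with $\Re s>0$ and $g\in L^2(\Omega;\mathbb C)$ let $\chi_g\in\hat V$ solve $s^2(w,\chi_g)_\Omega+(\nabla w,\nabla\chi_g)_\Omega=|s|^2(w,g)_\Omega$ for all $w\in\hat V$, where $(w,v)_\Omega=\int_\Omega w\bar v$, and put $$\gamma_s(h)=\sup_{|s|\|g\|_\Omega=1}\ \min_{v_h\in\hat V_h}\|\nabla(\chi_g-v_h)\|_\Omega,\qquad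 \gamma_{\rho,\omega}(h)=\sup_{|\nu|\le\omega}\gamma_{\rho+i\nu}(h).$$ Then, with both sides understood in $[0,+\infty]$, $$\int_0^{+\infty}\big\{\|\dot e(t)\|_\Omega^2+\|\nabla e(t)\|_\Omega^2\big\}e^{-2\rho t}\,dt\le\int_0^{+\infty}\Big\{\|\mathcal R(t)\|_{V'}^2+\frac{20}{\rho^2}\|\nabla\dot\delta_{h\tau}(t)\|_\Omega^2+40\,\gamma_{\rho,\omega}(h)^2\|\mathcal R(t)\|_{V'}^2+\frac{11}{\rho^2}\|\eta_f(t)\|_\Omega^2+\frac{8}{\rho^2\omega^{2r}}\|f^{(r)}(t)\|_\Omega^2\Big\}e^{-2\rho t}\,dt .$$ -/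

import Mathlib

open MeasureTheory Set
open scoped ENNReal

noncomputable section

namespace LeapfrogWave

/-! ### Function spaces on `Ω` -/

/-- `L²(Ω; F)`. -/
abbrev L2 {d : ℕ} (Ω : Set (EuclideanSpace ℝ (Fin d))) (F : Type) [NormedAddCommGroup F] : Type :=
  Lp F 2 (volume.restrict Ω)

/-- The classical gradient `(∂₁φ(x), …, ∂_dφ(x))` of a real or complex valued function. -/
def classicalGrad (𝕜 : Type) [RCLike 𝕜] {d : ℕ} (φ : EuclideanSpace ℝ (Fin d) → 𝕜)
    (x : EuclideanSpace ℝ (Fin d)) : EuclideanSpace 𝕜 (Fin d) :=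
  WithLp.toLp 2 fun i => fderiv ℝ φ x (EuclideanSpace.single i 1)

/-- The pairs `(φ, ∇φ)` in `L²(Ω) × L²(Ω)ᵈ` with `φ ∈ C_c^∞(Ω)`. -/
def testGraph (𝕜 : Type) [RCLike 𝕜] {d : ℕ} (Ω : Set (EuclideanSpace ℝ (Fin d))) :
    Set (WithLp 2 (L2 Ω 𝕜 × L2 Ω (EuclideanSpace 𝕜 (Fin d)))) :=
  {z | ∃ φ : EuclideanSpace ℝ (Fin d) → 𝕜,
    ContDiff ℝ ((⊤ : ℕ∞) : WithTop ℕ∞) φ ∧ HasCompactSupport φ ∧ tsupport φ ⊆ Ω ∧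
    (z.fst : EuclideanSpace ℝ (Fin d) → 𝕜) =ᵐ[volume.restrict Ω] φ ∧
    (z.snd : EuclideanSpace ℝ (Fin d) → EuclideanSpace 𝕜 (Fin d))
      =ᵐ[volume.restrict Ω] classicalGrad 𝕜 φ}

/-- `H¹₀(Ω; 𝕜)`, the closure of `C_c^∞(Ω; 𝕜)` in the `H¹`-norm `(‖v‖² + ‖∇v‖²)^{1/2}`.
An element `v` is stored together with its weak gradient, as the pair `(v, ∇v)`. -/
def H10 (𝕜 : Type) [RCLike 𝕜] {d : ℕ} (Ω : Set (EuclideanSpace ℝ (Fin d))) :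
    Submodule 𝕜 (WithLp 2 (L2 Ω 𝕜 × L2 Ω (EuclideanSpace 𝕜 (Fin d)))) :=
  (Submodule.span 𝕜 (testGraph 𝕜 Ω)).topologicalClosure

section
variable {𝕜 : Type} [RCLike 𝕜] {d : ℕ} {Ω : Set (EuclideanSpace ℝ (Fin d))}

/-- The embedding `H¹₀(Ω) ⊂ L²(Ω)`. -/
def val : H10 𝕜 Ω →L[𝕜] L2 Ω 𝕜 :=
  (WithLp.fstL 2 𝕜 (L2 Ω 𝕜) (L2 Ω (EuclideanSpace 𝕜 (Fin d)))).comp (H10 𝕜 Ω).subtypeL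

/-- The weak gradient `∇ : H¹₀(Ω) → L²(Ω)ᵈ`. -/
def grad : H10 𝕜 Ω →L[𝕜] L2 Ω (EuclideanSpace 𝕜 (Fin d)) :=
  (WithLp.sndL 2 𝕜 (L2 Ω 𝕜) (L2 Ω (EuclideanSpace 𝕜 (Fin d)))).comp (H10 𝕜 Ω).subtypeL

/-- The norm `‖ℓ‖_{V'} = sup {|⟨ℓ, v⟩| : v ∈ V, ‖∇v‖ = 1}`, where `V = H¹₀(Ω)`. -/
def dualNorm (l : H10 ℝ Ω →L[ℝ] ℝ) : ℝ≥0∞ :=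
  ⨆ (v : H10 ℝ Ω) (_ : ‖grad v‖ = 1), ‖l v‖ₑ

end

/-! ### The finite element space -/

/-- The cells of a simplicial complex in `ℝᵈ`: its `d`-dimensional simplices, given by their sets
of `d + 1` vertices. -/
def cells {d : ℕ} (T : Geometry.SimplicialComplex ℝ (EuclideanSpace ℝ (Fin d))) :
    Set (Finset (EuclideanSpace ℝ (Fin d))) :=
  {s | s ∈ T.faces ∧ s.card = d + 1}

/-- `T` is a (conforming, affine, finite) simplicial mesh that covers `Ω` exactly. -/
structure IsMesh {d : ℕ} (Ω : Set (EuclideanSpace ℝ (Fin d)))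
    (T : Geometry.SimplicialComplex ℝ (EuclideanSpace ℝ (Fin d))) : Prop where
  finite : T.faces.Finite
  covers : ⋃ s ∈ cells T, convexHull ℝ (s : Set (EuclideanSpace ℝ (Fin d))) = closure Ω

/-- `p` is continuous on the closure of `Ω`, vanishes on the boundary, and is on every cell of `T`
a polynomial of total degree at most `k`. -/
structure IsLagrangeFunction {𝕜 : Type} [RCLike 𝕜] {d : ℕ} (Ω : Set (EuclideanSpace ℝ (Fin d)))
    (T : Geometry.SimplicialComplex ℝ (EuclideanSpace ℝ (Fin d))) (k : ℕ)
    (p : EuclideanSpace ℝ (Fin d) → 𝕜) : Prop where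
  continuousOn : ContinuousOn p (closure Ω)
  boundary : ∀ x ∈ frontier Ω, p x = 0
  polynomial : ∀ s ∈ cells T, ∃ P : MvPolynomial (Fin d) 𝕜, P.totalDegree ≤ k ∧
    ∀ x ∈ convexHull ℝ (s : Set (EuclideanSpace ℝ (Fin d))),
      p x = MvPolynomial.eval (fun i => ((x i : ℝ) : 𝕜)) P

/-- The `𝕜`-valued `H¹₀`-conforming Lagrange finite element space of degree `k` on the mesh `T`. -/
def lagrangeSpace (𝕜 : Type) [RCLike 𝕜] {d : ℕ} (Ω : Set (EuclideanSpace ℝ (Fin d)))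
    (T : Geometry.SimplicialComplex ℝ (EuclideanSpace ℝ (Fin d))) (k : ℕ) :
    Submodule 𝕜 (H10 𝕜 Ω) where
  carrier := {v | ∃ p : EuclideanSpace ℝ (Fin d) → 𝕜, IsLagrangeFunction Ω T k p ∧
    (val v : EuclideanSpace ℝ (Fin d) → 𝕜) =ᵐ[volume.restrict Ω] p}
  zero_mem' := by
    refine ⟨0, ⟨continuousOn_const, fun _ _ => rfl, fun s _ => ⟨0, by simp, by simp⟩⟩, ?_⟩
    rw [map_zero]
    exact Lp.coeFn_zero _ _ _
  add_mem' := by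
    rintro v w ⟨p, hp, hvp⟩ ⟨q, hq, hwq⟩
    refine ⟨p + q, ⟨hp.continuousOn.add hq.continuousOn, fun x hx => ?_, fun s hs => ?_⟩, ?_⟩
    · simp [hp.boundary x hx, hq.boundary x hx]
    · obtain ⟨P, hP, hpP⟩ := hp.polynomial s hs
      obtain ⟨Q, hQ, hqQ⟩ := hq.polynomial s hs
      refine ⟨P + Q, (MvPolynomial.totalDegree_add P Q).trans (max_le hP hQ), fun x hx => ?_⟩
      simp [hpP x hx, hqQ x hx]
    · rw [map_add]
      exact (Lp.coeFn_add _ _).trans (hvp.add hwq)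
  smul_mem' := by
    rintro c v ⟨p, hp, hvp⟩
    refine ⟨c • p, ⟨hp.continuousOn.const_smul c, fun x hx => ?_, fun s hs => ?_⟩, ?_⟩
    · simp [hp.boundary x hx]
    · obtain ⟨P, hP, hpP⟩ := hp.polynomial s hs
      refine ⟨c • P, (MvPolynomial.totalDegree_smul_le c P).trans hP, fun x hx => ?_⟩
      simp [hpP x hx, MvPolynomial.smul_eval]
    · rw [map_smul]
      exact (Lp.coeFn_smul _ _).trans (hvp.const_smul c)

/-! ### Functions of time on `J = [0, ∞)` -/

section
variable {Y : Type} [NormedAddCommGroup Y] [NormedSpace ℝ Y]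

/-- The `r`-th time derivative on `J = [0, ∞)` (one-sided at `0`). -/
def timeDeriv (r : ℕ) (v : ℝ → Y) (t : ℝ) : Y := iteratedDerivWithin r v (Ici 0) t

/-- `v ∈ C^r_b(J; Y)`: `v` is of class `C^r` on `J` and `v^{(r)}` is bounded. -/
def IsCrb (r : ℕ) (v : ℝ → Y) : Prop :=
  ContDiffOn ℝ r v (Ici 0) ∧ ∃ M : ℝ, ∀ t ≥ 0, ‖timeDeriv r v t‖ ≤ M

/-- `v` is supported away from zero. -/
def SupportedAwayFromZero (v : ℝ → Y) : Prop :=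
  ∃ ε > 0, ∀ t, 0 ≤ t → t ≤ ε → v t = 0

/-- Extension of a sequence by zero to negative indices. -/
def zeroExt (V : ℕ → Y) (n : ℤ) : Y := if n < 0 then 0 else V n.toNat

/-- The index `n` of the time interval `J_n = [nτ, (n+1)τ)` that contains `t ≥ 0`. -/
def timeIndex (τ t : ℝ) : ℤ := ⌊t / τ⌋

/-- The piecewise quadratic, continuous time reconstruction `R(V)`. -/
def reconR (τ : ℝ) (V : ℕ → Y) (t : ℝ) : Y :=
  let W := zeroExt V
  let n := timeIndex τ t
  let x := t - n * τ
  W n + (x / (2 * τ)) • (W (n + 1) - W (n - 1))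
    + (x ^ 2 / 2 / τ ^ 2) • (W (n + 1) - (2 : ℝ) • W n + W (n - 1))

/-- The piecewise quartic, twice continuously differentiable time reconstruction `L(V)`. -/
def reconL (τ : ℝ) (V : ℕ → Y) (t : ℝ) : Y :=
  let W := zeroExt V
  let n := timeIndex τ t
  let x := t - n * τ
  let α : Y := (1 / 24 : ℝ) •
    ((3 : ℝ) • W (n + 1) + (17 : ℝ) • W n + (5 : ℝ) • W (n - 1) - W (n - 2))
  let β : Y := (1 / (12 * τ)) •
    ((5 : ℝ) • W (n + 1) + (3 : ℝ) • W n - (9 : ℝ) • W (n - 1) + W (n - 2))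
  let γ : Y := (1 / τ ^ 2) • (W (n + 1) - (2 : ℝ) • W n + W (n - 1))
  let θ : Y := (1 / (2 * τ ^ 3)) •
    (W (n + 2) - (2 : ℝ) • W (n + 1) + (2 : ℝ) • W (n - 1) - W (n - 2))
  let ε : Y := (1 / τ ^ 4) •
    (W (n + 2) - (4 : ℝ) • W (n + 1) + (6 : ℝ) • W n - (4 : ℝ) • W (n - 1) + W (n - 2))
  α + x • β + (x ^ 2 / 2) • γ + (x ^ 3 / 6) • θ + (x ^ 4 / 24) • ε

end

/-! ### The wave equation, the leapfrog scheme and the error -/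

section
variable {d : ℕ} {Ω : Set (EuclideanSpace ℝ (Fin d))}

/-- `u ∈ C²(J; L²(Ω)) ∩ C⁰(J; V)` with `u(0) = u'(0) = 0` is the strong solution of the wave
equation with source term `f`. -/
structure IsWaveSolution (f : ℝ → L2 Ω ℝ) (u : ℝ → H10 ℝ Ω) : Prop where
  contDiffOn : ContDiffOn ℝ 2 (fun t => val (u t)) (Ici 0)
  continuousOn : ContinuousOn u (Ici 0)
  initial : val (u 0) = 0
  initial_deriv : timeDeriv 1 (fun t => val (u t)) 0 = 0
  equation : ∀ t ≥ 0, ∀ v : H10 ℝ Ω,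
    inner ℝ (timeDeriv 2 (fun t => val (u t)) t) (val v) + inner ℝ (grad (u t)) (grad v)
      = inner ℝ (f t) (val v)

/-- The sequence `U` in `Vh` solves the leapfrog scheme with time step `τ`. -/
structure IsLeapfrogSolution (Vh : Submodule ℝ (H10 ℝ Ω)) (τ : ℝ) (f : ℝ → L2 Ω ℝ)
    (U : ℕ → H10 ℝ Ω) : Prop where
  mem : ∀ n, U n ∈ Vh
  initial_zero : U 0 = 0
  initial_one : U 1 = 0
  equation : ∀ n ≥ 1, ∀ v ∈ Vh,
    1 / τ ^ 2 * inner ℝ (val (U (n + 1) - (2 : ℝ) • U n + U (n - 1))) (val v)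
      + inner ℝ (grad (U n)) (grad v) = inner ℝ (f (n * τ)) (val v)

/-- `f_τ = R(F)` with `Fⁿ = f(nτ)`. -/
def fTau (τ : ℝ) (f : ℝ → L2 Ω ℝ) : ℝ → L2 Ω ℝ := reconR τ fun n => f (n * τ)

/-- The data oscillation `η_f = f - f_τ`. -/
def etaF (τ : ℝ) (f : ℝ → L2 Ω ℝ) (t : ℝ) : L2 Ω ℝ := f t - fTau τ f t

/-- The time reconstruction error `δ = R(U) - L(U)`. -/
def delta (τ : ℝ) (U : ℕ → H10 ℝ Ω) (t : ℝ) : H10 ℝ Ω := reconR τ U t - reconL τ U t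

/-- The time derivative of `δ`. As `δ` is only continuous and piecewise polynomial, this is taken
from the right, which gives on each `J_n = [nτ, (n+1)τ)` the derivative of the polynomial. -/
def deltaDot (τ : ℝ) (U : ℕ → H10 ℝ Ω) (t : ℝ) : H10 ℝ Ω := derivWithin (delta τ U) (Ici t) t

/-- The residual `⟨R(t), v⟩ = (f_τ(t), v) - (w''(t), v) - (∇w(t), ∇v)` with `w = L(U)`. -/
def residual (τ : ℝ) (f : ℝ → L2 Ω ℝ) (U : ℕ → H10 ℝ Ω) (t : ℝ) : H10 ℝ Ω →L[ℝ] ℝ :=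
  (innerSL ℝ (fTau τ f t)).comp val
    - (innerSL ℝ (timeDeriv 2 (fun t => val (reconL τ U t)) t)).comp val
    - (innerSL ℝ (grad (reconL τ U t))).comp grad

/-- The square `∫₀^∞ (‖φ'(t)‖² + ‖∇φ(t)‖²) e^{-2ρt} dt` of the damped energy norm. -/
def dampedEnergySq (ρ : ℝ) (φ : ℝ → H10 ℝ Ω) : ℝ≥0∞ :=
  ∫⁻ t in Ici (0 : ℝ),
    (‖timeDeriv 1 (fun t => val (φ t)) t‖ₑ ^ 2 + ‖grad (φ t)‖ₑ ^ 2)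
      * ENNReal.ofReal (Real.exp (-2 * ρ * t))

/-! ### The approximation factor -/

/-- `χ` solves the adjoint problem `b_s(w, χ) = |s|² (w, g)` for all `w ∈ H¹₀(Ω; ℂ)`, where
`b_s(w, χ) = s² (w, χ) + (∇w, ∇χ)` and `(w, χ) = ∫ w χ̄`, which is `inner ℂ χ w`. -/
def IsAdjointSolution (s : ℂ) (g : L2 Ω ℂ) (χ : H10 ℂ Ω) : Prop :=
  ∀ w : H10 ℂ Ω, s ^ 2 * inner ℂ (val χ) (val w) + inner ℂ (grad χ) (grad w)
    = (‖s‖ : ℂ) ^ 2 * inner ℂ g (val w)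

/-- The approximation factor `γ_s(h)` of the complex discrete space `Vh`. -/
def gammaS (Vh : Submodule ℂ (H10 ℂ Ω)) (s : ℂ) : ℝ≥0∞ :=
  ⨆ (g : L2 Ω ℂ) (_ : ‖s‖ * ‖g‖ = 1) (χ : H10 ℂ Ω) (_ : IsAdjointSolution s g χ),
    ⨅ v ∈ Vh, ‖grad (χ - v)‖ₑ

/-- `γ_{ρ,ω}(h)`, the largest `γ_s(h)` over `s = ρ + iν` with `|ν| ≤ ω`. -/
def gammaRhoOmega (Vh : Submodule ℂ (H10 ℂ Ω)) (ρ ω : ℝ) : ℝ≥0∞ :=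
  ⨆ (ν : ℝ) (_ : |ν| ≤ ω), gammaS Vh (ρ + ν * Complex.I)

end

end LeapfrogWave

end

open LeapfrogWave

noncomputable section

namespace LeapfrogWave

/-! ### Real and complex `H¹₀` -/

section Spaces
variable {𝕜 : Type} [RCLike 𝕜] {d : ℕ} {Ω : Set (EuclideanSpace ℝ (Fin d))}

/-! The estimate is proved frequency by frequency. On the line `Re s = ρ` the Laplace transform
turns time derivatives into multiplications by `s` (`lap_deriv`; the initial values involved all
vanish), and by Plancherel (`lintegral_enorm_lap`) a damped `L²` norm in time is an `L²` norm over
that line. It therefore suffices to bound `|s|²‖ê‖² + ‖∇ê‖²` for each `s = ρ + iν` by the transforms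
of the estimators (`transformed_bound`).

On the discrete side, `L(U)'' = R(D)` with `D` the second differences of `U`. Applying `R` to the
leapfrog scheme thus gives an evolution equation that holds at all times, and on `V_h` the residual
reduces to `v ↦ (∇δ, ∇v)` (`residual_apply_of_mem`). The residual itself is handled through its
Riesz representative `residualRep`, whose gradient is a function of time with values in a Hilbert
space.

The form `b_s` is stable because `Re (s̄ b_s(v, v)) = Re s (|s|²‖v‖² + ‖∇v‖²)`. For `|ν| ≤ ω`
(`low_frequency`) a duality argument bounds `|s|‖ê‖`: the adjoint solution with datum `ê` is
approximated from `V_h` up to the approximation factor, and on `V_h` the residual is `∇δ̂`. The real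
part of the error equation tested with `ê` then bounds `‖∇ê‖` with the sharp constant 1 in front of
`‖R̂‖²`. For `|ν| > ω` (`high_frequency`) the stability bound is applied separately to the exact and
to the discrete solution, and `‖f̂‖ ≤ ω⁻ʳ ‖sʳ f̂‖` brings in the `r`-th derivative.

The transforms must converge. The source grows slower than any exponential, being an `r`-fold
integral of a bounded function, and energy estimates pass this on to `u`. For the discrete solution
no CFL condition is available, and it may blow up. If the right-hand side is infinite there is
nothing to prove. Otherwise the damped norm of `∇δ'` is finite; on each time interval `δ'` is a
cubic polynomial with third derivative `-ε^n`, so the fourth differences of `∇U`, and hence `U`,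
grow at most like `e^{ρt}` (`seqGrowth_of_deltaDot`). This is only the borderline rate, so the
estimate is first proved at the rate `ρ + ε`. The approximation factor at `ρ + ε` exceeds the one at
`ρ` by a factor that tends to 1 (`gammaRhoOmega_le_mul`), and Fatou's lemma gives the limit `ε → 0`.
-/

lemma classicalGrad_add {φ ψ : EuclideanSpace ℝ (Fin d) → 𝕜}
    (hφ : Differentiable ℝ φ) (hψ : Differentiable ℝ ψ) :
    classicalGrad 𝕜 (φ + ψ) = classicalGrad 𝕜 φ + classicalGrad 𝕜 ψ := by
  ext x i
  simp [classicalGrad, fderiv_add (hφ x) (hψ x)]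

lemma classicalGrad_smul (c : 𝕜) {φ : EuclideanSpace ℝ (Fin d) → 𝕜} (hφ : Differentiable ℝ φ) :
    classicalGrad 𝕜 (c • φ) = c • classicalGrad 𝕜 φ := by
  ext x i
  simp [classicalGrad, fderiv_const_smul (hφ x)]

/-- The test functions form a linear space. -/
lemma mem_testGraph_of_mem_span {z : WithLp 2 (L2 Ω 𝕜 × L2 Ω (EuclideanSpace 𝕜 (Fin d)))}
    (hz : z ∈ Submodule.span 𝕜 (testGraph 𝕜 Ω)) : z ∈ testGraph 𝕜 Ω := by
  induction hz using Submodule.span_induction with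
  | mem z h => exact h
  | zero =>
    refine ⟨0, contDiff_const, HasCompactSupport.zero, by simp [tsupport], ?_, ?_⟩
    · exact Lp.coeFn_zero _ _ _
    · have : classicalGrad 𝕜 (0 : EuclideanSpace ℝ (Fin d) → 𝕜) = 0 := by
        ext x i; simp [classicalGrad]
      rw [this]
      exact Lp.coeFn_zero _ _ _
  | add y z _ _ hy hz =>
    obtain ⟨φ, h1, h2, h3, h4, h5⟩ := hy
    obtain ⟨ψ, k1, k2, k3, k4, k5⟩ := hz
    refine ⟨φ + ψ, h1.add k1, h2.add k2,
      (tsupport_add φ ψ).trans (union_subset h3 k3), ?_, ?_⟩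
    · exact (Lp.coeFn_add _ _).trans (h4.add k4)
    · rw [classicalGrad_add (h1.differentiable (by simp)) (k1.differentiable (by simp))]
      exact (Lp.coeFn_add _ _).trans (h5.add k5)
  | smul c z _ hz =>
    obtain ⟨φ, h1, h2, h3, h4, h5⟩ := hz
    refine ⟨c • φ, h1.const_smul c, h2.smul_left (f := fun _ => c),
      (tsupport_smul_subset_right (fun _ => c) φ).trans h3, ?_, ?_⟩
    · exact (Lp.coeFn_smul _ _).trans (h4.const_smul c)
    · rw [classicalGrad_smul c (h1.differentiable (by simp))]
      exact (Lp.coeFn_smul _ _).trans (h5.const_smul c)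

lemma H10_ext {v w : H10 𝕜 Ω} (h1 : val v = val w) (h2 : grad v = grad w) : v = w := by
  apply Subtype.ext
  apply (WithLp.equiv 2 _).injective
  exact Prod.ext h1 h2

end Spaces

section Maps
variable {A B : Type} [RCLike A] [RCLike B] {d : ℕ} {Ω : Set (EuclideanSpace ℝ (Fin d))}

/-- Application of a linear map to every coordinate of a vector. -/
def coordMap (d : ℕ) (l : A →L[ℝ] B) : EuclideanSpace A (Fin d) →L[ℝ] EuclideanSpace B (Fin d) :=
  ((PiLp.continuousLinearEquiv 2 ℝ fun _ : Fin d => B).symm :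
      (Fin d → B) →L[ℝ] EuclideanSpace B (Fin d)).comp
    ((ContinuousLinearMap.pi fun i => l.comp (ContinuousLinearMap.proj i)).comp
      (PiLp.continuousLinearEquiv 2 ℝ fun _ : Fin d => A :
        EuclideanSpace A (Fin d) →L[ℝ] (Fin d → A)))

@[simp] lemma coordMap_apply (l : A →L[ℝ] B) (x : EuclideanSpace A (Fin d)) (i : Fin d) :
    coordMap d l x i = l (x i) := rfl

/-- Pointwise application of `l` on `L²(Ω) × L²(Ω)ᵈ`. -/
def pairMap (l : A →L[ℝ] B)
    (z : WithLp 2 (L2 Ω A × L2 Ω (EuclideanSpace A (Fin d)))) :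
    WithLp 2 (L2 Ω B × L2 Ω (EuclideanSpace B (Fin d))) :=
  WithLp.toLp 2 (l.compLpL 2 _ z.fst, (coordMap d l).compLpL 2 _ z.snd)

lemma pairMap_add (l : A →L[ℝ] B)
    (y z : WithLp 2 (L2 Ω A × L2 Ω (EuclideanSpace A (Fin d)))) :
    pairMap l (y + z) = pairMap l y + pairMap l z := by
  rw [pairMap, WithLp.add_fst, WithLp.add_snd, map_add, map_add, ← Prod.mk_add_mk, WithLp.toLp_add,
    pairMap, pairMap]

lemma pairMap_smul (l : A →L[ℝ] B) (c : ℝ)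
    (z : WithLp 2 (L2 Ω A × L2 Ω (EuclideanSpace A (Fin d)))) :
    pairMap l (c • z) = c • pairMap l z := by
  rw [pairMap, WithLp.smul_fst, WithLp.smul_snd, map_smul, map_smul, ← Prod.smul_mk,
    WithLp.toLp_smul, pairMap]

lemma continuous_pairMap (l : A →L[ℝ] B) : Continuous (pairMap (Ω := Ω) l) := by
  unfold pairMap
  refine (WithLp.prod_continuous_toLp 2 _ _).comp (Continuous.prodMk ?_ ?_)
  · exact (ContinuousLinearMap.continuous _).comp
      (WithLp.fstL 2 A (L2 Ω A) (L2 Ω (EuclideanSpace A (Fin d)))).continuous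
  · exact (ContinuousLinearMap.continuous _).comp
      (WithLp.sndL 2 A (L2 Ω A) (L2 Ω (EuclideanSpace A (Fin d)))).continuous

lemma pairMap_mem_testGraph (l : A →L[ℝ] B)
    {z : WithLp 2 (L2 Ω A × L2 Ω (EuclideanSpace A (Fin d)))} (hz : z ∈ testGraph A Ω) :
    pairMap l z ∈ testGraph B Ω := by
  obtain ⟨φ, h1, h2, h3, h4, h5⟩ := hz
  refine ⟨l ∘ φ, l.contDiff.comp h1, h2.comp_left (map_zero l), ?_, ?_, ?_⟩
  · refine (closure_mono ?_).trans h3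
    exact Function.support_comp_subset (map_zero l) φ
  · refine (ContinuousLinearMap.coeFn_compLpL (p := 2) l _).trans ?_
    filter_upwards [h4] with x hx
    simp [hx]
  · refine (ContinuousLinearMap.coeFn_compLpL (p := 2) (coordMap d l) _).trans ?_
    filter_upwards [h5] with x hx
    rw [hx]
    ext i
    have : fderiv ℝ (l ∘ φ) x = l.comp (fderiv ℝ φ x) :=
      l.hasFDerivAt.comp x (h1.differentiable (by simp) x).hasFDerivAt |>.fderiv
    simp [classicalGrad, this]

/-- As `l` is only real linear, it need not respect spans over `A`. But the test pairs already form
a subspace, so every element of the span is itself a test pair, and composition with `l` preserves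
those. Continuity passes this to the closure. -/
lemma pairMap_mem_H10 (l : A →L[ℝ] B)
    {z : WithLp 2 (L2 Ω A × L2 Ω (EuclideanSpace A (Fin d)))} (hz : z ∈ H10 A Ω) :
    pairMap l z ∈ H10 B Ω := by
  have hz' : z ∈ closure (Submodule.span A (testGraph A Ω) : Set _) := hz
  have : pairMap l z ∈ closure (Submodule.span B (testGraph B Ω) : Set _) :=
    map_mem_closure (continuous_pairMap l) hz' fun y hy =>
      Submodule.subset_span (pairMap_mem_testGraph l (mem_testGraph_of_mem_span hy))
  exact this

/-- Pointwise application of a real-linear map on `H¹₀(Ω)`. -/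
def mapH10 (l : A →L[ℝ] B) : H10 A Ω →L[ℝ] H10 B Ω where
  toFun z := ⟨pairMap l z.1, pairMap_mem_H10 l z.2⟩
  map_add' y z := Subtype.ext (pairMap_add l y.1 z.1)
  map_smul' c z := Subtype.ext (pairMap_smul l c z.1)
  cont := ((continuous_pairMap l).comp continuous_subtype_val).subtype_mk _

lemma val_mapH10 (l : A →L[ℝ] B) (z : H10 A Ω) :
    val (mapH10 l z) = l.compLpL 2 _ (val z) := rfl

lemma grad_mapH10 (l : A →L[ℝ] B) (z : H10 A Ω) :
    grad (mapH10 l z) = (coordMap d l).compLpL 2 _ (grad z) := rfl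

/-- `l` commutes with the evaluation of polynomials at real points. -/
lemma exists_polynomial_map (l : A →L[ℝ] B) (P : MvPolynomial (Fin d) A) :
    ∃ Q : MvPolynomial (Fin d) B, Q.totalDegree ≤ P.totalDegree ∧
      ∀ x : EuclideanSpace ℝ (Fin d), MvPolynomial.eval (fun i => ((x i : ℝ) : B)) Q =
        l (MvPolynomial.eval (fun i => ((x i : ℝ) : A)) P) := by
  refine ⟨∑ m ∈ P.support, MvPolynomial.monomial m (l (P.coeff m)), ?_, fun x => ?_⟩
  · refine MvPolynomial.totalDegree_finsetSum_le fun m hm => ?_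
    exact (MvPolynomial.totalDegree_monomial_le _ _).trans (MvPolynomial.le_totalDegree hm)
  · rw [MvPolynomial.eval_eq' _ P, map_sum, map_sum]
    refine Finset.sum_congr rfl fun m _ => ?_
    have h : ∀ (K : Type) [RCLike K],
        (∏ i, ((x i : ℝ) : K) ^ m i) = ((∏ i, x i ^ m i : ℝ) : K) := by
      intro K _
      push_cast
      rfl
    rw [h A, MvPolynomial.eval_monomial, Finsupp.prod_fintype _ _ (by simp), h B, mul_comm,
      mul_comm (MvPolynomial.coeff m P), ← RCLike.real_smul_eq_coe_mul,
      ← RCLike.real_smul_eq_coe_mul, map_smul]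

/-- Applied to `re`, `im` and the inclusion `ℝ → ℂ`, this lets the real scheme be tested with real
and imaginary parts of complex discrete functions, and puts the real reconstruction in the complex
discrete space. -/
lemma mapH10_mem_lagrangeSpace (l : A →L[ℝ] B)
    {T : Geometry.SimplicialComplex ℝ (EuclideanSpace ℝ (Fin d))} {k : ℕ} {v : H10 A Ω}
    (hv : v ∈ lagrangeSpace A Ω T k) : mapH10 l v ∈ lagrangeSpace B Ω T k := by
  obtain ⟨p, hp, hvp⟩ := hv
  refine ⟨l ∘ p, ⟨l.continuous.comp_continuousOn hp.continuousOn, fun x hx => ?_, fun s hs => ?_⟩,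
    ?_⟩
  · simp [hp.boundary x hx]
  · obtain ⟨P, hP, hpP⟩ := hp.polynomial s hs
    obtain ⟨Q, hQ, hQP⟩ := exists_polynomial_map l P
    exact ⟨Q, hQ.trans hP, fun x hx => by rw [hQP, ← hpP x hx]; rfl⟩
  · rw [val_mapH10]
    refine (ContinuousLinearMap.coeFn_compLpL (p := 2) l _).trans ?_
    filter_upwards [hvp] with x hx
    simp [hx]

end Maps

/-! ### Complexification of the real spaces -/

section Complexification
variable {d : ℕ} {Ω : Set (EuclideanSpace ℝ (Fin d))}

/-- The embedding of `L²(Ω)` into its complex version. -/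
def cVal : L2 Ω ℝ →L[ℝ] L2 Ω ℂ := Complex.ofRealCLM.compLpL 2 _

/-- The embedding of `L²(Ω)ᵈ` into its complex version. -/
def cGrad : L2 Ω (EuclideanSpace ℝ (Fin d)) →L[ℝ] L2 Ω (EuclideanSpace ℂ (Fin d)) :=
  (coordMap d Complex.ofRealCLM).compLpL 2 _

/-- The embedding of `H¹₀(Ω)` into its complex version. -/
def cH10 : H10 ℝ Ω →L[ℝ] H10 ℂ Ω := mapH10 Complex.ofRealCLM

lemma val_cH10 (v : H10 ℝ Ω) : val (cH10 v) = cVal (val v) := rfl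

lemma grad_cH10 (v : H10 ℝ Ω) : grad (cH10 v) = cGrad (grad v) := rfl

lemma inner_cVal (a b : L2 Ω ℝ) : inner ℂ (cVal a) (cVal b) = ((inner ℝ a b : ℝ) : ℂ) := by
  rw [L2.inner_def, L2.inner_def, ← integral_complex_ofReal]
  refine integral_congr_ae ?_
  filter_upwards [ContinuousLinearMap.coeFn_compLpL (p := 2) Complex.ofRealCLM a,
    ContinuousLinearMap.coeFn_compLpL (p := 2) Complex.ofRealCLM b] with x hx hy
  rw [cVal, hx, hy]
  simp

lemma inner_cGrad (a b : L2 Ω (EuclideanSpace ℝ (Fin d))) :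
    inner ℂ (cGrad a) (cGrad b) = ((inner ℝ a b : ℝ) : ℂ) := by
  rw [L2.inner_def, L2.inner_def, ← integral_complex_ofReal]
  refine integral_congr_ae ?_
  filter_upwards [ContinuousLinearMap.coeFn_compLpL (p := 2) (coordMap d Complex.ofRealCLM) a,
    ContinuousLinearMap.coeFn_compLpL (p := 2) (coordMap d Complex.ofRealCLM) b] with x hx hy
  rw [cGrad, hx, hy]
  simp [PiLp.inner_apply]

lemma norm_cVal (a : L2 Ω ℝ) : ‖cVal a‖ = ‖a‖ := by
  have h := inner_cVal a a
  rw [inner_self_eq_norm_sq_to_K, real_inner_self_eq_norm_sq] at h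
  have h' : ‖cVal a‖ ^ 2 = ‖a‖ ^ 2 := Complex.ofReal_injective (by simpa using h)
  exact (sq_eq_sq₀ (norm_nonneg _) (norm_nonneg _)).1 h'

lemma norm_cGrad (a : L2 Ω (EuclideanSpace ℝ (Fin d))) : ‖cGrad a‖ = ‖a‖ := by
  have h := inner_cGrad a a
  rw [inner_self_eq_norm_sq_to_K, real_inner_self_eq_norm_sq] at h
  have h' : ‖cGrad a‖ ^ 2 = ‖a‖ ^ 2 := Complex.ofReal_injective (by simpa using h)
  exact (sq_eq_sq₀ (norm_nonneg _) (norm_nonneg _)).1 h'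

lemma eq_re_add_im (v : H10 ℂ Ω) :
    v = cH10 (mapH10 Complex.reCLM v) + Complex.I • cH10 (mapH10 Complex.imCLM v) := by
  refine H10_ext ?_ ?_
  · rw [map_add, map_smul, val_cH10, val_cH10, val_mapH10, val_mapH10]
    change val v = cVal (Complex.reCLM.compLpL 2 _ (val v))
      + Complex.I • cVal (Complex.imCLM.compLpL 2 _ (val v))
    apply Lp.ext
    filter_upwards [Lp.coeFn_add (cVal (Complex.reCLM.compLpL 2 _ (val v)))
        (Complex.I • cVal (Complex.imCLM.compLpL 2 _ (val v))),
      Lp.coeFn_smul Complex.I (cVal (Complex.imCLM.compLpL 2 _ (val v))),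
      ContinuousLinearMap.coeFn_compLpL (p := 2) Complex.reCLM (val v),
      ContinuousLinearMap.coeFn_compLpL (p := 2) Complex.imCLM (val v),
      ContinuousLinearMap.coeFn_compLpL (p := 2) Complex.ofRealCLM
        (Complex.reCLM.compLpL 2 _ (val v)),
      ContinuousLinearMap.coeFn_compLpL (p := 2) Complex.ofRealCLM
        (Complex.imCLM.compLpL 2 _ (val v))] with x h1 h2 h3 h4 h5 h6
    rw [h1, Pi.add_apply, h2, Pi.smul_apply, cVal, h5, h6, h3, h4]
    simp [mul_comm Complex.I]
  · rw [map_add, map_smul, grad_cH10, grad_cH10, grad_mapH10, grad_mapH10]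
    change grad v = cGrad ((coordMap d Complex.reCLM).compLpL 2 _ (grad v))
      + Complex.I • cGrad ((coordMap d Complex.imCLM).compLpL 2 _ (grad v))
    apply Lp.ext
    filter_upwards [Lp.coeFn_add (cGrad ((coordMap d Complex.reCLM).compLpL 2 _ (grad v)))
        (Complex.I • cGrad ((coordMap d Complex.imCLM).compLpL 2 _ (grad v))),
      Lp.coeFn_smul Complex.I (cGrad ((coordMap d Complex.imCLM).compLpL 2 _ (grad v))),
      ContinuousLinearMap.coeFn_compLpL (p := 2) (coordMap d Complex.reCLM) (grad v),
      ContinuousLinearMap.coeFn_compLpL (p := 2) (coordMap d Complex.imCLM) (grad v),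
      ContinuousLinearMap.coeFn_compLpL (p := 2) (coordMap d Complex.ofRealCLM)
        ((coordMap d Complex.reCLM).compLpL 2 _ (grad v)),
      ContinuousLinearMap.coeFn_compLpL (p := 2) (coordMap d Complex.ofRealCLM)
        ((coordMap d Complex.imCLM).compLpL 2 _ (grad v))] with x h1 h2 h3 h4 h5 h6
    rw [h1, Pi.add_apply, h2, Pi.smul_apply, cGrad, h5, h6, h3, h4]
    ext i
    simp [mul_comm Complex.I]

end Complexification

/-! ### The Poincaré inequality and the solution operator of the Laplacian -/

section Poincare
variable {d : ℕ} {Ω : Set (EuclideanSpace ℝ (Fin d))}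

lemma continuous_classicalGrad {φ : EuclideanSpace ℝ (Fin d) → ℝ}
    (hφ : ContDiff ℝ ((⊤ : ℕ∞) : WithTop ℕ∞) φ) : Continuous (classicalGrad ℝ φ) := by
  unfold classicalGrad
  refine (PiLp.continuous_toLp 2 _).comp (continuous_pi fun j => ?_)
  exact (hφ.continuous_fderiv (by simp)).clm_apply continuous_const

lemma classicalGrad_eq_zero {φ : EuclideanSpace ℝ (Fin d) → ℝ} {x : EuclideanSpace ℝ (Fin d)}
    (hx : x ∉ tsupport φ) : classicalGrad ℝ φ x = 0 := by
  have : fderiv ℝ φ x = 0 := image_eq_zero_of_notMem_tsupport (f := fderiv ℝ φ)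
    fun h => hx (tsupport_fderiv_subset ℝ h)
  ext j
  simp [classicalGrad, this]

lemma hasCompactSupport_classicalGrad {φ : EuclideanSpace ℝ (Fin d) → ℝ}
    (hc : HasCompactSupport φ) : HasCompactSupport (classicalGrad ℝ φ) :=
  hc.mono' fun _ hx => by_contra fun h => hx (classicalGrad_eq_zero h)

/-- Integration by parts against the coordinate function `x i`, whose derivative in direction `i` is
1. -/
lemma integral_sq_eq {φ : EuclideanSpace ℝ (Fin d) → ℝ} (i : Fin d)
    (hφ : ContDiff ℝ 1 φ) (hc : HasCompactSupport φ) :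
    ∫ x, φ x ^ 2 = - ∫ x, x i * (2 * φ x * fderiv ℝ φ x (EuclideanSpace.single i 1)) := by
  have hd : Differentiable ℝ φ := hφ.differentiable (by simp)
  have hf2 : ∀ x, fderiv ℝ (fun y => φ y ^ 2) x (EuclideanSpace.single i 1)
      = 2 * φ x * fderiv ℝ φ x (EuclideanSpace.single i 1) := by
    intro x
    rw [((hd x).hasFDerivAt.pow 2).fderiv]
    simp
  have hℓ : ∀ x, fderiv ℝ (fun y : EuclideanSpace ℝ (Fin d) => y i) x (EuclideanSpace.single i 1)
      = 1 := by
    intro x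
    have : fderiv ℝ (fun y : EuclideanSpace ℝ (Fin d) => y i) x = EuclideanSpace.proj (𝕜 := ℝ) i :=
      (EuclideanSpace.proj (𝕜 := ℝ) i).hasFDerivAt.fderiv
    simp [this]
  have hi2 : Integrable (fun x => φ x ^ 2) :=
    (hφ.continuous.pow 2).integrable_of_hasCompactSupport
      (hc.mono fun x hx h => hx (by simp [h]))
  have hfc : Continuous fun x => fderiv ℝ φ x (EuclideanSpace.single i 1) :=
    (hφ.continuous_fderiv (by simp)).clm_apply continuous_const
  have hic : Continuous fun y : EuclideanSpace ℝ (Fin d) => y i :=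
    (EuclideanSpace.proj (𝕜 := ℝ) i).continuous
  have hIBP := integral_mul_fderiv_eq_neg_fderiv_mul_of_integrable (μ := volume) (𝕜 := ℝ)
    (f := fun y : EuclideanSpace ℝ (Fin d) => y i) (g := fun y => φ y ^ 2)
    (v := EuclideanSpace.single i 1)
    (by simp only [hℓ, one_mul]; exact hi2)
    (by
      simp only [hf2]
      refine Continuous.integrable_of_hasCompactSupport ?_ ?_
      · exact hic.mul ((continuous_const.mul hφ.continuous).mul hfc)
      · exact hc.mono fun x hx h => hx (by simp [h]))
    ((hic.mul (hφ.continuous.pow 2)).integrable_of_hasCompactSupport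
      (hc.mono fun x hx h => hx (by simp [h])))
    (fun x _ => (EuclideanSpace.proj (𝕜 := ℝ) i).differentiableAt) (fun x _ => (hd x).pow 2)
  simp only [hf2, hℓ, one_mul] at hIBP
  rw [hIBP, neg_neg]

/-- In the identity `integral_sq_eq` the weight `x i` is at most `M` on the support; Young's
inequality leaves half of `∫ φ²`, which is absorbed on the left. -/
lemma integral_sq_le_of_contDiff {φ : EuclideanSpace ℝ (Fin d) → ℝ} (i : Fin d) {M : ℝ}
    (hφ : ContDiff ℝ ((⊤ : ℕ∞) : WithTop ℕ∞) φ) (hc : HasCompactSupport φ)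
    (hM : ∀ x ∈ tsupport φ, |x i| ≤ M) :
    ∫ x, φ x ^ 2 ≤ 4 * M ^ 2 * ∫ x, ‖classicalGrad ℝ φ x‖ ^ 2 := by
  have hgc := continuous_classicalGrad hφ
  have hgs := hasCompactSupport_classicalGrad hc
  have hi2 : Integrable (fun x => φ x ^ 2) :=
    (hφ.continuous.pow 2).integrable_of_hasCompactSupport
      (hc.mono fun x hx h => hx (by simp [h]))
  have hig : Integrable (fun x => ‖classicalGrad ℝ φ x‖ ^ 2) :=
    (hgc.norm.pow 2).integrable_of_hasCompactSupport
      (hgs.mono fun x hx h => hx (by simp [h]))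
  have hle : ∀ x, -(x i * (2 * φ x * fderiv ℝ φ x (EuclideanSpace.single i 1)))
      ≤ 1 / 2 * φ x ^ 2 + 2 * M ^ 2 * ‖classicalGrad ℝ φ x‖ ^ 2 := by
    intro x
    by_cases hx : x ∈ tsupport φ
    · have h1 : |x i| ≤ M := hM x hx
      have h2 : |fderiv ℝ φ x (EuclideanSpace.single i 1)| ≤ ‖classicalGrad ℝ φ x‖ :=
        PiLp.norm_apply_le (classicalGrad ℝ φ x) i
      generalize fderiv ℝ φ x (EuclideanSpace.single i 1) = a at *
      generalize ‖classicalGrad ℝ φ x‖ = b at *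
      generalize φ x = y at *
      generalize x i = z at *
      have h3 : |z * a| ≤ M * b := by
        rw [abs_mul]
        exact mul_le_mul h1 h2 (abs_nonneg _) ((abs_nonneg _).trans h1)
      have h4 : (z * a) ^ 2 ≤ (M * b) ^ 2 := sq_le_sq' (by linarith [neg_abs_le (z * a)])
        ((le_abs_self _).trans h3)
      nlinarith [sq_nonneg (y + 2 * (z * a))]
    · have h0 : φ x = 0 := image_eq_zero_of_notMem_tsupport hx
      have : 0 ≤ 2 * M ^ 2 * ‖classicalGrad ℝ φ x‖ ^ 2 := by positivity
      rw [h0]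
      linarith
  have key : ∫ x, φ x ^ 2 ≤ ∫ x, (1 / 2 * φ x ^ 2 + 2 * M ^ 2 * ‖classicalGrad ℝ φ x‖ ^ 2) := by
    conv_lhs => rw [integral_sq_eq i (hφ.of_le (by exact_mod_cast le_top)) hc, ← integral_neg]
    -- If the integrand were not integrable its integral would be 0 by convention, and the bound
    -- holds anyway.
    by_cases hInt : Integrable fun x =>
        -(x i * (2 * φ x * fderiv ℝ φ x (EuclideanSpace.single i 1)))
    · exact integral_mono hInt ((hi2.const_mul _).add (hig.const_mul _)) hle
    · rw [integral_undef hInt]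
      exact integral_nonneg fun x => by positivity
  rw [integral_add (hi2.const_mul _) (hig.const_mul _), integral_const_mul,
    integral_const_mul] at key
  linarith

lemma norm_sq_eq_integral {F : Type} [NormedAddCommGroup F] [InnerProductSpace ℝ F]
    (a : L2 Ω F) {φ : EuclideanSpace ℝ (Fin d) → F} (h : a =ᵐ[volume.restrict Ω] φ)
    (hΩ : ∀ x ∉ Ω, φ x = 0) : ‖a‖ ^ 2 = ∫ x, ‖φ x‖ ^ 2 := by
  rw [← real_inner_self_eq_norm_sq, L2.inner_def,
    ← setIntegral_eq_integral_of_forall_compl_eq_zero (s := Ω)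
      (f := fun x => ‖φ x‖ ^ 2) fun x hx => by simp [hΩ x hx]]
  refine integral_congr_ae ?_
  filter_upwards [h] with x hx
  rw [hx, real_inner_self_eq_norm_sq]

/-- The inequality defines a closed set of pairs, so it passes from test functions to their closure.
One coordinate direction suffices, which is where `1 ≤ d` enters. -/
lemma exists_poincare (hd : 1 ≤ d) (hΩb : Bornology.IsBounded Ω) :
    ∃ C : ℝ, 0 < C ∧ ∀ v : H10 ℝ Ω, ‖val v‖ ≤ C * ‖grad v‖ := by
  obtain ⟨M, hM0, hM⟩ := hΩb.exists_pos_norm_le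
  refine ⟨2 * M, by positivity, ?_⟩
  let S : Set (WithLp 2 (L2 Ω ℝ × L2 Ω (EuclideanSpace ℝ (Fin d)))) :=
    {z | ‖z.fst‖ ≤ 2 * M * ‖z.snd‖}
  have hS : IsClosed S := isClosed_le
    (WithLp.fstL 2 ℝ (L2 Ω ℝ) (L2 Ω (EuclideanSpace ℝ (Fin d)))).continuous.norm
    (continuous_const.mul
      (WithLp.sndL 2 ℝ (L2 Ω ℝ) (L2 Ω (EuclideanSpace ℝ (Fin d)))).continuous.norm)
  have hsub : (Submodule.span ℝ (testGraph ℝ Ω) : Set _) ⊆ S := by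
    intro z hz
    obtain ⟨φ, h1, h2, h3, h4, h5⟩ := mem_testGraph_of_mem_span hz
    have hsupp : ∀ x ∉ Ω, φ x = 0 := fun x hx =>
      image_eq_zero_of_notMem_tsupport fun h => hx (h3 h)
    have hgsupp : ∀ x ∉ Ω, classicalGrad ℝ φ x = 0 := fun x hx =>
      classicalGrad_eq_zero fun h => hx (h3 h)
    have := integral_sq_le_of_contDiff ⟨0, hd⟩ h1 h2 (M := M) fun x hx =>
      (PiLp.norm_apply_le x ⟨0, hd⟩).trans (hM x (h3 hx))
    have e1 := norm_sq_eq_integral z.fst h4 hsupp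
    have e2 := norm_sq_eq_integral z.snd h5 hgsupp
    simp only [Real.norm_eq_abs, sq_abs] at e1
    rw [← e1, ← e2] at this
    change ‖z.fst‖ ≤ 2 * M * ‖z.snd‖
    refine le_of_sq_le_sq ?_ (by positivity)
    calc _ ≤ _ := this
      _ = _ := by ring
  intro v
  exact closure_minimal hsub hS v.2

lemma norm_sq_H10 {𝕜 : Type} [RCLike 𝕜] (v : H10 𝕜 Ω) :
    ‖v‖ ^ 2 = ‖val v‖ ^ 2 + ‖grad v‖ ^ 2 :=
  WithLp.prod_norm_sq_eq_of_L2 v.1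

instance {𝕜 : Type} [RCLike 𝕜] : CompleteSpace (H10 𝕜 Ω) :=
  (Submodule.isClosed_topologicalClosure _).completeSpace_coe

/-- The weak solution operator `g ↦ v`, `-Δv = g`, with homogeneous Dirichlet conditions. -/
lemma exists_solution_operator (hd : 1 ≤ d) (hΩb : Bornology.IsBounded Ω) :
    ∃ S : L2 Ω ℝ →L[ℝ] H10 ℝ Ω, ∀ g v, inner ℝ (grad (S g)) (grad v) = inner ℝ g (val v) := by
  obtain ⟨C, hC, hP⟩ := exists_poincare hd hΩb
  let B : H10 ℝ Ω →L[ℝ] H10 ℝ Ω →L[ℝ] ℝ :=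
    (innerSL ℝ).bilinearComp grad grad
  have hB : ∀ v w, B v w = inner ℝ (grad v) (grad w) := fun v w => rfl
  have hco : IsCoercive B := by
    -- By Poincaré, `‖v‖² + ‖∇v‖² ≤ (C² + 1) ‖∇v‖²`.
    refine ⟨(C ^ 2 + 1)⁻¹, by positivity, fun v => ?_⟩
    rw [hB, real_inner_self_eq_norm_sq, mul_assoc, ← sq, inv_mul_le_iff₀ (by positivity),
      norm_sq_H10]
    have := pow_le_pow_left₀ (norm_nonneg _) (hP v) 2
    linarith [mul_pow C ‖grad v‖ 2]
  refine ⟨(hco.continuousLinearEquivOfBilin.symm : H10 ℝ Ω →L[ℝ] H10 ℝ Ω).comp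
    (ContinuousLinearMap.adjoint val), fun g v => ?_⟩
  rw [← hB, ← hco.continuousLinearEquivOfBilin_apply]
  simp [ContinuousLinearMap.adjoint_inner_left]

end Poincare

/-! ### The Laplace transform -/

section Laplace
open Filter Topology FourierTransform SchwartzMap

/-- The `L²` Fourier transform and the Fourier integral agree on `L¹ ∩ L²`: paired with a smooth
compactly supported function, both equal the pairing of `g` with the transform of that function,
once by the compatibility with tempered distributions and once by Fubini. -/
lemma fourier_toLp_ae_eq {F : Type} [NormedAddCommGroup F] [InnerProductSpace ℂ F] [CompleteSpace F]
    {g : ℝ → F} (h1 : Integrable g) (h2 : MemLp g 2 volume) :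
    (𝓕 (h2.toLp g) : Lp F 2 (volume : Measure ℝ)) =ᵐ[volume] 𝓕 g := by
  refine ae_eq_of_integral_contDiff_smul_eq ?_ ?_ fun φ hφ hc => ?_
  · exact (Lp.memLp _).locallyIntegrable (by norm_num)
  · exact (VectorFourier.fourierIntegral_continuous Real.continuous_fourierChar
      (by exact continuous_inner) h1).locallyIntegrable
  · let ψ : 𝓢(ℝ, ℂ) := HasCompactSupport.toSchwartzMap (f := fun x => (φ x : ℂ))
      (hc.comp_left (g := fun y : ℝ => (y : ℂ)) (by simp)) (Complex.ofRealCLM.contDiff.comp hφ)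
    have hψ : ∀ x, ψ x = (φ x : ℂ) := fun x => rfl
    have e := congrArg (fun D : 𝓢'(ℝ, F) => D ψ) (Lp.fourier_toTemperedDistribution_eq (h2.toLp g))
    simp only [TemperedDistribution.fourier_apply, Lp.toTemperedDistribution_apply] at e
    have e1 : ∀ x, φ x • (𝓕 (h2.toLp g) : Lp F 2 (volume : Measure ℝ)) x
        = ψ x • (𝓕 (h2.toLp g) : Lp F 2 (volume : Measure ℝ)) x := fun x => by
      rw [hψ, Complex.coe_smul]
    simp only [e1]
    rw [← e]
    have e2 : ∫ x, (𝓕 ψ) x • (h2.toLp g : ℝ → F) x = ∫ x, (𝓕 ψ) x • g x :=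
      integral_congr_ae (by filter_upwards [h2.coeFn_toLp] with x hx; rw [hx])
    rw [e2]
    have e3 := VectorFourier.integral_fourierIntegral_smul_eq_flip (L := innerₗ ℝ) (μ := volume)
      (ν := volume) (f := ψ) (g := g) Real.continuous_fourierChar
      (by exact continuous_inner) ψ.integrable h1
    refine Eq.trans ?_ (e3.trans ?_)
    · rfl
    · refine integral_congr_ae (Eventually.of_forall fun x => ?_)
      simp only [hψ, Complex.coe_smul]
      congr 1
      simp only [flip_innerₗ]
      rfl

lemma lintegral_enorm_fourier {F : Type} [NormedAddCommGroup F] [InnerProductSpace ℂ F]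
    [CompleteSpace F] {g : ℝ → F} (h1 : Integrable g) (h2 : MemLp g 2 volume) :
    ∫⁻ ξ, ‖𝓕 g ξ‖ₑ ^ 2 = ∫⁻ t, ‖g t‖ₑ ^ 2 := by
  have key : ∀ h : Lp F 2 (volume : Measure ℝ), ∫⁻ t, ‖h t‖ₑ ^ 2 = ‖h‖ₑ ^ 2 := by
    intro h
    rw [Lp.enorm_def, eLpNorm_eq_lintegral_rpow_enorm_toReal (by norm_num) (by norm_num)]
    simp only [ENNReal.toReal_ofNat, ENNReal.rpow_ofNat, one_div]
    rw [← ENNReal.rpow_natCast, ← ENNReal.rpow_mul]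
    simp
  have a1 : ∫⁻ ξ, ‖𝓕 g ξ‖ₑ ^ 2
      = ∫⁻ ξ, ‖(𝓕 (h2.toLp g) : Lp F 2 (volume : Measure ℝ)) ξ‖ₑ ^ 2 :=
    lintegral_congr_ae (by filter_upwards [fourier_toLp_ae_eq h1 h2] with x hx; rw [hx])
  have a2 : ∫⁻ t, ‖g t‖ₑ ^ 2 = ∫⁻ ξ, ‖(h2.toLp g : ℝ → F) ξ‖ₑ ^ 2 :=
    lintegral_congr_ae (by filter_upwards [h2.coeFn_toLp] with x hx; rw [hx])
  rw [a1, a2, key, key]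
  congr 1
  rw [← ofReal_norm, ← ofReal_norm, Lp.norm_fourier_eq]

/-- `φ` is measurable on `(0, ∞)` and grows at most like `e^{at}`. -/
structure ExpGrowth {E : Type} [NormedAddCommGroup E] (a : ℝ) (φ : ℝ → E) : Prop where
  meas : AEStronglyMeasurable φ (volume.restrict (Ioi 0))
  bound : ∃ C : ℝ, ∀ t ≥ 0, ‖φ t‖ ≤ C * Real.exp (a * t)

section
variable {E F : Type} [NormedAddCommGroup E] [NormedAddCommGroup F]

lemma ExpGrowth.add {a : ℝ} {φ ψ : ℝ → E} (h : ExpGrowth a φ) (h' : ExpGrowth a ψ) :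
    ExpGrowth a (fun t => φ t + ψ t) := by
  obtain ⟨C, hC⟩ := h.bound
  obtain ⟨C', hC'⟩ := h'.bound
  refine ⟨h.meas.add h'.meas, C + C', fun t ht => ?_⟩
  rw [add_mul]
  exact norm_add_le_of_le (hC t ht) (hC' t ht)

lemma ExpGrowth.sub {a : ℝ} {φ ψ : ℝ → E} (h : ExpGrowth a φ) (h' : ExpGrowth a ψ) :
    ExpGrowth a (fun t => φ t - ψ t) := by
  obtain ⟨C, hC⟩ := h.bound
  obtain ⟨C', hC'⟩ := h'.bound
  refine ⟨h.meas.sub h'.meas, C + C', fun t ht => ?_⟩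
  rw [add_mul]
  exact norm_sub_le_of_le (hC t ht) (hC' t ht)

lemma ExpGrowth.clm {𝕜 : Type} [NontriviallyNormedField 𝕜] [NormedSpace 𝕜 E] [NormedSpace 𝕜 F]
    {a : ℝ} {φ : ℝ → E} (h : ExpGrowth a φ) (L : E →L[𝕜] F) : ExpGrowth a (fun t => L (φ t)) := by
  obtain ⟨C, hC⟩ := h.bound
  refine ⟨L.continuous.comp_aestronglyMeasurable h.meas, ‖L‖ * C, fun t ht => ?_⟩
  rw [mul_assoc]
  exact (L.le_opNorm _).trans (by gcongr; exact hC t ht)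

end

/-- The Laplace transform of a function on `(0, ∞)`. -/
def lap {E : Type} [NormedAddCommGroup E] [NormedSpace ℂ E] (s : ℂ) (φ : ℝ → E) : E :=
  ∫ t in Ioi (0 : ℝ), Complex.exp (-s * t) • φ t

section
variable {E F : Type} [NormedAddCommGroup E] [NormedSpace ℂ E]
  [NormedAddCommGroup F] [NormedSpace ℂ F]

lemma norm_cexp_neg_mul (s : ℂ) (t : ℝ) : ‖Complex.exp (-s * t)‖ = Real.exp (-s.re * t) := by
  rw [Complex.norm_exp]
  simp

lemma ExpGrowth.integrableOn {a : ℝ} {φ : ℝ → E} (h : ExpGrowth a φ) {s : ℂ} (hs : a < s.re) :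
    IntegrableOn (fun t : ℝ => Complex.exp (-s * t) • φ t) (Ioi 0) := by
  obtain ⟨C, hC⟩ := h.bound
  have hi : IntegrableOn (fun t : ℝ => C * Real.exp (-(s.re - a) * t)) (Ioi 0) :=
    (integrableOn_exp_mul_Ioi (by linarith) 0).const_mul C
  refine Integrable.mono' hi ?_ ?_
  · exact AEStronglyMeasurable.smul (by fun_prop) h.meas
  · filter_upwards [ae_restrict_mem measurableSet_Ioi] with t ht
    rw [norm_smul, norm_cexp_neg_mul]
    calc _ ≤ Real.exp (-s.re * t) * (C * Real.exp (a * t)) := by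
          gcongr; exact hC t (le_of_lt ht)
      _ = C * (Real.exp (-s.re * t) * Real.exp (a * t)) := by ring
      _ = _ := by rw [← Real.exp_add]; ring_nf

lemma lap_add {a : ℝ} {φ ψ : ℝ → E} (h : ExpGrowth a φ) (h' : ExpGrowth a ψ) {s : ℂ}
    (hs : a < s.re) : lap s (fun t => φ t + ψ t) = lap s φ + lap s ψ := by
  simp only [lap, smul_add]
  exact integral_add (h.integrableOn hs) (h'.integrableOn hs)

lemma lap_sub {a : ℝ} {φ ψ : ℝ → E} (h : ExpGrowth a φ) (h' : ExpGrowth a ψ) {s : ℂ}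
    (hs : a < s.re) : lap s (fun t => φ t - ψ t) = lap s φ - lap s ψ := by
  simp only [lap, smul_sub]
  exact integral_sub (h.integrableOn hs) (h'.integrableOn hs)

lemma lap_congr {φ ψ : ℝ → E} (h : ∀ t ≥ 0, φ t = ψ t) (s : ℂ) : lap s φ = lap s ψ :=
  setIntegral_congr_fun measurableSet_Ioi fun t ht => by
    rw [h t (le_of_lt ht)]

lemma lap_clm [CompleteSpace E] [CompleteSpace F] {a : ℝ} {φ : ℝ → E} (h : ExpGrowth a φ) {s : ℂ}
    (hs : a < s.re) (L : E →L[ℂ] F) : lap s (fun t => L (φ t)) = L (lap s φ) := by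
  rw [lap, lap, ← L.integral_comp_comm (h.integrableOn hs)]
  simp

lemma ExpGrowth.tendsto_zero {a : ℝ} {φ : ℝ → E} (h : ExpGrowth a φ) {s : ℂ} (hs : a < s.re) :
    Tendsto (fun t : ℝ => Complex.exp (-s * t) • φ t) atTop (𝓝 0) := by
  obtain ⟨C, hC⟩ := h.bound
  have hlim : Tendsto (fun t : ℝ => C * Real.exp (-(s.re - a) * t)) atTop (𝓝 0) := by
    have h0 : 0 < s.re - a := by linarith
    have h1 : Tendsto (fun t : ℝ => -((s.re - a) * t)) atTop atBot :=
      tendsto_neg_atTop_atBot.comp (tendsto_id.const_mul_atTop h0)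
    have := (Real.tendsto_exp_atBot.comp h1).const_mul C
    simpa only [Function.comp_def, neg_mul, mul_zero] using this
  refine squeeze_zero_norm' ?_ hlim
  filter_upwards [eventually_ge_atTop 0] with t ht
  rw [norm_smul, norm_cexp_neg_mul]
  calc _ ≤ Real.exp (-s.re * t) * (C * Real.exp (a * t)) := by
        gcongr; exact hC t ht
    _ = C * (Real.exp (-s.re * t) * Real.exp (a * t)) := by ring
    _ = _ := by rw [← Real.exp_add]; ring_nf

/-- The Laplace transform turns (right) derivatives into multiplications by `s`. -/
lemma lap_deriv [CompleteSpace E] {a : ℝ} {φ φ' : ℝ → E} (h : ExpGrowth a φ)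
    (h' : ExpGrowth a φ') (hc : ContinuousOn φ (Ici 0))
    (hd : ∀ t ≥ 0, HasDerivWithinAt φ (φ' t) (Ici t) t) (h0 : φ 0 = 0) {s : ℂ} (hs : a < s.re) :
    lap s φ' = s • lap s φ := by
  have hI : IntegrableOn (fun t : ℝ => Complex.exp (-s * t) • (φ' t)
      - s • (Complex.exp (-s * t) • φ t)) (Ioi 0) :=
    (h'.integrableOn hs).sub ((h.integrableOn hs).smul s)
  -- The integrand is the right derivative of `e^{-st} φ(t)`. The fundamental theorem only needs a
  -- right derivative, so piecewise smooth functions such as `δ` are covered.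
  have hFTC : ∀ T ≥ (0 : ℝ), ∫ t in (0 : ℝ)..T, (Complex.exp (-s * t) • (φ' t)
      - s • (Complex.exp (-s * t) • φ t)) = Complex.exp (-s * T) • φ T := by
    intro T hT
    have hcexp : Continuous fun t : ℝ => Complex.exp (-s * t) := by fun_prop
    have := intervalIntegral.integral_eq_sub_of_hasDeriv_right_of_le hT
      (f := fun t : ℝ => Complex.exp (-s * t) • φ t)
      (f' := fun t : ℝ => Complex.exp (-s * t) • (φ' t) - s • (Complex.exp (-s * t) • φ t))
      (hcexp.continuousOn.smul (hc.mono Icc_subset_Ici_self))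
      (fun t ht => ?_) ?_
    · simpa [h0] using this
    · have he : HasDerivAt (fun t : ℝ => Complex.exp (-s * t)) (Complex.exp (-s * t) * (-s)) t := by
        have h1 : HasDerivAt (fun t : ℝ => -s * (t : ℂ)) (-s) t := by
          simpa using (Complex.ofRealCLM.hasDerivAt (x := t)).const_mul (-s)
        exact h1.cexp
      have := he.hasDerivWithinAt.smul ((hd t ht.1.le).mono Ioi_subset_Ici_self)
      refine HasDerivWithinAt.congr_deriv this ?_
      rw [smul_smul, mul_comm s, mul_neg, neg_smul, sub_eq_add_neg]
    · rw [intervalIntegrable_iff_integrableOn_Ioc_of_le hT]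
      exact hI.mono_set Ioc_subset_Ioi_self
  have hlim1 := intervalIntegral_tendsto_integral_Ioi 0 hI tendsto_id
  have hlim2 : Tendsto (fun T : ℝ => ∫ t in (0 : ℝ)..T, (Complex.exp (-s * t) • (φ' t)
      - s • (Complex.exp (-s * t) • φ t))) atTop (𝓝 0) := by
    refine (h.tendsto_zero hs).congr' ?_
    filter_upwards [eventually_ge_atTop 0] with T hT
    exact (hFTC T hT).symm
  have := tendsto_nhds_unique hlim1 hlim2
  rw [integral_sub (h'.integrableOn hs) (by exact (h.integrableOn hs).smul s),
    integral_smul] at this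
  exact sub_eq_zero.1 this

end

/-- Plancherel's identity for the Laplace transform. -/
lemma lintegral_enorm_lap {E : Type} [NormedAddCommGroup E] [InnerProductSpace ℂ E]
    [CompleteSpace E] {a ρ : ℝ} (ha : a < ρ) {φ : ℝ → E} (h : ExpGrowth a φ) :
    ∫⁻ ξ : ℝ, ‖lap (ρ + (2 * Real.pi * ξ : ℝ) * Complex.I) φ‖ₑ ^ 2
      = ∫⁻ t in Ici (0 : ℝ), ‖φ t‖ₑ ^ 2 * ENNReal.ofReal (Real.exp (-2 * ρ * t)) := by
  -- With `s = ρ + 2πiξ` the Laplace transform of `φ` is the Fourier transform at `ξ` of this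
  -- extension by zero. As `g` is integrable and bounded, it is also square integrable.
  let g : ℝ → E := (Ioi (0 : ℝ)).indicator fun t => Complex.exp (-(ρ : ℂ) * t) • φ t
  have hg1 : Integrable g :=
    (h.integrableOn (s := ρ) (by simpa using ha)).integrable_indicator measurableSet_Ioi
  have hg2 : MemLp g 2 volume := by
    obtain ⟨C, hC⟩ := h.bound
    have hC0 : 0 ≤ C := by simpa using (norm_nonneg _).trans (hC 0 le_rfl)
    have hgC : ∀ t, ‖g t‖ ≤ C := fun t => by
      by_cases ht : t ∈ Ioi (0 : ℝ)
      · have ht0 : 0 < t := ht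
        simp only [g, indicator_of_mem ht]
        rw [norm_smul, norm_cexp_neg_mul]
        calc _ ≤ Real.exp (-ρ * t) * (C * Real.exp (a * t)) := by
              gcongr
              · simp
              · exact hC t ht0.le
          _ = C * Real.exp (-ρ * t + a * t) := by rw [Real.exp_add]; ring
          _ ≤ C * 1 := by
              gcongr
              rw [Real.exp_le_one_iff]
              nlinarith
          _ = C := mul_one C
      · simpa [g, indicator_of_notMem ht] using hC0
    refine (memLp_two_iff_integrable_sq_norm hg1.aestronglyMeasurable).2 ?_
    refine (hg1.norm.const_mul C).mono' (hg1.aestronglyMeasurable.norm.pow 2) ?_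
    refine Eventually.of_forall fun t => ?_
    rw [Real.norm_of_nonneg (by positivity), sq]
    exact mul_le_mul_of_nonneg_right (hgC t) (norm_nonneg _)
  have e1 : ∀ ξ : ℝ, lap (ρ + (2 * Real.pi * ξ : ℝ) * Complex.I) φ = 𝓕 g ξ := by
    intro ξ
    rw [Real.fourier_real_eq_integral_exp_smul, lap, ← integral_indicator measurableSet_Ioi]
    congr 1
    ext t
    by_cases ht : t ∈ Ioi (0 : ℝ)
    · simp only [g, indicator_of_mem ht, smul_smul, ← Complex.exp_add]
      congr 2
      push_cast
      ring
    · simp [g, indicator_of_notMem ht]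
  simp only [e1]
  rw [lintegral_enorm_fourier hg1 hg2, setLIntegral_congr Ioi_ae_eq_Ici.symm,
    ← lintegral_indicator measurableSet_Ioi]
  congr 1
  ext t
  by_cases ht : t ∈ Ioi (0 : ℝ)
  · simp only [g, indicator_of_mem ht, enorm_smul, mul_pow]
    rw [mul_comm, ← ofReal_norm (Complex.exp _), norm_cexp_neg_mul,
      ← ENNReal.ofReal_pow (by positivity),
      ← Real.exp_nat_mul]
    congr 3
    simp
    ring
  · simp [g, indicator_of_notMem ht]

end Laplace

/-! ### Piecewise polynomial functions of time -/

section Piecewise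
open Filter Topology
variable {Y : Type} [NormedAddCommGroup Y] [NormedSpace ℝ Y]

/-- The function that is on `[nτ, (n+1)τ)` the quartic polynomial in `x = t - nτ` with derivatives
`A n`, …, `E n` at `x = 0`. -/
def pwPoly (τ : ℝ) (A B C D E : ℤ → Y) (t : ℝ) : Y :=
  A (timeIndex τ t) + (t - timeIndex τ t * τ) • B (timeIndex τ t)
    + ((t - timeIndex τ t * τ) ^ 2 / 2) • C (timeIndex τ t)
    + ((t - timeIndex τ t * τ) ^ 3 / 6) • D (timeIndex τ t)
    + ((t - timeIndex τ t * τ) ^ 4 / 24) • E (timeIndex τ t)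

lemma timeIndex_eq {τ t : ℝ} (hτ : 0 < τ) {n : ℤ} (h1 : n * τ ≤ t) (h2 : t < (n + 1) * τ) :
    timeIndex τ t = n := by
  rw [timeIndex, Int.floor_eq_iff]
  exact ⟨(le_div_iff₀ hτ).2 h1, (div_lt_iff₀ hτ).2 h2⟩

lemma timeIndex_mul_le {τ : ℝ} (hτ : 0 < τ) (t : ℝ) : timeIndex τ t * τ ≤ t :=
  (le_div_iff₀ hτ).1 (Int.floor_le _)

lemma lt_timeIndex_mul {τ : ℝ} (hτ : 0 < τ) (t : ℝ) : t < (timeIndex τ t + 1) * τ :=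
  (div_lt_iff₀ hτ).1 (Int.lt_floor_add_one _)

lemma pwPoly_of_mem_Ico {τ t : ℝ} (hτ : 0 < τ) (A B C D E : ℤ → Y) {n : ℤ} (h1 : n * τ ≤ t)
    (h2 : t < (n + 1) * τ) : pwPoly τ A B C D E t = A n + (t - n * τ) • B n
      + ((t - n * τ) ^ 2 / 2) • C n + ((t - n * τ) ^ 3 / 6) • D n
      + ((t - n * τ) ^ 4 / 24) • E n := by
  rw [pwPoly, timeIndex_eq hτ h1 h2]

/-- Differentiation shifts the Taylor coefficients. Since the intervals are closed on the left, the
right derivative exists at the nodes too, without any matching condition. -/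
lemma hasDerivWithinAt_pwPoly {τ : ℝ} (hτ : 0 < τ) (A B C D E : ℤ → Y) (t : ℝ) :
    HasDerivWithinAt (pwPoly τ A B C D E) (pwPoly τ B C D E 0 t) (Ici t) t := by
  set n := timeIndex τ t with hn
  have h1 : n * τ ≤ t := timeIndex_mul_le hτ t
  have h2 : t < (n + 1) * τ := lt_timeIndex_mul hτ t
  have hx : HasDerivAt (fun s : ℝ => s - n * τ) 1 t := (hasDerivAt_id t).sub_const _
  have hpoly : HasDerivAt (fun s : ℝ => A n + (s - n * τ) • B n + ((s - n * τ) ^ 2 / 2) • C n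
      + ((s - n * τ) ^ 3 / 6) • D n + ((s - n * τ) ^ 4 / 24) • E n)
      (pwPoly τ B C D E 0 t) t := by
    have := ((((hasDerivAt_const t (A n)).add (hx.smul_const (B n))).add
      (((hx.pow 2).div_const 2).smul_const (C n))).add
      (((hx.pow 3).div_const 6).smul_const (D n))).add
      (((hx.pow 4).div_const 24).smul_const (E n))
    refine HasDerivAt.congr_deriv this ?_
    rw [pwPoly_of_mem_Ico hτ _ _ _ _ _ h1 h2, Pi.zero_apply]
    push_cast
    match_scalars <;> ring
  refine hpoly.hasDerivWithinAt.congr_of_eventuallyEq ?_ (pwPoly_of_mem_Ico hτ _ _ _ _ _ h1 h2)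
  filter_upwards [Ico_mem_nhdsGE h2] with s hs
  exact pwPoly_of_mem_Ico hτ _ _ _ _ _ (h1.trans hs.1) hs.2

/-- Continuity from the right is automatic; `hm` says that each polynomial ends at the value with
which the next one starts. -/
lemma continuous_pwPoly {τ : ℝ} (hτ : 0 < τ) {A B C D E : ℤ → Y}
    (hm : ∀ n, A n + τ • B n + (τ ^ 2 / 2) • C n + (τ ^ 3 / 6) • D n + (τ ^ 4 / 24) • E n
      = A (n + 1)) : Continuous (pwPoly τ A B C D E) := by
  refine continuous_iff_continuousAt.2 fun t => continuousAt_iff_continuous_left_right.2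
    ⟨?_, (hasDerivWithinAt_pwPoly hτ A B C D E t).continuousWithinAt⟩
  -- The index with `mτ < t ≤ (m+1)τ`: for continuity from the left, a node belongs to the interval
  -- that it closes.
  set m : ℤ := ⌈t / τ⌉ - 1 with hmdef
  have h1 : m * τ < t := by
    rw [← lt_div_iff₀ hτ, hmdef]
    push_cast
    linarith [Int.ceil_lt_add_one (t / τ)]
  have h2 : t ≤ (m + 1) * τ := by
    rw [← div_le_iff₀ hτ, hmdef]
    push_cast
    linarith [Int.le_ceil (t / τ)]
  have heq : ∀ s, m * τ ≤ s → s ≤ (m + 1) * τ → pwPoly τ A B C D E s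
      = A m + (s - m * τ) • B m + ((s - m * τ) ^ 2 / 2) • C m
      + ((s - m * τ) ^ 3 / 6) • D m + ((s - m * τ) ^ 4 / 24) • E m := by
    intro s hs1 hs2
    rcases hs2.lt_or_eq with h | h
    · exact pwPoly_of_mem_Ico hτ _ _ _ _ _ hs1 h
    · rw [pwPoly_of_mem_Ico hτ A B C D E (n := m + 1) (by push_cast; linarith)
        (by push_cast; nlinarith)]
      have e1 : s - (m + 1 : ℤ) * τ = 0 := by push_cast; linarith
      have e2 : s - m * τ = τ := by linarith
      rw [e1, e2, hm]
      simp
  have hc : ContinuousWithinAt (fun s : ℝ => A m + (s - m * τ) • B m + ((s - m * τ) ^ 2 / 2) • C m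
      + ((s - m * τ) ^ 3 / 6) • D m + ((s - m * τ) ^ 4 / 24) • E m) (Iic t) t := by
    refine Continuous.continuousWithinAt ?_
    fun_prop
  refine hc.congr_of_eventuallyEq ?_ (heq t h1.le h2)
  filter_upwards [Ioc_mem_nhdsLE h1] with s hs
  exact heq s hs.1.le (hs.2.trans h2)

/-- A continuous right derivative of a continuous function is a derivative. -/
lemma hasDerivAt_of_right [CompleteSpace Y] {F F' : ℝ → Y} (hF : Continuous F)
    (hF' : Continuous F') (h : ∀ t, HasDerivWithinAt F (F' t) (Ici t) t) (t : ℝ) :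
    HasDerivAt F (F' t) t := by
  have h1 : ∀ y, t - 1 ≤ y → F y = F (t - 1) + ∫ s in (t - 1)..y, F' s := by
    intro y hy
    rw [intervalIntegral.integral_eq_sub_of_hasDeriv_right_of_le hy hF.continuousOn
      (fun s _ => (h s).mono Ioi_subset_Ici_self) (hF'.intervalIntegrable _ _)]
    abel
  have h2 : HasDerivAt (fun y => F (t - 1) + ∫ s in (t - 1)..y, F' s) (F' t) t :=
    (intervalIntegral.integral_hasDerivAt_right (hF'.intervalIntegrable _ _)
      (hF'.stronglyMeasurableAtFilter _ _) hF'.continuousAt).const_add _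
  refine h2.congr_of_eventuallyEq ?_
  filter_upwards [Ici_mem_nhds (sub_one_lt t)] with y hy
  exact h1 y hy

/-- Geometric growth of a sequence, at the rate `e^{aτ}`. -/
def SeqGrowth {Z : Type} [NormedAddCommGroup Z] (a τ : ℝ) (A : ℤ → Z) : Prop :=
  ∃ K : ℝ, ∀ n : ℤ, ‖A n‖ ≤ K * Real.exp (a * (n * τ))

lemma SeqGrowth.add {a τ : ℝ} {Z : Type} [NormedAddCommGroup Z] {A B : ℤ → Z}
    (hA : SeqGrowth a τ A) (hB : SeqGrowth a τ B) :
    SeqGrowth a τ fun n => A n + B n := by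
  obtain ⟨K, hK⟩ := hA
  obtain ⟨K', hK'⟩ := hB
  refine ⟨K + K', fun n => ?_⟩
  rw [add_mul]
  exact norm_add_le_of_le (hK n) (hK' n)

lemma SeqGrowth.sub {a τ : ℝ} {Z : Type} [NormedAddCommGroup Z] {A B : ℤ → Z}
    (hA : SeqGrowth a τ A) (hB : SeqGrowth a τ B) :
    SeqGrowth a τ fun n => A n - B n := by
  obtain ⟨K, hK⟩ := hA
  obtain ⟨K', hK'⟩ := hB
  refine ⟨K + K', fun n => ?_⟩
  rw [add_mul]
  exact norm_sub_le_of_le (hK n) (hK' n)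

lemma SeqGrowth.smul {a τ : ℝ} {A : ℤ → Y} (hA : SeqGrowth a τ A) (c : ℝ) :
    SeqGrowth a τ fun n => c • A n := by
  obtain ⟨K, hK⟩ := hA
  refine ⟨|c| * K, fun n => ?_⟩
  rw [norm_smul, mul_assoc, Real.norm_eq_abs]
  gcongr
  exact hK n

lemma SeqGrowth.shift {a τ : ℝ} {Z : Type} [NormedAddCommGroup Z] {A : ℤ → Z}
    (hA : SeqGrowth a τ A) (m : ℤ) :
    SeqGrowth a τ fun n => A (n + m) := by
  obtain ⟨K, hK⟩ := hA
  refine ⟨K * Real.exp (a * (m * τ)), fun n => (hK _).trans (le_of_eq ?_)⟩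
  rw [mul_assoc, ← Real.exp_add]
  push_cast
  ring_nf

lemma SeqGrowth.shift_neg {a τ : ℝ} {Z : Type} [NormedAddCommGroup Z] {A : ℤ → Z}
    (hA : SeqGrowth a τ A) (m : ℤ) :
    SeqGrowth a τ fun n => A (n - m) := by
  simpa only [sub_eq_add_neg] using hA.shift (-m)

lemma SeqGrowth.zero {Z : Type} [NormedAddCommGroup Z] (a τ : ℝ) :
    SeqGrowth a τ (0 : ℤ → Z) := ⟨0, by simp⟩

/-- Since `a ≥ 0`, the rate `e^{anτ}` at the left end of the interval is at most `e^{at}`. -/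
lemma SeqGrowth.expGrowth {a τ : ℝ} (ha : 0 ≤ a) (hτ : 0 < τ) {A : ℤ → Y} (hA : SeqGrowth a τ A)
    {c : ℝ → ℝ} (hc : Measurable c) {M : ℝ} (hM : ∀ t, |c t| ≤ M) :
    ExpGrowth a fun t => c t • A (timeIndex τ t) := by
  obtain ⟨K, hK⟩ := hA
  have hK0 : 0 ≤ K := by simpa using (norm_nonneg _).trans (hK 0)
  have hmeas : StronglyMeasurable fun t : ℝ => A (timeIndex τ t) := by
    have h1 : Measurable fun t : ℝ => timeIndex τ t :=
      Int.measurable_floor.comp (measurable_id.div_const τ)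
    exact StronglyMeasurable.comp_measurable (StronglyMeasurable.of_discrete (f := A)) h1
  refine ⟨(hc.stronglyMeasurable.smul hmeas).aestronglyMeasurable, M * K, fun t _ => ?_⟩
  rw [norm_smul, mul_assoc, Real.norm_eq_abs]
  refine mul_le_mul (hM t) ((hK _).trans ?_) (norm_nonneg _) ((abs_nonneg _).trans (hM t))
  gcongr
  exact timeIndex_mul_le hτ t

lemma expGrowth_pwPoly {a τ : ℝ} (ha : 0 ≤ a) (hτ : 0 < τ) {A B C D E : ℤ → Y}
    (hA : SeqGrowth a τ A) (hB : SeqGrowth a τ B) (hC : SeqGrowth a τ C) (hD : SeqGrowth a τ D)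
    (hE : SeqGrowth a τ E) : ExpGrowth a (pwPoly τ A B C D E) := by
  have hm : Measurable fun t : ℝ => t - timeIndex τ t * τ := by
    have h1 : Measurable fun t : ℝ => timeIndex τ t :=
      Int.measurable_floor.comp (measurable_id.div_const τ)
    have h2 : Measurable fun t : ℝ => (timeIndex τ t : ℝ) :=
      (measurable_from_top (f := fun n : ℤ => (n : ℝ))).comp h1
    exact measurable_id.sub (h2.mul_const τ)
  have hx0 : ∀ t : ℝ, 0 ≤ t - timeIndex τ t * τ := fun t => by linarith [timeIndex_mul_le hτ t]
  have hx1 : ∀ t : ℝ, t - timeIndex τ t * τ ≤ τ := fun t => by linarith [lt_timeIndex_mul hτ t]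
  have hb : ∀ k : ℕ, ∀ c : ℝ, 0 < c → ∀ t : ℝ, |(t - timeIndex τ t * τ) ^ k / c| ≤ τ ^ k / c := by
    intro k c hc t
    rw [abs_of_nonneg (div_nonneg (pow_nonneg (hx0 t) _) hc.le)]
    gcongr
    · exact hx0 t
    · exact hx1 t
  have e0 : ExpGrowth a fun t => A (timeIndex τ t) := by
    simpa using hA.expGrowth ha hτ measurable_const (c := fun _ => 1) (M := 1) (by simp)
  have e1 := hB.expGrowth ha hτ hm (M := τ)
    fun t => by rw [abs_of_nonneg (hx0 t)]; exact hx1 t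
  have e2 := hC.expGrowth ha hτ ((hm.pow_const 2).div_const 2) (hb 2 2 (by norm_num))
  have e3 := hD.expGrowth ha hτ ((hm.pow_const 3).div_const 6) (hb 3 6 (by norm_num))
  have e4 := hE.expGrowth ha hτ ((hm.pow_const 4).div_const 24) (hb 4 24 (by norm_num))
  exact (((e0.add e1).add e2).add e3).add e4

end Piecewise

/-! ### The time reconstructions -/

section Recon
variable {Y : Type} [NormedAddCommGroup Y] [NormedSpace ℝ Y]

/-- `(W^{n+1} - 2W^n + W^{n-1}) / τ²`. -/
def secondDiff (τ : ℝ) (W : ℤ → Y) (n : ℤ) : Y :=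
  (1 / τ ^ 2) • (W (n + 1) - (2 : ℝ) • W n + W (n - 1))

/-- The coefficient `(W^{n+1} - W^{n-1}) / 2τ`. -/
def centralDiff (τ : ℝ) (W : ℤ → Y) (n : ℤ) : Y := (1 / (2 * τ)) • (W (n + 1) - W (n - 1))

/-- The coefficient `α` of `L(W)`. -/
def coeffα (W : ℤ → Y) (n : ℤ) : Y := (1 / 24 : ℝ) •
  ((3 : ℝ) • W (n + 1) + (17 : ℝ) • W n + (5 : ℝ) • W (n - 1) - W (n - 2))

/-- The coefficient `β` of `L(W)`. -/
def coeffβ (τ : ℝ) (W : ℤ → Y) (n : ℤ) : Y := (1 / (12 * τ)) •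
  ((5 : ℝ) • W (n + 1) + (3 : ℝ) • W n - (9 : ℝ) • W (n - 1) + W (n - 2))

/-- The coefficient `ϑ` of `L(W)`. -/
def coeffθ (τ : ℝ) (W : ℤ → Y) (n : ℤ) : Y := (1 / (2 * τ ^ 3)) •
  (W (n + 2) - (2 : ℝ) • W (n + 1) + (2 : ℝ) • W (n - 1) - W (n - 2))

/-- The coefficient `ε` of `L(W)`. -/
def coeffε (τ : ℝ) (W : ℤ → Y) (n : ℤ) : Y := (1 / τ ^ 4) •
  (W (n + 2) - (4 : ℝ) • W (n + 1) + (6 : ℝ) • W n - (4 : ℝ) • W (n - 1) + W (n - 2))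

lemma reconL_eq (τ : ℝ) (V : ℕ → Y) : reconL τ V = pwPoly τ (coeffα (zeroExt V))
    (coeffβ τ (zeroExt V)) (secondDiff τ (zeroExt V)) (coeffθ τ (zeroExt V))
    (coeffε τ (zeroExt V)) := rfl

lemma reconR_eq (τ : ℝ) (V : ℕ → Y) : reconR τ V = pwPoly τ (zeroExt V)
    (centralDiff τ (zeroExt V)) (secondDiff τ (zeroExt V)) 0 0 := by
  ext t
  simp only [reconR, pwPoly, centralDiff, secondDiff, Pi.zero_apply, smul_zero, add_zero, smul_smul]
  congr 3 <;> ring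

/-- This and the next two lemmas are the matching conditions at the nodes for `L(W)`, `L(W)'` and
`L(W)''`; together they make `L(W)` twice continuously differentiable. -/
lemma continuous_reconL_aux {τ : ℝ} (hτ : 0 < τ) (W : ℤ → Y) :
    Continuous (pwPoly τ (coeffα W) (coeffβ τ W) (secondDiff τ W)
    (coeffθ τ W) (coeffε τ W)) := by
  refine continuous_pwPoly hτ fun n => ?_
  simp only [coeffα, coeffβ, secondDiff, coeffθ, coeffε, show n + 1 + 1 = n + 2 by ring,
    show n + 1 - 1 = n by ring, show n + 1 - 2 = n - 1 by ring]
  match_scalars <;> field_simp <;> ring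

lemma continuous_reconL_deriv_aux {τ : ℝ} (hτ : 0 < τ) (W : ℤ → Y) :
    Continuous (pwPoly τ (coeffβ τ W) (secondDiff τ W)
    (coeffθ τ W) (coeffε τ W) 0) := by
  refine continuous_pwPoly hτ fun n => ?_
  simp only [coeffβ, secondDiff, coeffθ, coeffε, show n + 1 + 1 = n + 2 by ring,
    show n + 1 - 1 = n by ring, show n + 1 - 2 = n - 1 by ring, Pi.zero_apply]
  match_scalars <;> field_simp <;> ring

lemma continuous_reconL_deriv2_aux {τ : ℝ} (hτ : 0 < τ) (W : ℤ → Y) :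
    Continuous (pwPoly τ (secondDiff τ W)
    (coeffθ τ W) (coeffε τ W) 0 0) := by
  refine continuous_pwPoly hτ fun n => ?_
  simp only [secondDiff, coeffθ, coeffε, show n + 1 + 1 = n + 2 by ring,
    show n + 1 - 1 = n by ring, Pi.zero_apply]
  match_scalars <;> field_simp <;> ring

lemma continuous_reconR_aux {τ : ℝ} (hτ : 0 < τ) (W : ℤ → Y) :
    Continuous (pwPoly τ W (centralDiff τ W) (secondDiff τ W) 0 0) := by
  refine continuous_pwPoly hτ fun n => ?_
  simp only [centralDiff, secondDiff, Pi.zero_apply]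
  match_scalars <;> field_simp <;> ring

/-- `L(W)'' = R(D)` where `D` is the sequence of second differences of `W`. -/
lemma reconL_deriv2_eq {τ : ℝ} (hτ : 0 < τ) (W : ℤ → Y) :
    pwPoly τ (secondDiff τ W) (coeffθ τ W) (coeffε τ W) 0 0
    = pwPoly τ (secondDiff τ W) (centralDiff τ (secondDiff τ W))
      (secondDiff τ (secondDiff τ W)) 0 0 := by
  have h1 : coeffθ τ W = centralDiff τ (secondDiff τ W) := by
    ext n
    simp only [coeffθ, centralDiff, secondDiff, show n + 1 + 1 = n + 2 by ring,
      show n + 1 - 1 = n by ring, show n - 1 + 1 = n by ring, show n - 1 - 1 = n - 2 by ring]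
    match_scalars <;> field_simp <;> ring
  have h2 : coeffε τ W = secondDiff τ (secondDiff τ W) := by
    ext n
    simp only [coeffε, secondDiff, show n + 1 + 1 = n + 2 by ring,
      show n + 1 - 1 = n by ring, show n - 1 + 1 = n by ring, show n - 1 - 1 = n - 2 by ring]
    match_scalars <;> field_simp <;> ring
  rw [h1, h2]

end Recon

/-! ### Growth of the data and of the exact solution -/

section Growth
open Filter Topology

lemma expGrowth_of_continuousOn {E : Type} [NormedAddCommGroup E] {a C : ℝ} {φ : ℝ → E}
    (hc : ContinuousOn φ (Ici 0)) (h : ∀ t ≥ 0, ‖φ t‖ ≤ C * Real.exp (a * t)) : ExpGrowth a φ :=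
  ⟨(hc.mono Ioi_subset_Ici_self).aestronglyMeasurable measurableSet_Ioi, C, h⟩

section
variable {Y : Type} [NormedAddCommGroup Y] [NormedSpace ℝ Y]

lemma timeDeriv_one (v : ℝ → Y) : timeDeriv 1 v = derivWithin v (Ici 0) := by
  ext t
  rw [timeDeriv, iteratedDerivWithin_one]

lemma timeDeriv_succ (r : ℕ) (v : ℝ → Y) :
    timeDeriv (r + 1) v = timeDeriv r (timeDeriv 1 v) := by
  rw [timeDeriv_one]
  ext t
  exact congrFun iteratedDerivWithin_succ' t

lemma hasDerivWithinAt_timeDeriv {v : ℝ → Y} {r : ℕ} (hv : ContDiffOn ℝ (r + 1) v (Ici 0)) {t : ℝ}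
    (ht : 0 ≤ t) : HasDerivWithinAt v (timeDeriv 1 v t) (Ici 0) t := by
  rw [timeDeriv_one]
  exact (hv.differentiableOn (by positivity) t ht).hasDerivWithinAt

lemma contDiffOn_timeDeriv {v : ℝ → Y} {r : ℕ} (hv : ContDiffOn ℝ (r + 1) v (Ici 0)) :
    ContDiffOn ℝ r (timeDeriv 1 v) (Ici 0) := by
  rw [timeDeriv_one]
  exact hv.derivWithin (uniqueDiffOn_Ici 0) le_rfl

lemma timeDeriv_one_eq {v : ℝ → Y} {v' : Y} {t : ℝ} (ht : 0 ≤ t)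
    (h : HasDerivWithinAt v v' (Ici 0) t) : timeDeriv 1 v t = v' := by
  rw [timeDeriv_one]
  exact h.derivWithin (uniqueDiffOn_Ici 0 t ht)

lemma IsCrb.timeDeriv_one {r : ℕ} {v : ℝ → Y} (h : IsCrb (r + 1) v) : IsCrb r (timeDeriv 1 v) := by
  obtain ⟨h1, M, hM⟩ := h
  refine ⟨contDiffOn_timeDeriv (by exact_mod_cast h1), M, fun t ht => ?_⟩
  rw [← timeDeriv_succ r v]
  exact hM t ht

lemma SupportedAwayFromZero.timeDeriv_one {v : ℝ → Y} (h : SupportedAwayFromZero v) :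
    SupportedAwayFromZero (timeDeriv 1 v) := by
  obtain ⟨ε, hε, h0⟩ := h
  refine ⟨ε / 2, by positivity, fun t ht ht' => timeDeriv_one_eq ht ?_⟩
  refine (hasDerivWithinAt_const t (Ici 0) (0 : Y)).congr_of_eventuallyEq ?_
    (h0 t ht (by linarith))
  filter_upwards [inter_mem_nhdsWithin (Ici 0) (Iio_mem_nhds (show t < ε by linarith))] with s hs
  exact h0 s hs.1 hs.2.le

lemma SupportedAwayFromZero.zero {Z : Type} [NormedAddCommGroup Z] {v : ℝ → Z}
    (h : SupportedAwayFromZero v) : v 0 = 0 := by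
  obtain ⟨ε, hε, h0⟩ := h
  exact h0 0 le_rfl hε.le

lemma IsCrb.continuousOn_timeDeriv {r : ℕ} {v : ℝ → Y} (h : IsCrb r v) :
    ContinuousOn (timeDeriv r v) (Ici 0) :=
  h.1.continuousOn_iteratedDerivWithin le_rfl (uniqueDiffOn_Ici 0)

lemma IsCrb.expGrowth_timeDeriv {r : ℕ} {v : ℝ → Y} (h : IsCrb r v) {a : ℝ} (ha : 0 < a) :
    ExpGrowth a (timeDeriv r v) := by
  obtain ⟨M, hM⟩ := h.2
  have hM0 : 0 ≤ M := (norm_nonneg _).trans (hM 0 le_rfl)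
  refine expGrowth_of_continuousOn h.continuousOn_timeDeriv (C := M) fun t ht => (hM t ht).trans ?_
  have : 1 ≤ Real.exp (a * t) := Real.one_le_exp (by positivity)
  nlinarith

/-- Starting from the bounded `r`-th derivative, integrate `r` times from 0, where everything
vanishes. Each integration of `C e^{at}` only costs a factor `1/a`. -/
lemma IsCrb.expGrowth {r : ℕ} {v : ℝ → Y} (h : IsCrb r v) (h0 : SupportedAwayFromZero v) {a : ℝ}
    (ha : 0 < a) : ExpGrowth a v := by
  induction r generalizing v with
  | zero =>
    have : timeDeriv 0 v = v := by
      ext t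
      simp [timeDeriv]
    have h' := h.expGrowth_timeDeriv ha
    rwa [this] at h'
  | succ r ih =>
    obtain ⟨C, hC⟩ := (ih h.timeDeriv_one h0.timeDeriv_one).bound
    have hc : ContinuousOn v (Ici 0) := h.1.continuousOn
    have hC0 : 0 ≤ C := by simpa using (norm_nonneg _).trans (hC 0 le_rfl)
    refine expGrowth_of_continuousOn hc (C := C / a) fun t ht => ?_
    refine image_norm_le_of_norm_deriv_right_le_deriv_boundary (a := 0) (b := t)
      (hc.mono Icc_subset_Ici_self) (f' := timeDeriv 1 v)
      (fun x hx => (hasDerivWithinAt_timeDeriv (r := r) (by exact_mod_cast h.1) hx.1).mono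
        (Ici_subset_Ici.2 hx.1))
      (B := fun t => C / a * Real.exp (a * t)) (B' := fun t => C * Real.exp (a * t))
      ?_ (fun x => ?_) (fun x hx => hC x hx.1) ⟨ht, le_rfl⟩
    · rw [h0.zero, norm_zero]
      positivity
    · have := (((hasDerivAt_id x).const_mul a).exp).const_mul (C / a)
      refine HasDerivAt.congr_deriv this ?_
      simp only [id_eq]
      field_simp

/-- Since `v` vanishes near 0, so do its derivatives, and no initial values appear. -/
lemma lap_timeDeriv {E : Type} [NormedAddCommGroup E] [NormedSpace ℂ E] [CompleteSpace E]
    (L : Y →L[ℝ] E) {r : ℕ} {v : ℝ → Y} (h : IsCrb r v)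
    (h0 : SupportedAwayFromZero v) {s : ℂ} (hs : 0 < s.re) :
    lap s (fun t => L (timeDeriv r v t)) = s ^ r • lap s (fun t => L (v t)) := by
  induction r generalizing v with
  | zero => simp [timeDeriv]
  | succ r ih =>
    have ha : 0 < s.re / 2 := by positivity
    have hd := fun t (ht : t ≥ 0) => hasDerivWithinAt_timeDeriv (v := v) (r := r)
      (by exact_mod_cast h.1) ht
    rw [timeDeriv_succ r v, ih h.timeDeriv_one h0.timeDeriv_one]
    rw [lap_deriv (a := s.re / 2) (φ := fun t => L (v t)) ((h.expGrowth h0 ha).clm L)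
      ((h.timeDeriv_one.expGrowth h0.timeDeriv_one ha).clm L)
      (L.continuous.comp_continuousOn h.1.continuousOn)
      (fun t ht => L.hasFDerivAt.comp_hasDerivWithinAt t ((hd t ht).mono (Ici_subset_Ici.2 ht)))
      (by rw [h0.zero, map_zero]) (by linarith), smul_smul, pow_succ]

end

/-! ### Energy estimates for the exact solution -/

section Wave
variable {d : ℕ} {Ω : Set (EuclideanSpace ℝ (Fin d))} {f : ℝ → L2 Ω ℝ} {u : ℝ → H10 ℝ Ω}

lemma IsWaveSolution.hasDerivWithinAt (hu : IsWaveSolution f u) {t : ℝ} (ht : 0 ≤ t) :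
    HasDerivWithinAt (fun t => val (u t)) (timeDeriv 1 (fun t => val (u t)) t) (Ici 0) t :=
  hasDerivWithinAt_timeDeriv (r := 1) (by exact_mod_cast hu.contDiffOn) ht

lemma IsWaveSolution.hasDerivWithinAt₂ (hu : IsWaveSolution f u) {t : ℝ} (ht : 0 ≤ t) :
    HasDerivWithinAt (timeDeriv 1 fun t => val (u t)) (timeDeriv 2 (fun t => val (u t)) t)
      (Ici 0) t := by
  rw [timeDeriv_succ 1]
  exact hasDerivWithinAt_timeDeriv (r := 0)
    (by exact_mod_cast contDiffOn_timeDeriv (r := 1) (by exact_mod_cast hu.contDiffOn)) ht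

lemma IsWaveSolution.continuousOn_timeDeriv (hu : IsWaveSolution f u) {k : ℕ} (hk : k ≤ 2) :
    ContinuousOn (timeDeriv k fun t => val (u t)) (Ici 0) :=
  hu.contDiffOn.continuousOn_iteratedDerivWithin (by exact_mod_cast hk) (uniqueDiffOn_Ici 0)

/-- The squared gradient norm of a strong solution is differentiable in time. -/
lemma IsWaveSolution.hasDerivWithinAt_norm_grad (hu : IsWaveSolution f u)
    (hf : ContinuousOn f (Ici 0)) {t : ℝ} (ht : 0 ≤ t) :
    HasDerivWithinAt (fun t => ‖grad (u t)‖ ^ 2)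
      (2 * inner ℝ (f t - timeDeriv 2 (fun t => val (u t)) t)
        (timeDeriv 1 (fun t => val (u t)) t)) (Ici 0) t := by
  set g : ℝ → L2 Ω ℝ := fun t => f t - timeDeriv 2 (fun t => val (u t)) t with hg
  have hgc : ContinuousOn g (Ici 0) := hf.sub (hu.continuousOn_timeDeriv le_rfl)
  have heq : ∀ y ≥ 0, ∀ v : H10 ℝ Ω, inner ℝ (grad (u y)) (grad v) = inner ℝ (g y) (val v) := by
    intro y hy v
    rw [hg, inner_sub_left]
    linarith [hu.equation y hy v]
  rw [hasDerivWithinAt_iff_tendsto_slope]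
  have h1 := hasDerivWithinAt_iff_tendsto_slope.1 (hu.hasDerivWithinAt ht)
  have h2 : Tendsto g (𝓝[Ici 0 \ {t}] t) (𝓝 (g t)) :=
    (hgc t ht).tendsto.mono_left (nhdsWithin_mono _ sdiff_subset)
  -- `u` is not known to be differentiable with values in `V`. Instead, `‖∇u(y)‖² - ‖∇u(t)‖² =
  -- (∇u(y) + ∇u(t), ∇(u(y) - u(t)))`, and the equation at both times turns this into `(g(y) + g(t),
  -- u(y) - u(t))`, where the `L²` differentiability of `u` suffices.
  have h3 := (h2.add_const (g t)).inner (𝕜 := ℝ) h1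
  have e : inner ℝ (g t + g t) (timeDeriv 1 (fun t => val (u t)) t)
      = 2 * inner ℝ (g t) (timeDeriv 1 (fun t => val (u t)) t) := by
    rw [inner_add_left]; ring
  rw [e] at h3
  refine h3.congr' ?_
  filter_upwards [self_mem_nhdsWithin] with y hy
  rw [slope_def_module, slope_def_field, inner_smul_right, ← map_sub, inner_add_left,
    ← heq y hy.1, ← heq t ht, map_sub, inner_sub_right, inner_sub_right,
    real_inner_self_eq_norm_sq, real_inner_self_eq_norm_sq, real_inner_comm (grad (u t))]
  ring

/-- The energy `N` satisfies `N' = 2(f, u')`. After multiplication by `e^{-at}` the term `-aN`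
absorbs `u'` by Young's inequality, and what remains of `f` is integrable in time, because `f` may
be taken to grow at the rate `a/4`. -/
lemma IsWaveSolution.energy_le (hu : IsWaveSolution f u) (hf : ContinuousOn f (Ici 0))
    (hg : ∀ a > 0, ExpGrowth a f) {a : ℝ} (ha : 0 < a) : ∃ K : ℝ, ∀ t ≥ 0,
      ‖timeDeriv 1 (fun t => val (u t)) t‖ ^ 2 + ‖grad (u t)‖ ^ 2 ≤ K * Real.exp (a * t) := by
  obtain ⟨C, hC⟩ := (hg (a / 4) (by positivity)).bound
  set p : ℝ → L2 Ω ℝ := timeDeriv 1 fun t => val (u t) with hp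
  set N : ℝ → ℝ := fun t => ‖p t‖ ^ 2 + ‖grad (u t)‖ ^ 2 with hN
  have hNd : ∀ t ≥ 0, HasDerivWithinAt N (2 * inner ℝ (f t) (p t)) (Ici 0) t := by
    intro t ht
    have := (hu.hasDerivWithinAt₂ ht).norm_sq.add (hu.hasDerivWithinAt_norm_grad hf ht)
    refine HasDerivWithinAt.congr_deriv this ?_
    rw [inner_sub_left, real_inner_comm (timeDeriv 2 (fun t => val (u t)) t)]
    ring
  set M : ℝ → ℝ := fun t => N t * Real.exp (-a * t) with hM
  have hMd : ∀ t ≥ 0, HasDerivWithinAt M ((2 * inner ℝ (f t) (p t) - a * N t)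
      * Real.exp (-a * t)) (Ici 0) t := by
    intro t ht
    have := (hNd t ht).mul (((hasDerivAt_id t).const_mul (-a)).exp.hasDerivWithinAt (s := Ici 0))
    refine HasDerivWithinAt.congr_deriv this ?_
    simp only [id_eq]
    ring
  have hbound : ∀ t ≥ 0, (2 * inner ℝ (f t) (p t) - a * N t) * Real.exp (-a * t)
      ≤ C ^ 2 / a * Real.exp (-(a / 2) * t) := by
    intro t ht
    have h1 : inner ℝ (f t) (p t) ≤ ‖f t‖ * ‖p t‖ := real_inner_le_norm _ _
    have h2 : ‖f t‖ ^ 2 ≤ C ^ 2 * Real.exp (a / 2 * t) := by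
      have := pow_le_pow_left₀ (norm_nonneg _) (hC t ht) 2
      rw [mul_pow, ← Real.exp_nat_mul] at this
      refine this.trans (le_of_eq ?_)
      congr 2
      push_cast
      ring
    have h3 : 2 * inner ℝ (f t) (p t) - a * N t ≤ ‖f t‖ ^ 2 / a := by
      rw [le_div_iff₀ ha, hN]
      nlinarith [sq_nonneg (‖f t‖ - a * ‖p t‖), sq_nonneg (‖grad (u t)‖),
        mul_nonneg (mul_nonneg ha.le ha.le) (sq_nonneg ‖grad (u t)‖)]
    calc _ ≤ C ^ 2 * Real.exp (a / 2 * t) / a * Real.exp (-a * t) := by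
          gcongr
          exact h3.trans (by gcongr)
      _ = C ^ 2 / a * (Real.exp (a / 2 * t) * Real.exp (-a * t)) := by ring
      _ = _ := by rw [← Real.exp_add]; ring_nf
  refine ⟨M 0 + 2 * C ^ 2 / a ^ 2, fun t ht => ?_⟩
  have key : M t ≤ M 0 + 2 * C ^ 2 / a ^ 2 * (1 - Real.exp (-(a / 2) * t)) := by
    refine image_le_of_deriv_right_le_deriv_boundary (a := 0) (b := t) (f := M)
      (fun x hx => ((hMd x hx.1).continuousWithinAt).mono Icc_subset_Ici_self)
      (fun x hx => (hMd x hx.1).mono (Ici_subset_Ici.2 hx.1))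
      (B := fun t => M 0 + 2 * C ^ 2 / a ^ 2 * (1 - Real.exp (-(a / 2) * t)))
      (B' := fun t => C ^ 2 / a * Real.exp (-(a / 2) * t)) (by simp) ?_ ?_
      (fun x hx => hbound x hx.1) ⟨ht, le_rfl⟩
    · fun_prop
    · intro x _
      have := (((((hasDerivAt_id x).const_mul (-(a / 2))).exp).const_sub 1).const_mul
        (2 * C ^ 2 / a ^ 2)).const_add (M 0)
      refine (HasDerivAt.congr_deriv this ?_).hasDerivWithinAt
      simp only [id_eq]
      field_simp
  have h2 : M t ≤ M 0 + 2 * C ^ 2 / a ^ 2 := by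
    refine key.trans ?_
    have : 0 < Real.exp (-(a / 2) * t) := Real.exp_pos _
    have : 0 ≤ 2 * C ^ 2 / a ^ 2 := by positivity
    nlinarith
  have h3 : N t = M t * Real.exp (a * t) := by
    rw [hM]
    simp only
    rw [mul_assoc, ← Real.exp_add]
    simp
  change N t ≤ _
  rw [h3]
  gcongr

lemma IsWaveSolution.expGrowth_deriv (hu : IsWaveSolution f u) (hf : ContinuousOn f (Ici 0))
    (hg : ∀ a > 0, ExpGrowth a f) {a : ℝ} (ha : 0 < a) :
    ExpGrowth a (timeDeriv 1 fun t => val (u t)) := by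
  obtain ⟨K, hK⟩ := hu.energy_le hf hg (a := 2 * a) (by positivity)
  refine expGrowth_of_continuousOn (hu.continuousOn_timeDeriv (by norm_num)) (C := √K)
    fun t ht => ?_
  have hK0 : 0 ≤ K := by
    have := hK 0 le_rfl
    simp only [mul_zero, Real.exp_zero, mul_one] at this
    exact (by positivity : (0 : ℝ) ≤ _).trans this
  refine le_of_sq_le_sq ?_ (by positivity)
  rw [mul_pow, Real.sq_sqrt hK0, ← Real.exp_nat_mul]
  have h1 := hK t ht
  have h2 : ((2 : ℕ) : ℝ) * (a * t) = 2 * a * t := by push_cast; ring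
  rw [h2]
  linarith [sq_nonneg ‖grad (u t)‖]

lemma IsWaveSolution.expGrowth (hd : 1 ≤ d) (hΩb : Bornology.IsBounded Ω)
    (hu : IsWaveSolution f u) (hf : ContinuousOn f (Ici 0))
    (hg : ∀ a > 0, ExpGrowth a f) {a : ℝ} (ha : 0 < a) : ExpGrowth a u := by
  obtain ⟨K, hK⟩ := hu.energy_le hf hg (a := 2 * a) (by positivity)
  obtain ⟨C, hC, hP⟩ := exists_poincare hd hΩb
  have hK0 : 0 ≤ K := by
    have := hK 0 le_rfl
    simp only [mul_zero, Real.exp_zero, mul_one] at this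
    exact (by positivity : (0 : ℝ) ≤ _).trans this
  refine expGrowth_of_continuousOn hu.continuousOn (C := √((C ^ 2 + 1) * K)) fun t ht => ?_
  refine le_of_sq_le_sq ?_ (by positivity)
  rw [mul_pow, Real.sq_sqrt (by positivity), ← Real.exp_nat_mul, norm_sq_H10]
  have h1 := hK t ht
  have h2 : ((2 : ℕ) : ℝ) * (a * t) = 2 * a * t := by push_cast; ring
  rw [h2]
  have h3 := pow_le_pow_left₀ (norm_nonneg _) (hP (u t)) 2
  have h4 : ‖grad (u t)‖ ^ 2 ≤ K * Real.exp (2 * a * t) := by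
    linarith [sq_nonneg ‖timeDeriv 1 (fun t => val (u t)) t‖]
  calc _ ≤ (C ^ 2 + 1) * ‖grad (u t)‖ ^ 2 := by linarith [mul_pow C ‖grad (u t)‖ 2]
    _ ≤ (C ^ 2 + 1) * (K * Real.exp (2 * a * t)) := by gcongr
    _ = _ := by ring

end Wave

end Growth

/-! ### The discrete solution -/

section SeqGrowthLemmas
variable {Y : Type} [NormedAddCommGroup Y]

/-- A sequence whose increments grow geometrically does so itself. -/
lemma SeqGrowth.of_diff {a τ : ℝ} (haτ : 0 < a * τ) {A : ℤ → Y} {m : ℤ} (h0 : ∀ n ≤ m, A n = 0)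
    (h : SeqGrowth a τ fun n => A (n + 1) - A n) : SeqGrowth a τ A := by
  obtain ⟨K, hK⟩ := h
  have hK0 : 0 ≤ K := by simpa using (norm_nonneg _).trans (hK 0)
  -- The constant `K / (e^{aτ} - 1)` comes from summing a geometric series: it satisfies `K + K' =
  -- e^{aτ} K'`, which is the induction step.
  have hq : 0 < Real.exp (a * τ) - 1 := by linarith [Real.add_one_lt_exp haτ.ne']
  refine ⟨K / (Real.exp (a * τ) - 1), fun n => ?_⟩
  rcases le_total n m with hn | hn
  · rw [h0 n hn, norm_zero]
    positivity
  · induction n, hn using Int.leInduction with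
    | base =>
      rw [h0 m le_rfl, norm_zero]
      positivity
    | succ n hn ih =>
      have e : a * (((n + 1 : ℤ) : ℝ) * τ) = a * τ + a * (n * τ) := by push_cast; ring
      rw [e, Real.exp_add]
      calc ‖A (n + 1)‖ = ‖(A (n + 1) - A n) + A n‖ := by rw [sub_add_cancel]
        _ ≤ K * Real.exp (a * (n * τ))
            + K / (Real.exp (a * τ) - 1) * Real.exp (a * (n * τ)) := norm_add_le_of_le (hK n) ih
        _ = _ := by field_simp; ring

variable [NormedSpace ℝ Y]

lemma setLIntegral_Ico_comp_add (h : ℝ → ℝ≥0∞) (a b c : ℝ) :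
    ∫⁻ t in Ico a b, h (t + c) = ∫⁻ t in Ico (a + c) (b + c), h t := by
  rw [← lintegral_indicator measurableSet_Ico, ← lintegral_indicator measurableSet_Ico,
    ← lintegral_add_right_eq_self ((Ico (a + c) (b + c)).indicator h) c]
  congr 1
  ext t
  by_cases ht : t ∈ Ico a b
  · rw [indicator_of_mem ht, indicator_of_mem (by simpa using ht)]
  · rw [indicator_of_notMem ht, indicator_of_notMem (by simpa using ht)]

/-- The cubic coefficient of a piecewise cubic function is controlled by the norm of the
function. -/
lemma norm_cubic_coeff_le {τ : ℝ} (hτ : 0 < τ) (A B C D : ℤ → Y) (n : ℤ) :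
    ‖D n‖ₑ ^ 2 * ENNReal.ofReal ((τ / 4) ^ 7)
      ≤ 256 * ∫⁻ t in Ico (n * τ) ((n + 1) * τ), ‖pwPoly τ A B C D 0 t‖ₑ ^ 2 := by
  -- For `t` in the first quarter of the interval the four points `t + jk`, `j ≤ 3`, stay inside it.
  -- The third difference over these points removes the lower order terms of the cubic and leaves
  -- `k³ D n`.
  set k := τ / 4 with hk
  have hk0 : 0 < k := by positivity
  set P := pwPoly τ A B C D 0 with hP
  set I := ∫⁻ t in Ico (n * τ) ((n + 1) * τ), ‖P t‖ₑ ^ 2 with hI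
  have hshift : ∀ j : ℝ, 0 ≤ j → j ≤ 3 →
      ∫⁻ t in Ico (n * τ) (n * τ + k), ‖P (t + j * k)‖ₑ ^ 2 ≤ I := by
    intro j hj0 hj3
    rw [setLIntegral_Ico_comp_add (fun t => ‖P t‖ₑ ^ 2)]
    refine lintegral_mono_set (Ico_subset_Ico ?_ ?_)
    · nlinarith
    · nlinarith
  have hdiff : ∀ t ∈ Ico (n * τ) (n * τ + k), k ^ 3 • D n
      = P (t + 3 * k) - (3 : ℝ) • P (t + 2 * k) + (3 : ℝ) • P (t + 1 * k) - P (t + 0 * k) := by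
    intro t ht
    have hj : ∀ j : ℝ, 0 ≤ j → j ≤ 3 → P (t + j * k) = _ := fun j hj0 hj3 =>
      pwPoly_of_mem_Ico hτ A B C D 0 (n := n) (t := t + j * k)
        (by have := ht.1; nlinarith) (by have := ht.2; nlinarith)
    rw [hj 3 (by norm_num) le_rfl, hj 2 (by norm_num) (by norm_num),
      hj 1 (by norm_num) (by norm_num), hj 0 le_rfl (by norm_num), Pi.zero_apply]
    match_scalars <;> ring
  have hpt : ∀ t ∈ Ico (n * τ) (n * τ + k), ‖k ^ 3 • D n‖ₑ ^ 2 ≤ 64 * (‖P (t + 3 * k)‖ₑ ^ 2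
      + ‖P (t + 2 * k)‖ₑ ^ 2 + ‖P (t + 1 * k)‖ₑ ^ 2 + ‖P (t + 0 * k)‖ₑ ^ 2) := by
    intro t ht
    rw [hdiff t ht]
    generalize P (t + 3 * k) = p3
    generalize P (t + 2 * k) = p2
    generalize P (t + 1 * k) = p1
    generalize P (t + 0 * k) = p0
    -- The factor 64 is `(1 + 3 + 3 + 1)²`, a crude bound for the binomial weights.
    have hr : ‖p3 - (3 : ℝ) • p2 + (3 : ℝ) • p1 - p0‖ ^ 2
        ≤ 64 * (‖p3‖ ^ 2 + ‖p2‖ ^ 2 + ‖p1‖ ^ 2 + ‖p0‖ ^ 2) := by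
      have h1 : ‖p3 - (3 : ℝ) • p2 + (3 : ℝ) • p1 - p0‖
          ≤ ‖p3‖ + 3 * ‖p2‖ + 3 * ‖p1‖ + ‖p0‖ := by
        refine norm_sub_le_of_le (norm_add_le_of_le (norm_sub_le_of_le le_rfl ?_) ?_) le_rfl <;>
        · rw [norm_smul]
          simp
      have h2 := pow_le_pow_left₀ (norm_nonneg _) h1 2
      nlinarith [sq_nonneg (‖p3‖ - ‖p2‖), sq_nonneg (‖p3‖ - ‖p1‖), sq_nonneg (‖p3‖ - ‖p0‖),
        sq_nonneg (‖p2‖ - ‖p1‖), sq_nonneg (‖p2‖ - ‖p0‖), sq_nonneg (‖p1‖ - ‖p0‖),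
        sq_nonneg ‖p3‖, sq_nonneg ‖p2‖, sq_nonneg ‖p1‖, sq_nonneg ‖p0‖]
    have := ENNReal.ofReal_le_ofReal hr
    rw [ENNReal.ofReal_mul (by norm_num), ENNReal.ofReal_add (by positivity) (by positivity),
      ENNReal.ofReal_add (by positivity) (by positivity),
      ENNReal.ofReal_add (by positivity) (by positivity)] at this
    simpa [ENNReal.ofReal_pow, ofReal_norm] using this
  have hmeas : ∀ j : ℝ, AEMeasurable (fun t => ‖P (t + j * k)‖ₑ ^ 2) := by
    intro j
    have h1 : Measurable fun t : ℝ => timeIndex τ t :=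
      Int.measurable_floor.comp (measurable_id.div_const τ)
    have h2 : Measurable fun t : ℝ => (timeIndex τ t : ℝ) :=
      (measurable_from_top (f := fun n : ℤ => (n : ℝ))).comp h1
    have h3 : Measurable fun t : ℝ => t - timeIndex τ t * τ := measurable_id.sub (h2.mul_const τ)
    have hs : ∀ S : ℤ → Y, StronglyMeasurable fun t : ℝ => S (timeIndex τ t) := fun S =>
      StronglyMeasurable.comp_measurable (StronglyMeasurable.of_discrete (f := S)) h1
    have h4 : StronglyMeasurable P := by
      rw [hP]
      unfold pwPoly
      exact ((((hs A).add (h3.stronglyMeasurable.smul (hs B))).add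
        (((h3.pow_const 2).div_const 2).stronglyMeasurable.smul (hs C))).add
        (((h3.pow_const 3).div_const 6).stronglyMeasurable.smul (hs D))).add
        (((h3.pow_const 4).div_const 24).stronglyMeasurable.smul (hs 0))
    exact ((h4.comp_measurable (measurable_id.add_const _)).enorm.pow_const 2).aemeasurable
  calc ‖D n‖ₑ ^ 2 * ENNReal.ofReal (k ^ 7)
      = ∫⁻ _ in Ico (n * τ) (n * τ + k), ‖k ^ 3 • D n‖ₑ ^ 2 := by
        rw [setLIntegral_const, Real.volume_Ico, enorm_smul, mul_pow,
          Real.enorm_of_nonneg (by positivity), ← ENNReal.ofReal_pow (by positivity)]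
        rw [mul_comm (ENNReal.ofReal _), mul_assoc, ← ENNReal.ofReal_mul (by positivity)]
        congr 2
        ring
    _ ≤ ∫⁻ t in Ico (n * τ) (n * τ + k), 64 * (‖P (t + 3 * k)‖ₑ ^ 2
      + ‖P (t + 2 * k)‖ₑ ^ 2 + ‖P (t + 1 * k)‖ₑ ^ 2 + ‖P (t + 0 * k)‖ₑ ^ 2) :=
        setLIntegral_mono' measurableSet_Ico hpt
    _ = 64 * ((∫⁻ t in Ico (n * τ) (n * τ + k), ‖P (t + 3 * k)‖ₑ ^ 2)
      + (∫⁻ t in Ico (n * τ) (n * τ + k), ‖P (t + 2 * k)‖ₑ ^ 2)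
      + (∫⁻ t in Ico (n * τ) (n * τ + k), ‖P (t + 1 * k)‖ₑ ^ 2)
      + (∫⁻ t in Ico (n * τ) (n * τ + k), ‖P (t + 0 * k)‖ₑ ^ 2)) := by
        rw [lintegral_const_mul' _ _ (by norm_num), lintegral_add_right' _ (hmeas 0).restrict,
          lintegral_add_right' _ (hmeas 1).restrict, lintegral_add_right' _ (hmeas 2).restrict]
    _ ≤ 64 * (I + I + I + I) := by
        gcongr <;> exact hshift _ (by norm_num) (by norm_num)
    _ = 256 * I := by ring

/-- Each interval contributes at most the total damped integral, with the weight undone at the right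
end of the interval; `norm_cubic_coeff_le` then bounds the coefficient there. -/
lemma cubic_coeff_growth {a τ : ℝ} (ha : 0 < a) (hτ : 0 < τ) (A B C D : ℤ → Y)
    (hfin : ∫⁻ t in Ici (0 : ℝ), ‖pwPoly τ A B C D 0 t‖ₑ ^ 2
      * ENNReal.ofReal (Real.exp (-2 * a * t)) ≠ ∞) (hneg : ∀ n < 0, D n = 0) :
    SeqGrowth a τ D := by
  set I := ∫⁻ t in Ici (0 : ℝ), ‖pwPoly τ A B C D 0 t‖ₑ ^ 2
      * ENNReal.ofReal (Real.exp (-2 * a * t)) with hI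
  have hk : 0 < (τ / 4) ^ 7 := by positivity
  set K := 256 * I.toReal * Real.exp (2 * a * τ) / (τ / 4) ^ 7 with hK
  refine ⟨√K, fun n => ?_⟩
  rcases lt_or_ge n 0 with hn | hn
  · rw [hneg n hn, norm_zero]
    positivity
  have hn' : (0 : ℝ) ≤ n := by exact_mod_cast hn
  have h1 : ∫⁻ t in Ico (n * τ) ((n + 1) * τ), ‖pwPoly τ A B C D 0 t‖ₑ ^ 2
      ≤ ENNReal.ofReal (Real.exp (2 * a * ((n + 1) * τ))) * I := by
    rw [hI, ← lintegral_const_mul' _ _ ENNReal.ofReal_ne_top]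
    refine (setLIntegral_mono' measurableSet_Ico fun t ht => ?_).trans
      (lintegral_mono_set (Ico_subset_Ici_self.trans (Ici_subset_Ici.2 (by positivity))))
    rw [mul_comm (‖_‖ₑ ^ 2), ← mul_assoc, ← ENNReal.ofReal_mul (by positivity), ← Real.exp_add]
    refine le_mul_of_one_le_left (by positivity) ?_
    rw [ENNReal.one_le_ofReal]
    refine Real.one_le_exp ?_
    have := ht.2
    nlinarith
  have h2 := (norm_cubic_coeff_le hτ A B C D n).trans (mul_le_mul_right h1 256)
  have h3 : ‖D n‖ ^ 2 * (τ / 4) ^ 7 ≤ 256 * (Real.exp (2 * a * ((n + 1) * τ)) * I.toReal) := by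
    have := ENNReal.toReal_mono (by finiteness) h2
    simpa [ENNReal.toReal_mul, ENNReal.toReal_ofReal hk.le,
      ENNReal.toReal_ofReal (Real.exp_pos _).le] using this
  refine le_of_sq_le_sq ?_ (by positivity)
  rw [mul_pow, Real.sq_sqrt (by positivity), ← Real.exp_nat_mul, hK, div_mul_eq_mul_div,
    le_div_iff₀ hk]
  refine h3.trans (le_of_eq ?_)
  have e : 2 * a * ((n + 1) * τ) = 2 * a * τ + ((2 : ℕ) : ℝ) * (a * (n * τ)) := by push_cast; ring
  rw [e, Real.exp_add]
  ring

/-- A sequence grows geometrically if its fourth differences do. -/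
lemma SeqGrowth.of_coeffε {a τ : ℝ} (ha : 0 < a) (hτ : 0 < τ) {W : ℤ → Y}
    (h0 : ∀ n < 0, W n = 0) (h : SeqGrowth a τ (coeffε τ W)) : SeqGrowth a τ W := by
  have haτ : 0 < a * τ := by positivity
  -- The fourth difference, shifted to the indices `n, …, n + 4` and written as iterated first
  -- differences, so that it can be summed four times. For `n ≤ -4` all indices up to `n + 3` are
  -- negative, so each summation starts from zero.
  have h4 : SeqGrowth a τ fun n => (W (n + 4) - W (n + 3) - (W (n + 3) - W (n + 2))
      - (W (n + 3) - W (n + 2) - (W (n + 2) - W (n + 1))))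
      - ((W (n + 3) - W (n + 2) - (W (n + 2) - W (n + 1)))
      - (W (n + 2) - W (n + 1) - (W (n + 1) - W n))) := by
    have := (h.shift 2).smul (τ ^ 4)
    refine (congrArg (SeqGrowth a τ) ?_).mp this
    ext n
    simp only [coeffε, show n + 2 + 2 = n + 4 by ring, show n + 2 + 1 = n + 3 by ring,
      show n + 2 - 1 = n + 1 by ring, show n + 2 - 2 = n by ring]
    match_scalars <;> field_simp <;> ring
  have h3 : SeqGrowth a τ fun n => (W (n + 3) - W (n + 2) - (W (n + 2) - W (n + 1)))
      - (W (n + 2) - W (n + 1) - (W (n + 1) - W n)) := by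
    refine SeqGrowth.of_diff haτ (m := -4) (fun n hn => ?_) ?_
    · simp [h0 (n + 3) (by omega), h0 (n + 2) (by omega), h0 (n + 1) (by omega), h0 n (by omega)]
    · simpa only [show ∀ n : ℤ, n + 1 + 3 = n + 4 by intro n; ring,
        show ∀ n : ℤ, n + 1 + 2 = n + 3 by intro n; ring,
        show ∀ n : ℤ, n + 1 + 1 = n + 2 by intro n; ring] using h4
  have h2 : SeqGrowth a τ fun n => W (n + 2) - W (n + 1) - (W (n + 1) - W n) := by
    refine SeqGrowth.of_diff haτ (m := -4) (fun n hn => ?_) ?_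
    · simp [h0 (n + 2) (by omega), h0 (n + 1) (by omega), h0 n (by omega)]
    · simpa only [show ∀ n : ℤ, n + 1 + 2 = n + 3 by intro n; ring,
        show ∀ n : ℤ, n + 1 + 1 = n + 2 by intro n; ring] using h3
  have h1 : SeqGrowth a τ fun n => W (n + 1) - W n := by
    refine SeqGrowth.of_diff haτ (m := -4) (fun n hn => ?_) ?_
    · simp [h0 (n + 1) (by omega), h0 n (by omega)]
    · simpa only [show ∀ n : ℤ, n + 1 + 1 = n + 2 by intro n; ring] using h2
  exact SeqGrowth.of_diff haτ (m := -4) (fun n hn => h0 n (by omega)) h1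

end SeqGrowthLemmas

section CoeffGrowth
variable {Y : Type} [NormedAddCommGroup Y] [NormedSpace ℝ Y] {a τ : ℝ} {W : ℤ → Y}

lemma SeqGrowth.secondDiff (h : SeqGrowth a τ W) : SeqGrowth a τ (secondDiff τ W) :=
  (((h.shift 1).sub (h.smul 2)).add (h.shift_neg 1)).smul _

lemma SeqGrowth.centralDiff (h : SeqGrowth a τ W) : SeqGrowth a τ (centralDiff τ W) :=
  ((h.shift 1).sub (h.shift_neg 1)).smul _

lemma SeqGrowth.coeffα (h : SeqGrowth a τ W) : SeqGrowth a τ (coeffα W) :=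
  (((((h.shift 1).smul 3).add (h.smul 17)).add ((h.shift_neg 1).smul 5)).sub
    (h.shift_neg 2)).smul _

lemma SeqGrowth.coeffβ (h : SeqGrowth a τ W) : SeqGrowth a τ (coeffβ τ W) :=
  (((((h.shift 1).smul 5).add (h.smul 3)).sub ((h.shift_neg 1).smul 9)).add
    (h.shift_neg 2)).smul _

lemma SeqGrowth.coeffθ (h : SeqGrowth a τ W) : SeqGrowth a τ (coeffθ τ W) :=
  ((((h.shift 2).sub ((h.shift 1).smul 2)).add ((h.shift_neg 1).smul 2)).sub
    (h.shift_neg 2)).smul _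

lemma SeqGrowth.coeffε (h : SeqGrowth a τ W) : SeqGrowth a τ (coeffε τ W) :=
  (((((h.shift 2).sub ((h.shift 1).smul 4)).add (h.smul 6)).sub ((h.shift_neg 1).smul 4)).add
    (h.shift_neg 2)).smul _

end CoeffGrowth

/-! ### Regularity and growth of the reconstructions of a general sequence -/

section Generic
variable {Y : Type} [NormedAddCommGroup Y] [NormedSpace ℝ Y] {τ : ℝ}

/-- The first time derivative of `L(U)`. -/
def wDot (τ : ℝ) (U : ℕ → Y) : ℝ → Y :=
  pwPoly τ (coeffβ τ (zeroExt U)) (secondDiff τ (zeroExt U)) (coeffθ τ (zeroExt U))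
    (coeffε τ (zeroExt U)) 0

/-- The second time derivative of `L(U)`. -/
def wDDot (τ : ℝ) (U : ℕ → Y) : ℝ → Y :=
  pwPoly τ (secondDiff τ (zeroExt U)) (coeffθ τ (zeroExt U)) (coeffε τ (zeroExt U)) 0 0

lemma continuous_reconL (hτ : 0 < τ) (U : ℕ → Y) : Continuous (reconL τ U) := by
  rw [reconL_eq]
  exact continuous_reconL_aux hτ (zeroExt U)

lemma continuous_reconR (hτ : 0 < τ) (U : ℕ → Y) : Continuous (reconR τ U) := by
  rw [reconR_eq]
  exact continuous_reconR_aux hτ (zeroExt U)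

lemma continuous_wDot (hτ : 0 < τ) (U : ℕ → Y) : Continuous (wDot τ U) :=
  continuous_reconL_deriv_aux hτ (zeroExt U)

lemma continuous_wDDot (hτ : 0 < τ) (U : ℕ → Y) : Continuous (wDDot τ U) :=
  continuous_reconL_deriv2_aux hτ (zeroExt U)

lemma hasDerivAt_reconL [CompleteSpace Y] (hτ : 0 < τ) (U : ℕ → Y) (t : ℝ) :
    HasDerivAt (reconL τ U) (wDot τ U t) t :=
  hasDerivAt_of_right (continuous_reconL hτ U) (continuous_wDot hτ U)
    (fun t => by rw [reconL_eq]; exact hasDerivWithinAt_pwPoly hτ _ _ _ _ _ t) t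

lemma hasDerivAt_wDot [CompleteSpace Y] (hτ : 0 < τ) (U : ℕ → Y) (t : ℝ) :
    HasDerivAt (wDot τ U) (wDDot τ U t) t :=
  hasDerivAt_of_right (continuous_wDot hτ U) (continuous_wDDot hτ U)
    (fun t => hasDerivWithinAt_pwPoly hτ _ _ _ _ _ t) t

lemma hasDerivWithinAt_reconR (hτ : 0 < τ) (U : ℕ → Y) (t : ℝ) :
    HasDerivWithinAt (reconR τ U) (pwPoly τ (centralDiff τ (zeroExt U))
      (secondDiff τ (zeroExt U)) 0 0 0 t) (Ici t) t := by
  rw [reconR_eq]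
  exact hasDerivWithinAt_pwPoly hτ _ _ _ _ _ t

lemma expGrowth_reconL {a : ℝ} (ha : 0 ≤ a) (hτ : 0 < τ) {U : ℕ → Y}
    (hW : SeqGrowth a τ (zeroExt U)) : ExpGrowth a (reconL τ U) := by
  rw [reconL_eq]
  exact expGrowth_pwPoly ha hτ hW.coeffα hW.coeffβ hW.secondDiff hW.coeffθ hW.coeffε

lemma expGrowth_reconR {a : ℝ} (ha : 0 ≤ a) (hτ : 0 < τ) {U : ℕ → Y}
    (hW : SeqGrowth a τ (zeroExt U)) : ExpGrowth a (reconR τ U) := by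
  rw [reconR_eq]
  exact expGrowth_pwPoly ha hτ hW hW.centralDiff hW.secondDiff (.zero _ _) (.zero _ _)

lemma expGrowth_wDot {a : ℝ} (ha : 0 ≤ a) (hτ : 0 < τ) {U : ℕ → Y}
    (hW : SeqGrowth a τ (zeroExt U)) : ExpGrowth a (wDot τ U) :=
  expGrowth_pwPoly ha hτ hW.coeffβ hW.secondDiff hW.coeffθ hW.coeffε (.zero _ _)

lemma expGrowth_wDDot {a : ℝ} (ha : 0 ≤ a) (hτ : 0 < τ) {U : ℕ → Y}
    (hW : SeqGrowth a τ (zeroExt U)) : ExpGrowth a (wDDot τ U) :=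
  expGrowth_pwPoly ha hτ hW.secondDiff hW.coeffθ hW.coeffε (.zero _ _) (.zero _ _)

lemma expGrowth_reconR_deriv {a : ℝ} (ha : 0 ≤ a) (hτ : 0 < τ) {U : ℕ → Y}
    (hW : SeqGrowth a τ (zeroExt U)) : ExpGrowth a (pwPoly τ (centralDiff τ (zeroExt U))
      (secondDiff τ (zeroExt U)) 0 0 0) :=
  expGrowth_pwPoly ha hτ hW.centralDiff hW.secondDiff (.zero _ _) (.zero _ _) (.zero _ _)

lemma reconL_mem_of_mem {V : Submodule ℝ Y} {U : ℕ → Y} (h : ∀ n, zeroExt U n ∈ V) (t : ℝ) :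
    reconL τ U t ∈ V := by
  rw [reconL_eq, pwPoly, coeffα, coeffβ, secondDiff, coeffθ, coeffε]
  repeat' first
    | exact h _
    | apply V.add_mem
    | apply V.sub_mem
    | apply V.smul_mem

/-- A discrete evolution equation carries over to the time reconstructions. -/
lemma reconR_eq_wDDot_add {H G : Type} [NormedAddCommGroup H] [InnerProductSpace ℝ H]
    [NormedAddCommGroup G] [InnerProductSpace ℝ G] (hτ : 0 < τ) (P : Y →L[ℝ] H) (Q : Y →L[ℝ] G)
    {U : ℕ → Y} {F : ℕ → H} {p : H} {q : G}
    (e : ∀ n : ℤ, inner ℝ (P (secondDiff τ (zeroExt U) n)) p + inner ℝ (Q (zeroExt U n)) q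
      = inner ℝ (zeroExt F n) p) (t : ℝ) :
    inner ℝ (reconR τ F t) p = inner ℝ (P (wDDot τ U t)) p + inner ℝ (Q (reconR τ U t)) q := by
  -- Now all three functions are `R` of a sequence; `R` is linear with scalar weights depending only
  -- on `t`, so the discrete relation can be applied coefficient by coefficient.
  rw [reconR_eq, reconR_eq, wDDot, reconL_deriv2_eq hτ]
  simp only [pwPoly]
  set n := timeIndex τ t
  have c1 : inner ℝ (centralDiff τ (zeroExt F) n) p
      = inner ℝ (P (centralDiff τ (secondDiff τ (zeroExt U)) n)) p
        + inner ℝ (Q (centralDiff τ (zeroExt U) n)) q := by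
    simp only [centralDiff, map_smul, map_sub, real_inner_smul_left, inner_sub_left, ← e]
    ring
  have c2 : inner ℝ (secondDiff τ (zeroExt F) n) p
      = inner ℝ (P (secondDiff τ (secondDiff τ (zeroExt U)) n)) p
        + inner ℝ (Q (secondDiff τ (zeroExt U) n)) q := by
    have hs : ∀ V : ℤ → Y, secondDiff τ V n
        = (1 / τ ^ 2) • (V (n + 1) - (2 : ℝ) • V n + V (n - 1)) := fun _ => rfl
    rw [hs (secondDiff τ (zeroExt U)), congrArg Q (hs (zeroExt U)), secondDiff]
    simp only [map_smul, map_sub, map_add, real_inner_smul_left, inner_sub_left, inner_add_left,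
      ← e]
    ring
  simp only [Pi.zero_apply, smul_zero, add_zero, map_add, map_smul, inner_add_left,
    real_inner_smul_left]
  rw [c1, c2, ← e n]
  ring

end Generic

/-! ### The leapfrog solution, its residual and its growth -/

section Discrete
variable {d : ℕ} {Ω : Set (EuclideanSpace ℝ (Fin d))} {Vh : Submodule ℝ (H10 ℝ Ω)} {τ : ℝ}
  {f : ℝ → L2 Ω ℝ} {U : ℕ → H10 ℝ Ω}

lemma zeroExt_neg {Y : Type} [NormedAddCommGroup Y] (V : ℕ → Y) {n : ℤ} (hn : n < 0) :
    zeroExt V n = 0 := if_pos hn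

lemma zeroExt_natCast {Y : Type} [NormedAddCommGroup Y] (V : ℕ → Y) (n : ℕ) :
    zeroExt V n = V n := by
  simp [zeroExt]

lemma zeroExt_mem (hU : IsLeapfrogSolution Vh τ f U) (n : ℤ) : zeroExt U n ∈ Vh := by
  rcases lt_or_ge n 0 with hn | hn
  · rw [zeroExt_neg U hn]
    exact Vh.zero_mem
  · obtain ⟨m, rfl⟩ := Int.eq_ofNat_of_zero_le hn
    rw [zeroExt_natCast]
    exact hU.mem m

lemma zeroExt_of_le_one (hU : IsLeapfrogSolution Vh τ f U) {n : ℤ} (hn : n ≤ 1) :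
    zeroExt U n = 0 := by
  rcases lt_or_ge n 0 with h | h
  · exact zeroExt_neg U h
  · interval_cases n
    · exact (zeroExt_natCast U 0).trans hU.initial_zero
    · exact (zeroExt_natCast U 1).trans hU.initial_one

/-- The leapfrog scheme for the zero extensions, at all times. -/
lemma leapfrog_int (hU : IsLeapfrogSolution Vh τ f U) (hf0 : f 0 = 0) (n : ℤ)
    {v : H10 ℝ Ω} (hv : v ∈ Vh) :
    inner ℝ (val (secondDiff τ (zeroExt U) n)) (val v) + inner ℝ (grad (zeroExt U n)) (grad v)
      = inner ℝ (zeroExt (fun m : ℕ => f (m * τ)) n) (val v) := by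
  rcases lt_or_ge n 1 with hn | hn
  -- For `n ≤ 0` every term vanishes; at `n = 0` this uses `U¹ = 0` and `f(0) = 0`.
  · have h1 : secondDiff τ (zeroExt U) n = 0 := by
      rw [secondDiff, zeroExt_of_le_one hU (show n + 1 ≤ 1 by omega),
        zeroExt_of_le_one hU (show n ≤ 1 by omega), zeroExt_of_le_one hU (show n - 1 ≤ 1 by omega)]
      simp
    have h2 : zeroExt (fun m : ℕ => f (m * τ)) n = 0 := by
      rcases lt_or_ge n 0 with h | h
      · exact zeroExt_neg _ h
      · obtain rfl : n = 0 := by omega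
        refine (zeroExt_natCast _ 0).trans ?_
        simp [hf0]
    rw [h1, h2, zeroExt_of_le_one hU (show n ≤ 1 by omega)]
    simp
  · obtain ⟨m, rfl⟩ := Int.eq_ofNat_of_zero_le (show 0 ≤ n by omega)
    have hm : 1 ≤ m := by exact_mod_cast hn
    have e := hU.equation m hm v hv
    have e1 : zeroExt U ((m : ℤ) + 1) = U (m + 1) := by
      exact_mod_cast zeroExt_natCast U (m + 1)
    have e2 : zeroExt U ((m : ℤ) - 1) = U (m - 1) := by
      have := zeroExt_natCast U (m - 1)
      rwa [Nat.cast_sub hm, Nat.cast_one] at this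
    rw [secondDiff, e1, e2, zeroExt_natCast, zeroExt_natCast, map_smul, real_inner_smul_left]
    exact e

lemma timeDeriv_one_reconL (hτ : 0 < τ) (U : ℕ → H10 ℝ Ω) {t : ℝ} (ht : 0 ≤ t) :
    timeDeriv 1 (fun t => val (reconL τ U t)) t = val (wDot τ U t) :=
  timeDeriv_one_eq ht
    ((val (Ω := Ω) (𝕜 := ℝ)).hasFDerivAt.comp_hasDerivAt t
      (hasDerivAt_reconL hτ U t)).hasDerivWithinAt

lemma timeDeriv_two_reconL (hτ : 0 < τ) (U : ℕ → H10 ℝ Ω) {t : ℝ} (ht : 0 ≤ t) :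
    timeDeriv 2 (fun t => val (reconL τ U t)) t = val (wDDot τ U t) := by
  rw [timeDeriv_succ 1]
  refine timeDeriv_one_eq ht ?_
  have : HasDerivWithinAt (fun t => val (wDot τ U t)) (val (wDDot τ U t)) (Ici 0) t :=
    ((val (Ω := Ω) (𝕜 := ℝ)).hasFDerivAt.comp_hasDerivAt t
      (hasDerivAt_wDot hτ U t)).hasDerivWithinAt
  exact this.congr (fun y hy => timeDeriv_one_reconL hτ U hy) (timeDeriv_one_reconL hτ U ht)

lemma reconL_zero (hτ : 0 < τ) (hU : IsLeapfrogSolution Vh τ f U) : reconL τ U 0 = 0 := by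
  rw [reconL_eq, pwPoly_of_mem_Ico hτ _ _ _ _ _ (n := 0) (by simp) (by simpa using hτ)]
  simp [coeffα, zeroExt_of_le_one hU]

lemma wDot_zero (hτ : 0 < τ) (hU : IsLeapfrogSolution Vh τ f U) : wDot τ U 0 = 0 := by
  rw [wDot, pwPoly_of_mem_Ico hτ _ _ _ _ _ (n := 0) (by simp) (by simpa using hτ)]
  simp [coeffβ, zeroExt_of_le_one hU]

lemma delta_zero (hτ : 0 < τ) (hU : IsLeapfrogSolution Vh τ f U) : delta τ U 0 = 0 := by
  rw [delta, reconL_zero hτ hU, reconR_eq,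
    pwPoly_of_mem_Ico hτ _ _ _ _ _ (n := 0) (by simp) (by simpa using hτ)]
  simp [zeroExt_of_le_one hU]

lemma continuous_delta (hτ : 0 < τ) (U : ℕ → H10 ℝ Ω) : Continuous (delta τ U) :=
  (continuous_reconR hτ U).sub (continuous_reconL hτ U)

lemma hasDerivWithinAt_delta (hτ : 0 < τ) (U : ℕ → H10 ℝ Ω) (t : ℝ) :
    HasDerivWithinAt (delta τ U) (pwPoly τ (centralDiff τ (zeroExt U))
      (secondDiff τ (zeroExt U)) 0 0 0 t - wDot τ U t) (Ici t) t :=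
  (hasDerivWithinAt_reconR hτ U t).sub (hasDerivAt_reconL hτ U t).hasDerivWithinAt

lemma deltaDot_eq (hτ : 0 < τ) (U : ℕ → H10 ℝ Ω) (t : ℝ) :
    deltaDot τ U t = pwPoly τ (centralDiff τ (zeroExt U)) (secondDiff τ (zeroExt U)) 0 0 0 t
      - wDot τ U t :=
  (hasDerivWithinAt_delta hτ U t).derivWithin (uniqueDiffOn_Ici t t self_mem_Ici)

lemma residual_apply (hτ : 0 < τ) (f : ℝ → L2 Ω ℝ) (U : ℕ → H10 ℝ Ω) {t : ℝ} (ht : 0 ≤ t)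
    (v : H10 ℝ Ω) : residual τ f U t v = inner ℝ (fTau τ f t - val (wDDot τ U t)) (val v)
      - inner ℝ (grad (reconL τ U t)) (grad v) := by
  rw [inner_sub_left, ← timeDeriv_two_reconL hτ U ht]
  rfl

/-- On the discrete space the residual is the gradient of the time reconstruction error. -/
lemma residual_apply_of_mem (hτ : 0 < τ) (hU : IsLeapfrogSolution Vh τ f U) (hf0 : f 0 = 0) {t : ℝ}
    (ht : 0 ≤ t) {v : H10 ℝ Ω} (hv : v ∈ Vh) :
    residual τ f U t v = inner ℝ (grad (delta τ U t)) (grad v) := by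
  have e := reconR_eq_wDDot_add (p := val v) (q := grad v) hτ val grad
    (fun n => leapfrog_int hU hf0 n hv) t
  rw [residual_apply hτ f U ht, delta, map_sub, inner_sub_left (grad _), inner_sub_left, fTau, e]
  ring

/-- Finiteness of the weighted norm of `∇δ'` bounds the growth of the discrete solution. -/
lemma seqGrowth_of_deltaDot (hd : 1 ≤ d) (hΩb : Bornology.IsBounded Ω) {ρ : ℝ} (hρ : 0 < ρ)
    (hτ : 0 < τ) (hU : IsLeapfrogSolution Vh τ f U)
    (hfin : ∫⁻ t in Ici (0 : ℝ), ‖grad (deltaDot τ U t)‖ₑ ^ 2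
      * ENNReal.ofReal (Real.exp (-2 * ρ * t)) ≠ ∞) : SeqGrowth ρ τ (zeroExt U) := by
  have hε0 : ∀ n < 0, coeffε τ (zeroExt U) n = 0 := fun n hn => by
    simp [coeffε, zeroExt_of_le_one hU (show n + 2 ≤ 1 by omega),
      zeroExt_of_le_one hU (show n + 1 ≤ 1 by omega), zeroExt_of_le_one hU (show n ≤ 1 by omega),
      zeroExt_of_le_one hU (show n - 1 ≤ 1 by omega),
      zeroExt_of_le_one hU (show n - 2 ≤ 1 by omega)]
  let W : ℤ → L2 Ω (EuclideanSpace ℝ (Fin d)) := fun n => grad (zeroExt U n)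
  -- `R(U)` and `L(U)` share the coefficient `γ`, so it cancels in `δ'`, which is a cubic polynomial
  -- on each interval with third derivative `-ε`.
  have hD : ∀ t, grad (deltaDot τ U t) = pwPoly τ
      (fun n => grad (centralDiff τ (zeroExt U) n - coeffβ τ (zeroExt U) n)) 0
      (fun n => grad (-coeffθ τ (zeroExt U) n)) (fun n => grad (-coeffε τ (zeroExt U) n)) 0 t := by
    intro t
    rw [deltaDot_eq hτ, wDot, pwPoly, pwPoly, pwPoly]
    simp only [map_sub, map_add, map_smul, map_neg, Pi.zero_apply, smul_zero, map_zero]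
    module
  have h1 : SeqGrowth ρ τ fun n => grad (-coeffε τ (zeroExt U) n) := by
    simp only [hD] at hfin
    exact cubic_coeff_growth hρ hτ _ _ _ _ hfin fun n hn => by rw [hε0 n hn]; simp
  have h2 : SeqGrowth ρ τ (coeffε τ W) := by
    have := h1.smul (-1)
    refine (congrArg (SeqGrowth ρ τ) ?_).mp this
    ext1 n
    simp only [coeffε, W, map_neg, map_smul, map_add, map_sub]
    module
  obtain ⟨K, hK⟩ := h2.of_coeffε hρ hτ fun n hn => by simp [W, zeroExt_neg U hn]
  obtain ⟨C, hC, hP⟩ := exists_poincare hd hΩb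
  refine ⟨(C + 1) * K, fun n => ?_⟩
  have h3 : ‖zeroExt U n‖ ≤ ‖val (zeroExt U n)‖ + ‖grad (zeroExt U n)‖ := by
    refine le_of_sq_le_sq ?_ (by positivity)
    rw [norm_sq_H10]
    nlinarith [mul_nonneg (norm_nonneg (val (zeroExt U n))) (norm_nonneg (grad (zeroExt U n)))]
  calc _ ≤ (C + 1) * ‖grad (zeroExt U n)‖ := by linarith [hP (zeroExt U n)]
    _ ≤ (C + 1) * (K * Real.exp (ρ * (n * τ))) := by gcongr; exact hK n
    _ = _ := by ring

lemma expGrowth_delta {a : ℝ} (ha : 0 ≤ a) (hτ : 0 < τ)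
    (hW : SeqGrowth a τ (zeroExt U)) : ExpGrowth a (delta τ U) :=
  (expGrowth_reconR ha hτ hW).sub (expGrowth_reconL ha hτ hW)

lemma expGrowth_deltaDot {a : ℝ} (ha : 0 ≤ a) (hτ : 0 < τ)
    (hW : SeqGrowth a τ (zeroExt U)) : ExpGrowth a (deltaDot τ U) := by
  rw [funext (deltaDot_eq hτ U)]
  exact (expGrowth_reconR_deriv ha hτ hW).sub (expGrowth_wDot ha hτ hW)

lemma expGrowth_fTau {a : ℝ} (ha : 0 ≤ a) (hτ : 0 < τ) (hf : ExpGrowth a f) :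
    ExpGrowth a (fTau τ f) := by
  have hF : SeqGrowth a τ (zeroExt fun m : ℕ => f (m * τ)) := by
    obtain ⟨C, hC⟩ := hf.bound
    have hC0 : 0 ≤ C := by simpa using (norm_nonneg _).trans (hC 0 le_rfl)
    refine ⟨C, fun n => ?_⟩
    rcases lt_or_ge n 0 with hn | hn
    · rw [zeroExt_neg _ hn, norm_zero]
      positivity
    · obtain ⟨m, rfl⟩ := Int.eq_ofNat_of_zero_le hn
      rw [zeroExt_natCast]
      exact_mod_cast hC (m * τ) (by positivity)
  exact expGrowth_reconR ha hτ hF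

lemma reconL_mem (hU : IsLeapfrogSolution Vh τ f U) (t : ℝ) : reconL τ U t ∈ Vh :=
  reconL_mem_of_mem (zeroExt_mem hU) t

/-- The Riesz representative of the residual for the gradient inner product. -/
def residualRep (S : L2 Ω ℝ →L[ℝ] H10 ℝ Ω) (τ : ℝ) (f : ℝ → L2 Ω ℝ) (U : ℕ → H10 ℝ Ω) (t : ℝ) :
    H10 ℝ Ω := S (fTau τ f t - val (wDDot τ U t)) - reconL τ U t

lemma inner_residualRep {S : L2 Ω ℝ →L[ℝ] H10 ℝ Ω}
    (hS : ∀ g v, inner ℝ (grad (S g)) (grad v) = inner ℝ g (val v)) (hτ : 0 < τ) {t : ℝ}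
    (ht : 0 ≤ t) (v : H10 ℝ Ω) :
    inner ℝ (grad (residualRep S τ f U t)) (grad v) = residual τ f U t v := by
  rw [residual_apply hτ f U ht, residualRep, map_sub, inner_sub_left (grad _), hS]

/-- The supremum is tested with the normalised representative. Only this inequality is needed, and
it spares any measurability question about the dual norm as a function of time. -/
lemma enorm_residualRep_le {S : L2 Ω ℝ →L[ℝ] H10 ℝ Ω}
    (hS : ∀ g v, inner ℝ (grad (S g)) (grad v) = inner ℝ g (val v)) (hτ : 0 < τ) {t : ℝ}
    (ht : 0 ≤ t) : ‖grad (residualRep S τ f U t)‖ₑ ≤ dualNorm (residual τ f U t) := by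
  set q := residualRep S τ f U t with hq
  by_cases h0 : ‖grad q‖ = 0
  · rw [← ofReal_norm, h0]
    simp
  have hv : ‖grad (‖grad q‖⁻¹ • q)‖ = 1 := by
    rw [map_smul, norm_smul, norm_inv, norm_norm, inv_mul_cancel₀ h0]
  refine le_trans (le_of_eq ?_) (le_iSup₂ (f := fun (v : H10 ℝ Ω) (_ : ‖grad v‖ = 1) =>
    ‖residual τ f U t v‖ₑ) (‖grad q‖⁻¹ • q) hv)
  rw [← inner_residualRep hS hτ ht, map_smul, inner_smul_right, ← hq, real_inner_self_eq_norm_sq,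
    ← ofReal_norm, ← ofReal_norm]
  congr 1
  rw [Real.norm_of_nonneg (by positivity)]
  field_simp

lemma expGrowth_residualRep {a : ℝ} (ha : 0 ≤ a) (hτ : 0 < τ) (hf : ExpGrowth a f)
    (hW : SeqGrowth a τ (zeroExt U)) (S : L2 Ω ℝ →L[ℝ] H10 ℝ Ω) :
    ExpGrowth a (residualRep S τ f U) := by
  have h1 : ExpGrowth a fun t => val (wDDot τ U t) :=
    (expGrowth_wDDot ha hτ hW).clm (val (𝕜 := ℝ) (Ω := Ω))
  have h2 : ExpGrowth a fun t => S (fTau τ f t - val (wDDot τ U t)) :=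
    ((expGrowth_fTau ha hτ hf).sub h1).clm S
  exact h2.sub (expGrowth_reconL ha hτ hW)

end Discrete

/-! ### Estimates at a fixed frequency -/

section Scalar

/-- Multiplication by `s̄` rotates both `s²` and `1` to numbers with positive real part when `Re s >
0`. All stability of `b_s` rests on this identity, at the price of a factor `|s| / Re s`. -/
lemma re_mul_energy (s : ℂ) (x y : ℝ) :
    (star s * (s ^ 2 * (x : ℂ) ^ 2 + (y : ℂ) ^ 2)).re = s.re * (‖s‖ ^ 2 * x ^ 2 + y ^ 2) := by
  rw [Complex.sq_norm, Complex.normSq_apply]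
  simp [pow_two]
  ring

/-- Coercivity of `b_s`, in terms of `x = ‖v‖`, `y = ‖∇v‖`. -/
lemma energy_le_of_norm_le {s : ℂ} (hs : 0 < s.re) {x y A B : ℝ} (hA : 0 ≤ A) (hB : 0 ≤ B)
    (h : ‖s ^ 2 * (x : ℂ) ^ 2 + (y : ℂ) ^ 2‖ ≤ x * A + y * B) :
    √(‖s‖ ^ 2 * x ^ 2 + y ^ 2) ≤ (A + ‖s‖ * B) / s.re := by
  set E := √(‖s‖ ^ 2 * x ^ 2 + y ^ 2) with hE
  have hE2 : E ^ 2 = ‖s‖ ^ 2 * x ^ 2 + y ^ 2 := Real.sq_sqrt (by positivity)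
  have h1 : s.re * E ^ 2 ≤ ‖s‖ * (x * A + y * B) := by
    rw [hE2, ← re_mul_energy]
    refine (Complex.re_le_norm _).trans ?_
    rw [norm_mul, norm_star]
    gcongr
  have hE0 : 0 ≤ E := Real.sqrt_nonneg _
  have hxE : ‖s‖ * x ≤ E := Real.le_sqrt_of_sq_le (by rw [mul_pow]; nlinarith [sq_nonneg y])
  have hyE : y ≤ E := Real.le_sqrt_of_sq_le (by nlinarith [sq_nonneg (‖s‖ * x)])
  rw [le_div_iff₀ hs]
  rcases hE0.eq_or_lt with h0 | h0
  · rw [← h0, zero_mul]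
    positivity
  · have h2 : ‖s‖ * (x * A + y * B) ≤ E * (A + ‖s‖ * B) := by
      nlinarith [mul_le_mul_of_nonneg_right hxE hA,
        mul_le_mul_of_nonneg_right hyE (mul_nonneg (norm_nonneg s) hB)]
    have h3 : E * (E * s.re) ≤ E * (A + ‖s‖ * B) := by nlinarith
    exact le_of_mul_le_mul_left h3 h0

end Scalar

section Frequency
variable {V H G : Type} [NormedAddCommGroup V] [InnerProductSpace ℂ V]
  [NormedAddCommGroup H] [InnerProductSpace ℂ H]
  [NormedAddCommGroup G] [InnerProductSpace ℂ G]
  {vl : V →L[ℂ] H} {gr : V →L[ℂ] G} {s : ℂ}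

lemma inner_vl_self (w : H) (y : G) : s ^ 2 * inner ℂ w w + inner ℂ y y
    = s ^ 2 * (‖w‖ : ℂ) ^ 2 + (‖y‖ : ℂ) ^ 2 := by
  rw [inner_self_eq_norm_sq_to_K, inner_self_eq_norm_sq_to_K]
  rfl

/-- The stability estimate for `b_s`. -/
lemma energy_le_of_eq (hs : 0 < s.re) {w : V} {a : H} {b : G}
    (h : s ^ 2 * inner ℂ (vl w) (vl w) + inner ℂ (gr w) (gr w)
      = inner ℂ (vl w) a + inner ℂ (gr w) b) :
    √(‖s‖ ^ 2 * ‖vl w‖ ^ 2 + ‖gr w‖ ^ 2) ≤ (‖a‖ + ‖s‖ * ‖b‖) / s.re := by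
  refine energy_le_of_norm_le hs (norm_nonneg _) (norm_nonneg _) ?_
  rw [← inner_vl_self, h]
  exact norm_add_le_of_le (norm_inner_le_norm _ _) (norm_inner_le_norm _ _)

lemma adjoint_energy_le (hs : 0 < s.re) {g : H} {χ : V}
    (h : ∀ w, s ^ 2 * inner ℂ (vl χ) (vl w) + inner ℂ (gr χ) (gr w)
      = (‖s‖ : ℂ) ^ 2 * inner ℂ g (vl w)) :
    √(‖s‖ ^ 2 * ‖vl χ‖ ^ 2 + ‖gr χ‖ ^ 2) ≤ ‖s‖ ^ 2 * ‖g‖ / s.re := by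
  have := energy_le_of_norm_le hs (x := ‖vl χ‖) (y := ‖gr χ‖)
    (A := ‖s‖ ^ 2 * ‖g‖) (B := 0) (by positivity) le_rfl ?_
  · simpa using this
  rw [← inner_vl_self, h, norm_mul]
  have h1 : ‖((‖s‖ : ℂ)) ^ 2‖ = ‖s‖ ^ 2 := by simp
  rw [h1]
  have := norm_inner_le_norm (𝕜 := ℂ) g (vl χ)
  nlinarith [mul_le_mul_of_nonneg_left this (sq_nonneg ‖s‖)]

lemma norm_gr_adjoint_le (hs : 0 < s.re) {g : H} {χ : V}
    (h : ∀ w, s ^ 2 * inner ℂ (vl χ) (vl w) + inner ℂ (gr χ) (gr w)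
      = (‖s‖ : ℂ) ^ 2 * inner ℂ g (vl w)) : ‖gr χ‖ ≤ ‖s‖ ^ 2 * ‖g‖ / s.re :=
  (Real.le_sqrt_of_sq_le (by nlinarith [sq_nonneg (‖s‖ * ‖vl χ‖)])).trans (adjoint_energy_le hs h)

lemma norm_vl_adjoint_le (hs : 0 < s.re) {g : H} {χ : V}
    (h : ∀ w, s ^ 2 * inner ℂ (vl χ) (vl w) + inner ℂ (gr χ) (gr w)
      = (‖s‖ : ℂ) ^ 2 * inner ℂ g (vl w)) : ‖vl χ‖ ≤ ‖s‖ * ‖g‖ / s.re := by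
  have hs0 : 0 < ‖s‖ := norm_pos_iff.2 fun h0 => by simp [h0] at hs
  have h1 : ‖s‖ * ‖vl χ‖ ≤ ‖s‖ ^ 2 * ‖g‖ / s.re :=
    (Real.le_sqrt_of_sq_le (by rw [mul_pow]; nlinarith [sq_nonneg ‖gr χ‖])).trans
      (adjoint_energy_le hs h)
  have h2 : ‖s‖ ^ 2 * ‖g‖ / s.re = ‖s‖ * (‖s‖ * ‖g‖ / s.re) := by ring
  rw [h2] at h1
  exact le_of_mul_le_mul_left h1 hs0

/-- Solvability of the adjoint problem (Lax–Milgram). -/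
lemma exists_adjoint [CompleteSpace V] [CompleteSpace H] [CompleteSpace G] (hs : 0 < s.re)
    (hV : ∀ v : V, ‖v‖ ^ 2 = ‖vl v‖ ^ 2 + ‖gr v‖ ^ 2) (g : H) :
    ∃ χ : V, ∀ w, s ^ 2 * inner ℂ (vl χ) (vl w) + inner ℂ (gr χ) (gr w)
      = (‖s‖ : ℂ) ^ 2 * inner ℂ g (vl w) := by
  have hs0 : 0 < ‖s‖ := norm_pos_iff.2 fun h0 => by simp [h0] at hs
  let T : V →L[ℂ] V := (star (s ^ 2)) • (ContinuousLinearMap.adjoint vl).comp vl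
    + (ContinuousLinearMap.adjoint gr).comp gr
  have hT : ∀ v w, inner ℂ (T v) w = s ^ 2 * inner ℂ (vl v) (vl w) + inner ℂ (gr v) (gr w) := by
    intro v w
    simp [T, ContinuousLinearMap.adjoint_inner_left, mul_comm]
  -- The coercivity constant left by `re_mul_energy` after division by `|s|` and comparison of the
  -- weighted energy with the full norm.
  set c := s.re * min (‖s‖ ^ 2) 1 / ‖s‖ with hc
  have hc0 : 0 < c := by positivity
  have hco : ∀ v, c * ‖v‖ ^ 2 ≤ ‖inner ℂ (T v) v‖ := by
    intro v
    rw [hT, inner_vl_self]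
    have h1 := re_mul_energy s ‖vl v‖ ‖gr v‖
    have h2 := (Complex.re_le_norm _).trans
      (norm_mul (star s) (s ^ 2 * (‖vl v‖ : ℂ) ^ 2 + (‖gr v‖ : ℂ) ^ 2)).le
    rw [h1, norm_star] at h2
    rw [hc, div_mul_eq_mul_div, div_le_iff₀ hs0, mul_comm ‖_ + _‖]
    refine le_trans ?_ h2
    rw [mul_assoc]
    refine mul_le_mul_of_nonneg_left ?_ hs.le
    rw [hV, mul_add]
    refine add_le_add ?_ ?_
    · gcongr
      exact min_le_left _ _
    · nlinarith [min_le_right (‖s‖ ^ 2) 1, sq_nonneg ‖gr v‖]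
  have hbelow : ∀ v, c * ‖v‖ ≤ ‖T v‖ := by
    intro v
    rcases (norm_nonneg v).eq_or_lt with h0 | h0
    · rw [← h0, mul_zero]
      exact norm_nonneg _
    · have := (hco v).trans (norm_inner_le_norm _ _)
      nlinarith
  have hanti : AntilipschitzWith (Real.toNNReal c⁻¹) T := by
    refine ContinuousLinearMap.antilipschitz_of_bound T fun v => ?_
    rw [Real.coe_toNNReal _ (by positivity), ← div_eq_inv_mul, le_div_iff₀ hc0, mul_comm]
    exact hbelow v
  -- Coercivity bounds `T` from below, so its range is closed. A vector `w` orthogonal to the range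
  -- has `(Tw, w) = 0` and therefore vanishes.
  have hclosed : IsClosed (T.range : Set V) := hanti.isClosed_range T.uniformContinuous
  have htop : T.range = ⊤ := by
    have := hclosed.completeSpace_coe
    rw [← T.range.orthogonal_orthogonal, Submodule.eq_top_iff']
    intro v w hw
    have h0 := hco w
    rw [hw (T w) ⟨w, rfl⟩, norm_zero] at h0
    have hw0 : w = 0 := by
      rw [← norm_eq_zero]
      have : ‖w‖ ^ 2 ≤ 0 := by
        by_contra hpos
        push Not at hpos
        nlinarith
      exact pow_eq_zero_iff (two_ne_zero) |>.1 (le_antisymm this (sq_nonneg _))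
    rw [hw0, inner_zero_left]
  obtain ⟨χ, hχ⟩ : ∃ χ, T χ = ((‖s‖ : ℂ) ^ 2) • ContinuousLinearMap.adjoint vl g := by
    have : ((‖s‖ : ℂ) ^ 2) • ContinuousLinearMap.adjoint vl g ∈ T.range := by
      rw [htop]
      trivial
    exact this
  refine ⟨χ, fun w => ?_⟩
  rw [← hT, hχ, inner_smul_left, ContinuousLinearMap.adjoint_inner_left]
  simp

/-- The error estimate at low frequencies. -/
lemma low_frequency [CompleteSpace G] (hs : 0 < s.re) {Vh : Submodule ℂ V} {e χ : V} {R δ : G}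
    {η : H} {Γ : ℝ} (hΓ : 0 ≤ Γ)
    (he : ∀ v, s ^ 2 * inner ℂ (vl v) (vl e) + inner ℂ (gr v) (gr e)
      = inner ℂ (gr v) R + inner ℂ (vl v) η)
    (ho : ∀ v ∈ Vh, inner ℂ (gr v) R = inner ℂ (gr v) δ)
    (hχ : ∀ w, s ^ 2 * inner ℂ (vl χ) (vl w) + inner ℂ (gr χ) (gr w)
      = (‖s‖ : ℂ) ^ 2 * inner ℂ (vl e) (vl w))
    (hdist : ∀ c, (∀ v ∈ Vh, c ≤ ‖gr (χ - v)‖) → c ≤ Γ * (‖s‖ * ‖vl e‖)) :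
    ‖s‖ ^ 2 * ‖vl e‖ ^ 2 + ‖gr e‖ ^ 2 ≤ ‖R‖ ^ 2 + 20 / s.re ^ 2 * (‖s‖ * ‖δ‖) ^ 2
      + 40 * Γ ^ 2 * ‖R‖ ^ 2 + 11 / s.re ^ 2 * ‖η‖ ^ 2 := by
  have hs0 : 0 < ‖s‖ := norm_pos_iff.2 fun h0 => by simp [h0] at hs
  have hρs : s.re ≤ ‖s‖ := Complex.re_le_norm s
  set ρ := s.re with hρ
  set X := ‖s‖ * ‖vl e‖ with hX
  have hX0 : 0 ≤ X := by positivity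
  -- The closure of `∇V_h`. Projecting `∇χ` onto it replaces a best approximation in `V_h`, whose
  -- existence is then not needed.
  set K : Submodule ℂ G := (Vh.map (gr : V →ₗ[ℂ] G)).topologicalClosure with hK
  have : CompleteSpace K := (Submodule.isClosed_topologicalClosure _).completeSpace_coe
  set p : G := K.starProjection (gr χ) with hp
  have hpK : p ∈ K := by
    rw [hp]
    exact Submodule.starProjection_apply_mem K (gr χ)
  have hpn : ‖p‖ ≤ ‖gr χ‖ := K.norm_starProjection_apply_le (gr χ)
  have horth : ∀ k ∈ K, inner ℂ k R = inner ℂ k δ := by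
    intro k hk
    have hcl : IsClosed {k : G | inner ℂ k R = inner ℂ k δ} :=
      isClosed_eq (by fun_prop) (by fun_prop)
    refine closure_minimal ?_ hcl hk
    rintro _ ⟨v, hv, rfl⟩
    exact ho v hv
  -- By Pythagoras the distance to the projection is a lower bound for every `‖∇(χ - v)‖`, and
  -- `hdist` bounds all such lower bounds.
  have hpd : ‖gr χ - p‖ ≤ Γ * X := by
    refine hdist _ fun v hv => ?_
    rw [map_sub]
    have hv' : gr v ∈ K := Submodule.le_topologicalClosure _ ⟨v, hv, rfl⟩
    have hpy : ‖gr χ - gr v‖ ^ 2 = ‖gr χ - p‖ ^ 2 + ‖p - gr v‖ ^ 2 := by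
      have h0 : inner ℂ (gr χ - p) (p - gr v) = 0 :=
        K.starProjection_inner_eq_zero (gr χ) (p - gr v) (K.sub_mem hpK hv')
      have := norm_add_sq_eq_norm_sq_add_norm_sq_of_inner_eq_zero (𝕜 := ℂ) _ _ h0
      rw [sub_add_sub_cancel] at this
      nlinarith
    refine le_of_sq_le_sq ?_ (norm_nonneg _)
    nlinarith [sq_nonneg ‖p - gr v‖]
  have hχg := norm_gr_adjoint_le hs hχ
  have hχv := norm_vl_adjoint_le hs hχ
  have e1 : ‖s‖ ^ 2 * ‖vl e‖ / ρ = ‖s‖ * X / ρ := by rw [hX]; ring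
  rw [e1] at hχg
  -- Duality: the error equation tested with `χ` gives `|s|²‖e‖² = (∇χ - p, R) + (p, δ) + (χ, η)`,
  -- where `R` was exchanged for `δ` on `p` by orthogonality. The three terms use the approximation
  -- factor and the two stability bounds for `χ`.
  have hdual : X ^ 2 ≤ X * (Γ * ‖R‖ + ‖s‖ * ‖δ‖ / ρ + ‖η‖ / ρ) := by
    have h1 : ((‖s‖ : ℂ)) ^ 2 * inner ℂ (vl e) (vl e)
        = inner ℂ (gr χ - p) R + inner ℂ p δ + inner ℂ (vl χ) η := by
      rw [← hχ e, he χ, inner_sub_left, horth p hpK]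
      ring
    have h2 : ‖((‖s‖ : ℂ)) ^ 2 * inner ℂ (vl e) (vl e)‖ = X ^ 2 := by
      rw [inner_self_eq_norm_sq_to_K, norm_mul]
      simp [hX, mul_pow]
    rw [← h2, h1]
    have b1 : ‖inner ℂ (gr χ - p) R‖ ≤ Γ * X * ‖R‖ :=
      (norm_inner_le_norm _ _).trans (by gcongr)
    have b2 : ‖inner ℂ p δ‖ ≤ ‖s‖ * X / ρ * ‖δ‖ :=
      (norm_inner_le_norm _ _).trans (by gcongr; exact hpn.trans hχg)
    have b3 : ‖inner ℂ (vl χ) η‖ ≤ X / ρ * ‖η‖ :=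
      (norm_inner_le_norm _ _).trans (by gcongr)
    refine (norm_add_le_of_le (norm_add_le_of_le b1 b2) b3).trans (le_of_eq ?_)
    ring
  have hXle : X ≤ Γ * ‖R‖ + ‖s‖ * ‖δ‖ / ρ + ‖η‖ / ρ := by
    rcases hX0.eq_or_lt with h0 | h0
    · rw [← h0]
      positivity
    · rw [sq] at hdual
      exact le_of_mul_le_mul_left hdual h0
  -- The real part of the error equation tested with `e`, with `Re s² = 2ρ² - |s|²`. Young's
  -- inequality absorbs half of `‖∇e‖²`; after doubling, `‖R‖²` has coefficient exactly 1.
  have henergy : ‖s‖ ^ 2 * ‖vl e‖ ^ 2 + ‖gr e‖ ^ 2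
      ≤ ‖R‖ ^ 2 + (‖η‖ / ρ) ^ 2 + 4 * X ^ 2 := by
    have h1 := he e
    rw [inner_vl_self] at h1
    have h2 := congrArg Complex.re h1
    have h3 : (s ^ 2 * (‖vl e‖ : ℂ) ^ 2 + (‖gr e‖ : ℂ) ^ 2).re
        = (2 * ρ ^ 2 - ‖s‖ ^ 2) * ‖vl e‖ ^ 2 + ‖gr e‖ ^ 2 := by
      rw [Complex.sq_norm, Complex.normSq_apply]
      simp only [pow_two, hρ, Complex.add_re, Complex.mul_re, Complex.mul_im, Complex.ofReal_re,
        Complex.ofReal_im]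
      ring
    rw [h3, Complex.add_re] at h2
    have b1 : (inner ℂ (gr e) R).re ≤ ‖gr e‖ * ‖R‖ :=
      (Complex.re_le_norm _).trans (norm_inner_le_norm _ _)
    have b2 : (inner ℂ (vl e) η).re ≤ X * (‖η‖ / ρ) := by
      refine ((Complex.re_le_norm _).trans (norm_inner_le_norm _ _)).trans ?_
      rw [mul_div_assoc', le_div_iff₀ hs]
      have := mul_le_mul_of_nonneg_right hρs (mul_nonneg (norm_nonneg (vl e)) (norm_nonneg η))
      rw [hX]
      linarith
    have hX2 : X ^ 2 = ‖s‖ ^ 2 * ‖vl e‖ ^ 2 := by rw [hX, mul_pow]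
    have b3 : 0 ≤ ρ ^ 2 * ‖vl e‖ ^ 2 := by positivity
    nlinarith [sq_nonneg (‖gr e‖ - ‖R‖), sq_nonneg (X - ‖η‖ / ρ)]
  have hsq := pow_le_pow_left₀ hX0 hXle 2
  have r1 : 20 / ρ ^ 2 * (‖s‖ * ‖δ‖) ^ 2 = 20 * (‖s‖ * ‖δ‖ / ρ) ^ 2 := by ring
  have r2 : 11 / ρ ^ 2 * ‖η‖ ^ 2 = 11 * (‖η‖ / ρ) ^ 2 := by ring
  have r3 : 40 * Γ ^ 2 * ‖R‖ ^ 2 = 40 * (Γ * ‖R‖) ^ 2 := by ring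
  rw [r1, r2, r3]
  generalize ‖s‖ * ‖δ‖ / ρ = y at *
  generalize ‖η‖ / ρ = z at *
  generalize Γ * ‖R‖ = x at *
  -- What remains is `4(x + y + z)² + z² ≤ 40x² + 20y² + 11z²`, a weighted Cauchy–Schwarz inequality
  -- with weights `1/10 + 1/5 + 2/5 ≤ 1`.
  nlinarith [sq_nonneg (2 * x - y), sq_nonneg (7 * x - z), sq_nonneg (7 * y - 2 * z),
    sq_nonneg (x - y / 2), sq_nonneg z]

/-- The error estimate at high frequencies. -/
lemma high_frequency (hs : 0 < s.re) {Vh : Submodule ℂ V} {u w : V} {δ : G}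
    {F η : H}
    (hu : ∀ v, s ^ 2 * inner ℂ (vl v) (vl u) + inner ℂ (gr v) (gr u) = inner ℂ (vl v) F)
    (hw : w ∈ Vh.topologicalClosure)
    (hwe : ∀ v ∈ Vh, s ^ 2 * inner ℂ (vl v) (vl w) + inner ℂ (gr v) (gr w)
      = inner ℂ (vl v) (F - η) - inner ℂ (gr v) δ) :
    ‖s‖ ^ 2 * ‖vl (u - w)‖ ^ 2 + ‖gr (u - w)‖ ^ 2 ≤ 20 / s.re ^ 2 * (‖s‖ * ‖δ‖) ^ 2
      + 11 / s.re ^ 2 * ‖η‖ ^ 2 + 8 / s.re ^ 2 * ‖F‖ ^ 2 := by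
  set ρ := s.re with hρ
  -- The equation holds for test functions in `V_h` and extends by continuity to the closure, so `w`
  -- itself may be used.
  have hwe' : s ^ 2 * inner ℂ (vl w) (vl w) + inner ℂ (gr w) (gr w)
      = inner ℂ (vl w) (F - η) + inner ℂ (gr w) (-δ) := by
    have hcl : IsClosed {v : V | s ^ 2 * inner ℂ (vl v) (vl w) + inner ℂ (gr v) (gr w)
        = inner ℂ (vl v) (F - η) - inner ℂ (gr v) δ} :=
      isClosed_eq (by fun_prop) (by fun_prop)
    rw [inner_neg_right, ← sub_eq_add_neg]
    exact closure_minimal hwe hcl hw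
  have hu' := energy_le_of_eq (a := F) (b := (0 : G)) hs
    (by rw [hu u, inner_zero_right, add_zero])
  have hw' := energy_le_of_eq hs hwe'
  rw [norm_zero, mul_zero, add_zero] at hu'
  rw [norm_neg] at hw'
  set E1 := √(‖s‖ ^ 2 * ‖vl u‖ ^ 2 + ‖gr u‖ ^ 2) with hE1
  set E2 := √(‖s‖ ^ 2 * ‖vl w‖ ^ 2 + ‖gr w‖ ^ 2) with hE2
  have q1 : E1 ^ 2 = ‖s‖ ^ 2 * ‖vl u‖ ^ 2 + ‖gr u‖ ^ 2 := Real.sq_sqrt (by positivity)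
  have q2 : E2 ^ 2 = ‖s‖ ^ 2 * ‖vl w‖ ^ 2 + ‖gr w‖ ^ 2 := Real.sq_sqrt (by positivity)
  have n1 : 0 ≤ E1 := Real.sqrt_nonneg _
  have n2 : 0 ≤ E2 := Real.sqrt_nonneg _
  have hcs : ‖s‖ ^ 2 * (‖vl u‖ * ‖vl w‖) + ‖gr u‖ * ‖gr w‖ ≤ E1 * E2 := by
    refine le_of_sq_le_sq ?_ (by positivity)
    rw [mul_pow, q1, q2]
    nlinarith [sq_nonneg (‖s‖ * (‖vl u‖ * ‖gr w‖ - ‖vl w‖ * ‖gr u‖))]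
  have htri : ‖s‖ ^ 2 * ‖vl (u - w)‖ ^ 2 + ‖gr (u - w)‖ ^ 2 ≤ (E1 + E2) ^ 2 := by
    have t1 : ‖vl (u - w)‖ ^ 2 ≤ (‖vl u‖ + ‖vl w‖) ^ 2 := by
      rw [map_sub]
      exact pow_le_pow_left₀ (norm_nonneg _) (norm_sub_le _ _) 2
    have t2 : ‖gr (u - w)‖ ^ 2 ≤ (‖gr u‖ + ‖gr w‖) ^ 2 := by
      rw [map_sub]
      exact pow_le_pow_left₀ (norm_nonneg _) (norm_sub_le _ _) 2
    have t3 := mul_le_mul_of_nonneg_left t1 (sq_nonneg ‖s‖)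
    nlinarith
  have hsum : E1 + E2 ≤ 2 * (‖F‖ / ρ) + ‖η‖ / ρ + ‖s‖ * ‖δ‖ / ρ := by
    have : (‖F - η‖ + ‖s‖ * ‖δ‖) / ρ ≤ (‖F‖ + ‖η‖ + ‖s‖ * ‖δ‖) / ρ := by
      gcongr
      exact norm_sub_le _ _
    have e : (‖F‖ + ‖η‖ + ‖s‖ * ‖δ‖) / ρ = ‖F‖ / ρ + ‖η‖ / ρ + ‖s‖ * ‖δ‖ / ρ := by ring
    linarith
  have hsq := pow_le_pow_left₀ (by positivity) hsum 2
  have r1 : 20 / ρ ^ 2 * (‖s‖ * ‖δ‖) ^ 2 = 20 * (‖s‖ * ‖δ‖ / ρ) ^ 2 := by ring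
  have r2 : 11 / ρ ^ 2 * ‖η‖ ^ 2 = 11 * (‖η‖ / ρ) ^ 2 := by ring
  have r3 : 8 / ρ ^ 2 * ‖F‖ ^ 2 = 8 * (‖F‖ / ρ) ^ 2 := by ring
  rw [r1, r2, r3]
  generalize ‖s‖ * ‖δ‖ / ρ = y at *
  generalize ‖η‖ / ρ = z at *
  generalize ‖F‖ / ρ = x at *
  -- `(2x + y + z)² ≤ 8x² + 20y² + 11z²`. The factor 2 arises because `F` drives both solutions.
  nlinarith [sq_nonneg (x - y), sq_nonneg (x - z), sq_nonneg (y - z), sq_nonneg y, sq_nonneg z]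

end Frequency

/-! ### The approximation factor -/

section Gamma
variable {d : ℕ} {Ω : Set (EuclideanSpace ℝ (Fin d))} {Vh : Submodule ℂ (H10 ℂ Ω)} {s : ℂ}

lemma iInf_le_enorm_grad (χ : H10 ℂ Ω) : ⨅ v ∈ Vh, ‖grad (χ - v)‖ₑ ≤ ‖grad χ‖ₑ := by
  refine (iInf₂_le 0 Vh.zero_mem).trans (le_of_eq ?_)
  rw [sub_zero]

/-- The best approximation error of `χ_g` in terms of the approximation factor. -/
lemma iInf_le_gammaS (hs : 0 < s.re) {g : L2 Ω ℂ} {χ : H10 ℂ Ω} (h : IsAdjointSolution s g χ) :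
    ⨅ v ∈ Vh, ‖grad (χ - v)‖ₑ ≤ gammaS Vh s * ENNReal.ofReal (‖s‖ * ‖g‖) := by
  have hs0 : 0 < ‖s‖ := norm_pos_iff.2 fun h0 => by simp [h0] at hs
  rcases (norm_nonneg g).eq_or_lt with h0 | h0
  · refine (iInf_le_enorm_grad χ).trans ?_
    have := norm_gr_adjoint_le hs h
    rw [← h0, mul_zero, zero_div] at this
    rw [← ofReal_norm, le_antisymm this (norm_nonneg _)]
    simp
  · set m : ℝ := ‖s‖ * ‖g‖ with hm
    have hm0 : 0 < m := by positivity
    have hmc : (m : ℂ) ≠ 0 := by exact_mod_cast hm0.ne'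
    have hadj : IsAdjointSolution s ((m : ℂ)⁻¹ • g) ((m : ℂ)⁻¹ • χ) := by
      intro w
      rw [map_smul, map_smul, inner_smul_left, inner_smul_left, inner_smul_left]
      linear_combination (starRingEnd ℂ (m : ℂ)⁻¹) * h w
    have hg1 : ‖s‖ * ‖(m : ℂ)⁻¹ • g‖ = 1 := by
      rw [norm_smul, norm_inv, Complex.norm_real, Real.norm_of_nonneg hm0.le]
      field_simp
      rw [hm]
    have h1 : ⨅ v ∈ Vh, ‖grad ((m : ℂ)⁻¹ • χ - v)‖ₑ ≤ gammaS Vh s :=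
      le_iSup_of_le ((m : ℂ)⁻¹ • g) (le_iSup_of_le hg1 (le_iSup_of_le ((m : ℂ)⁻¹ • χ)
        (le_iSup_of_le hadj le_rfl)))
    have hM0 : ENNReal.ofReal m ≠ 0 := by simpa using hm0
    refine le_trans ?_ (mul_le_mul_left h1 (ENNReal.ofReal m))
    rw [mul_comm, ← ENNReal.div_le_iff' hM0 ENNReal.ofReal_ne_top]
    refine le_iInf₂ fun v hv => ?_
    rw [ENNReal.div_le_iff' hM0 ENNReal.ofReal_ne_top]
    refine (iInf₂_le ((m : ℂ) • v) (Vh.smul_mem _ hv)).trans (le_of_eq ?_)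
    have e : χ - (m : ℂ) • v = (m : ℂ) • ((m : ℂ)⁻¹ • χ - v) := by
      rw [smul_sub, smul_inv_smul₀ hmc]
    rw [e, map_smul, enorm_smul, ← ofReal_norm (m : ℂ), Complex.norm_real,
      Real.norm_of_nonneg hm0.le]

/-- The zero function is an admissible approximation, so stability of the adjoint problem alone
bounds the factor. -/
lemma gammaS_le (hs : 0 < s.re) : gammaS Vh s ≤ ENNReal.ofReal (‖s‖ / s.re) := by
  refine iSup_le fun g => iSup_le fun hg => iSup_le fun χ => iSup_le fun h => ?_
  refine (iInf_le_enorm_grad χ).trans ?_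
  rw [← ofReal_norm]
  refine ENNReal.ofReal_le_ofReal ((norm_gr_adjoint_le hs h).trans (le_of_eq ?_))
  rw [sq, mul_assoc, hg, mul_one]

/-- The approximation factor depends continuously on `s`. -/
lemma gammaS_le_mul {s' : ℂ} {ρ ε : ℝ} (hρ : 0 < ρ) (hs : ρ ≤ s.re) (hs' : ρ ≤ s'.re)
    (hε : ‖s' - s‖ ≤ ε) :
    gammaS Vh s' ≤ ENNReal.ofReal (1 + ε / ρ + ε * (2 + ε / ρ) / ρ) * gammaS Vh s := by
  have hε0 : 0 ≤ ε := (norm_nonneg _).trans hε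
  have hn : ρ ≤ ‖s‖ := hs.trans (Complex.re_le_norm s)
  have hs0 : 0 < ‖s‖ := hρ.trans_le hn
  have hsc : (‖s‖ : ℂ) ≠ 0 := by exact_mod_cast hs0.ne'
  refine iSup_le fun g => iSup_le fun hg => iSup_le fun χ => iSup_le fun h => ?_
  -- The adjoint solution at `s'` also solves the adjoint problem at `s`, once the difference `(s'²
  -- - s²) χ` is moved into the datum; conjugation appears because `χ` sits in the conjugate slot.
  set g' : L2 Ω ℂ := ((‖s'‖ : ℂ) ^ 2 / (‖s‖ : ℂ) ^ 2) • g
    - (starRingEnd ℂ (s' ^ 2 - s ^ 2) / (‖s‖ : ℂ) ^ 2) • val χ with hg'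
  have hadj : IsAdjointSolution s g' χ := by
    intro w
    have := h w
    rw [hg', inner_sub_left, inner_smul_left, inner_smul_left]
    simp only [map_div₀, map_pow, Complex.conj_ofReal, Complex.conj_conj]
    field_simp
    linear_combination this
  refine (iInf_le_gammaS (hρ.trans_le hs) hadj).trans ?_
  rw [mul_comm]
  gcongr
  have hχ : ‖val χ‖ ≤ 1 / ρ := by
    refine (norm_vl_adjoint_le (hρ.trans_le hs') h).trans ?_
    rw [hg]
    exact one_div_le_one_div_of_le hρ hs'
  have h1 : ‖g'‖ ≤ ‖s'‖ ^ 2 / ‖s‖ ^ 2 * ‖g‖ + ‖s' ^ 2 - s ^ 2‖ / ‖s‖ ^ 2 * (1 / ρ) := by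
    refine norm_sub_le_of_le ?_ ?_
    · rw [norm_smul]
      simp
    · rw [norm_smul, norm_div, RCLike.norm_conj]
      simp only [norm_pow, Complex.norm_real, norm_norm]
      gcongr
  have h2 : ‖s' ^ 2 - s ^ 2‖ ≤ ε * (2 * ‖s‖ + ε) := by
    have e : s' ^ 2 - s ^ 2 = (s' - s) * (2 * s + (s' - s)) := by ring
    rw [e, norm_mul]
    refine mul_le_mul hε ?_ (norm_nonneg _) hε0
    refine norm_add_le_of_le ?_ hε
    rw [norm_mul]
    simp
  have h3 : ‖s'‖ ≤ ‖s‖ + ε := by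
    have : s' = s + (s' - s) := by ring
    rw [this]
    exact norm_add_le_of_le le_rfl hε
  calc ‖s‖ * ‖g'‖ ≤ ‖s‖ * (‖s'‖ ^ 2 / ‖s‖ ^ 2 * ‖g‖ + ‖s' ^ 2 - s ^ 2‖ / ‖s‖ ^ 2 * (1 / ρ)) := by
        gcongr
    _ = ‖s'‖ * (‖s'‖ * ‖g‖) / ‖s‖ + ‖s' ^ 2 - s ^ 2‖ / ‖s‖ / ρ := by
        field_simp
    _ ≤ (‖s‖ + ε) / ‖s‖ + ε * (2 * ‖s‖ + ε) / ‖s‖ / ρ := by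
        rw [hg, mul_one]
        gcongr
    _ = 1 + ε / ‖s‖ + ε * (2 + ε / ‖s‖) / ρ := by
        field_simp
    _ ≤ _ := by gcongr

lemma gammaRhoOmega_le_mul {ρ ω ε : ℝ} (hρ : 0 < ρ) (hε : 0 ≤ ε) : gammaRhoOmega Vh (ρ + ε) ω
    ≤ ENNReal.ofReal (1 + ε / ρ + ε * (2 + ε / ρ) / ρ) * gammaRhoOmega Vh ρ ω := by
  refine iSup_le fun ν => iSup_le fun hν => ?_
  refine (gammaS_le_mul (Vh := Vh) (s := ρ + ν * Complex.I) (ε := ε) hρ (by simp) (by simpa)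
    ?_).trans ?_
  · have : ((ρ + ε : ℝ) : ℂ) + ν * Complex.I - (ρ + ν * Complex.I) = (ε : ℂ) := by
      push_cast
      ring
    rw [this, Complex.norm_real, Real.norm_of_nonneg hε]
  · gcongr
    exact le_iSup₂ (f := fun (ν : ℝ) (_ : |ν| ≤ ω) => gammaS Vh (ρ + ν * Complex.I)) ν hν

lemma gammaRhoOmega_ne_top {ρ ω : ℝ} (hρ : 0 < ρ) : gammaRhoOmega Vh ρ ω ≠ ∞ := by
  refine ne_top_of_le_ne_top (b := ENNReal.ofReal ((ρ + ω) / ρ)) ENNReal.ofReal_ne_top ?_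
  refine iSup_le fun ν => iSup_le fun hν => (gammaS_le (by simpa)).trans ?_
  refine ENNReal.ofReal_le_ofReal ?_
  have h1 : ((ρ : ℂ) + ν * Complex.I).re = ρ := by simp
  rw [h1]
  gcongr
  refine norm_add_le_of_le ?_ ?_
  · rw [Complex.norm_real, Real.norm_of_nonneg hρ.le]
  · simpa using hν

end Gamma

/-! ### The equations in the frequency domain -/

section FrequencyEquations
variable {d : ℕ} {Ω : Set (EuclideanSpace ℝ (Fin d))} {s : ℂ} {a : ℝ}

lemma inner_cVal_lap {A : ℝ → L2 Ω ℝ} (hA : ExpGrowth a A) (hs : a < s.re) (b : L2 Ω ℝ) :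
    inner ℂ (cVal b) (lap s fun t => cVal (A t))
      = lap s fun t => ((inner ℝ (A t) b : ℝ) : ℂ) := by
  have h := lap_clm (hA.clm (cVal (Ω := Ω))) hs (innerSL ℂ (cVal b))
  simp only [innerSL_apply_apply, inner_cVal] at h
  rw [← h]
  simp only [real_inner_comm]

lemma inner_cGrad_lap {A : ℝ → L2 Ω (EuclideanSpace ℝ (Fin d))} (hA : ExpGrowth a A)
    (hs : a < s.re) (b : L2 Ω (EuclideanSpace ℝ (Fin d))) :
    inner ℂ (cGrad b) (lap s fun t => cGrad (A t))
      = lap s fun t => ((inner ℝ (A t) b : ℝ) : ℂ) := by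
  have h := lap_clm (hA.clm (cGrad (Ω := Ω))) hs (innerSL ℂ (cGrad b))
  simp only [innerSL_apply_apply, inner_cGrad] at h
  rw [← h]
  simp only [real_inner_comm]

/-- A conjugate-linear relation for real test functions extends to complex ones. -/
lemma relation_of_real {S : Submodule ℝ (H10 ℝ Ω)} {p : L2 Ω ℂ}
    {q : L2 Ω (EuclideanSpace ℂ (Fin d))}
    (h : ∀ v ∈ S, inner ℂ (cVal (val v)) p + inner ℂ (cGrad (grad v)) q = 0) {v : H10 ℂ Ω}
    (hre : mapH10 Complex.reCLM v ∈ S) (him : mapH10 Complex.imCLM v ∈ S) :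
    inner ℂ (val v) p + inner ℂ (grad v) q = 0 := by
  rw [eq_re_add_im v, map_add, map_add, map_smul, map_smul, inner_add_left, inner_add_left,
    inner_smul_left, inner_smul_left, val_cH10, val_cH10, grad_cH10, grad_cH10]
  linear_combination h _ hre + starRingEnd ℂ Complex.I * h _ him

lemma lap_val {φ : ℝ → H10 ℝ Ω} (h : ExpGrowth a φ) (hs : a < s.re) :
    val (lap s fun t => cH10 (φ t)) = lap s fun t => cVal (val (φ t)) :=
  (lap_clm (h.clm (cH10 (Ω := Ω))) hs (val (𝕜 := ℂ) (Ω := Ω))).symm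

lemma lap_grad {φ : ℝ → H10 ℝ Ω} (h : ExpGrowth a φ) (hs : a < s.re) :
    grad (lap s fun t => cH10 (φ t)) = lap s fun t => cGrad (grad (φ t)) :=
  (lap_clm (h.clm (cH10 (Ω := Ω))) hs (grad (𝕜 := ℂ) (Ω := Ω))).symm

/-- The wave equation in the frequency domain. -/
lemma wave_frequency {f : ℝ → L2 Ω ℝ} {u : ℝ → H10 ℝ Ω} (hu : IsWaveSolution f u)
    (hug : ExpGrowth a u) (hug' : ExpGrowth a (timeDeriv 1 fun t => val (u t)))
    (hf : ExpGrowth a f) (hs : a < s.re) (v : H10 ℂ Ω) :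
    s ^ 2 * inner ℂ (val v) (val (lap s fun t => cH10 (u t)))
      + inner ℂ (grad v) (grad (lap s fun t => cH10 (u t)))
      = inner ℂ (val v) (lap s fun t => cVal (f t)) := by
  have hval : ExpGrowth a fun t => val (u t) := hug.clm (val (𝕜 := ℝ) (Ω := Ω))
  have hgrad : ExpGrowth a fun t => grad (u t) := hug.clm (grad (𝕜 := ℝ) (Ω := Ω))
  have key : ∀ b ∈ (⊤ : Submodule ℝ (H10 ℝ Ω)),
      inner ℂ (cVal (val b)) (s ^ 2 • (lap s fun t => cVal (val (u t)))
        - lap s fun t => cVal (f t))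
      + inner ℂ (cGrad (grad b)) (lap s fun t => cGrad (grad (u t))) = 0 := by
    intro b _
    let ℓ : L2 Ω ℝ →L[ℝ] ℂ := Complex.ofRealCLM.comp (innerSL ℝ (val b))
    let ℓ' : L2 Ω (EuclideanSpace ℝ (Fin d)) →L[ℝ] ℂ := Complex.ofRealCLM.comp (innerSL ℝ (grad b))
    have hℓ : ∀ x, ℓ x = ((inner ℝ x (val b) : ℝ) : ℂ) := fun x => by
      rw [real_inner_comm]; rfl
    have hℓ' : ∀ x, ℓ' x = ((inner ℝ x (grad b) : ℝ) : ℂ) := fun x => by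
      rw [real_inner_comm]; rfl
    -- No growth bound is known for `u''` in `L²`. Paired with a fixed `b`, it equals `(f, b) - (∇u,
    -- ∇b)` by the equation, and this scalar function has the required growth.
    have hy2 : ∀ t ≥ 0, ℓ (f t) - ℓ' (grad (u t)) = ℓ (timeDeriv 2 (fun t => val (u t)) t) := by
      intro t ht
      rw [hℓ, hℓ', hℓ, ← hu.equation t ht b]
      push_cast
      ring
    have d1 := lap_deriv (φ := fun t => ℓ (val (u t)))
      (φ' := fun t => ℓ (timeDeriv 1 (fun t => val (u t)) t)) (hval.clm ℓ) (hug'.clm ℓ)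
      (ℓ.continuous.comp_continuousOn hu.contDiffOn.continuousOn)
      (fun t ht => ℓ.hasFDerivAt.comp_hasDerivWithinAt t
        ((hu.hasDerivWithinAt ht).mono (Ici_subset_Ici.2 ht)))
      (by simp only [hu.initial, map_zero]) hs
    have d2 := lap_deriv (φ := fun t => ℓ (timeDeriv 1 (fun t => val (u t)) t))
      (φ' := fun t => ℓ (f t) - ℓ' (grad (u t))) (hug'.clm ℓ) ((hf.clm ℓ).sub (hgrad.clm ℓ'))
      (ℓ.continuous.comp_continuousOn (hu.continuousOn_timeDeriv (by norm_num)))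
      (fun t ht => by
        rw [hy2 t ht]
        exact ℓ.hasFDerivAt.comp_hasDerivWithinAt t
          ((hu.hasDerivWithinAt₂ ht).mono (Ici_subset_Ici.2 ht)))
      (by simp only [hu.initial_deriv, map_zero]) hs
    rw [d1, lap_sub (hf.clm ℓ) (hgrad.clm ℓ') hs] at d2
    rw [inner_sub_right, inner_smul_right, inner_cVal_lap hval hs, inner_cVal_lap hf hs,
      inner_cGrad_lap hgrad hs]
    simp only [hℓ, hℓ', smul_eq_mul] at d2
    linear_combination -d2
  have := relation_of_real key (v := v) trivial trivial
  rw [inner_sub_right, inner_smul_right] at this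
  rw [lap_val hug hs, lap_grad hug hs]
  linear_combination this

end FrequencyEquations

/-! ### The discrete equations in the frequency domain -/

section DiscreteFrequency
variable {d : ℕ} {Ω : Set (EuclideanSpace ℝ (Fin d))} {s : ℂ} {a τ : ℝ} {f : ℝ → L2 Ω ℝ}
  {U : ℕ → H10 ℝ Ω} {Vh : Submodule ℝ (H10 ℝ Ω)}

/-- A linear relation in the time domain carries over to the frequency domain. -/
lemma lap_relation {S : Submodule ℝ (H10 ℝ Ω)} {A : ℝ → L2 Ω ℝ}
    {B : ℝ → L2 Ω (EuclideanSpace ℝ (Fin d))} (hA : ExpGrowth a A) (hB : ExpGrowth a B)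
    (hs : a < s.re)
    (h : ∀ t ≥ 0, ∀ v ∈ S, inner ℝ (A t) (val v) + inner ℝ (B t) (grad v) = 0) {v : H10 ℂ Ω}
    (hre : mapH10 Complex.reCLM v ∈ S) (him : mapH10 Complex.imCLM v ∈ S) :
    inner ℂ (val v) (lap s fun t => cVal (A t)) + inner ℂ (grad v) (lap s fun t => cGrad (B t))
      = 0 := by
  refine relation_of_real (S := S) (fun b hb => ?_) hre him
  have h1 : ExpGrowth a fun t => ((inner ℝ (A t) (val b) : ℝ) : ℂ) := by
    have := hA.clm (Complex.ofRealCLM.comp (innerSL ℝ (val b)))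
    simpa [real_inner_comm] using this
  have h2 : ExpGrowth a fun t => ((inner ℝ (B t) (grad b) : ℝ) : ℂ) := by
    have := hB.clm (Complex.ofRealCLM.comp (innerSL ℝ (grad b)))
    simpa [real_inner_comm] using this
  rw [inner_cVal_lap hA hs, inner_cGrad_lap hB hs, ← lap_add h1 h2 hs,
    lap_congr (ψ := fun _ => (0 : ℂ))]
  · simp [lap]
  · intro t ht
    exact_mod_cast h t ht b hb

lemma lap_wDDot (ha : 0 ≤ a) (hτ : 0 < τ) (hU : IsLeapfrogSolution Vh τ f U)
    (hW : SeqGrowth a τ (zeroExt U)) (hs : a < s.re) :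
    (lap s fun t => cVal (val (wDDot τ U t)))
      = s ^ 2 • val (lap s fun t => cH10 (reconL τ U t)) := by
  let L : H10 ℝ Ω →L[ℝ] H10 ℂ Ω := cH10
  have d1 := lap_deriv (φ := fun t => L (reconL τ U t)) (φ' := fun t => L (wDot τ U t))
    ((expGrowth_reconL ha hτ hW).clm L) ((expGrowth_wDot ha hτ hW).clm L)
    (L.continuous.comp (continuous_reconL hτ U)).continuousOn
    (fun t _ => (L.hasFDerivAt.comp_hasDerivAt t
      (hasDerivAt_reconL hτ U t)).hasDerivWithinAt)
    (by simp only [reconL_zero hτ hU, map_zero]) hs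
  have d2 := lap_deriv (φ := fun t => L (wDot τ U t)) (φ' := fun t => L (wDDot τ U t))
    ((expGrowth_wDot ha hτ hW).clm L) ((expGrowth_wDDot ha hτ hW).clm L)
    (L.continuous.comp (continuous_wDot hτ U)).continuousOn
    (fun t _ => (L.hasFDerivAt.comp_hasDerivAt t
      (hasDerivAt_wDot hτ U t)).hasDerivWithinAt)
    (by simp only [wDot_zero hτ hU, map_zero]) hs
  rw [← lap_val (expGrowth_wDDot ha hτ hW) hs, pow_two, mul_smul, ← map_smul, ← map_smul]
  exact congrArg _ (d2.trans (congrArg _ d1))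

/-- The equation for the reconstruction in the frequency domain. -/
lemma recon_frequency (ha : 0 ≤ a) (hτ : 0 < τ) (hU : IsLeapfrogSolution Vh τ f U)
    (hW : SeqGrowth a τ (zeroExt U)) (hf : ExpGrowth a f) {S : L2 Ω ℝ →L[ℝ] H10 ℝ Ω}
    (hS : ∀ g v, inner ℝ (grad (S g)) (grad v) = inner ℝ g (val v)) (hs : a < s.re)
    (v : H10 ℂ Ω) :
    s ^ 2 * inner ℂ (val v) (val (lap s fun t => cH10 (reconL τ U t)))
      + inner ℂ (grad v) (grad (lap s fun t => cH10 (reconL τ U t)))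
      = inner ℂ (val v) (lap s fun t => cVal (fTau τ f t))
        - inner ℂ (grad v) (lap s fun t => cGrad (grad (residualRep S τ f U t))) := by
  have gD : ExpGrowth a fun t => val (wDDot τ U t) :=
    (expGrowth_wDDot ha hτ hW).clm (val (𝕜 := ℝ) (Ω := Ω))
  have gF := expGrowth_fTau ha hτ hf
  have gL : ExpGrowth a fun t => grad (reconL τ U t) :=
    (expGrowth_reconL ha hτ hW).clm (grad (𝕜 := ℝ) (Ω := Ω))
  have gR : ExpGrowth a fun t => grad (residualRep S τ f U t) :=
    (expGrowth_residualRep ha hτ hf hW S).clm (grad (𝕜 := ℝ) (Ω := Ω))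
  have key := lap_relation (S := ⊤) (gD.sub gF) (gL.add gR) hs (fun t ht w _ => by
    rw [inner_add_left, inner_residualRep hS hτ ht, residual_apply hτ f U ht, inner_sub_left,
      inner_sub_left]
    ring) (v := v) trivial trivial
  simp only [map_sub, map_add] at key
  rw [lap_sub (gD.clm (cVal (Ω := Ω))) (gF.clm (cVal (Ω := Ω))) hs,
    lap_add (gL.clm (cGrad (Ω := Ω))) (gR.clm (cGrad (Ω := Ω))) hs, lap_wDDot ha hτ hU hW hs,
    inner_sub_right, inner_smul_right, inner_add_right] at key
  rw [lap_grad (expGrowth_reconL ha hτ hW) hs]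
  linear_combination key

/-- Galerkin orthogonality in the frequency domain. -/
lemma residual_frequency (ha : 0 ≤ a) (hτ : 0 < τ) (hU : IsLeapfrogSolution Vh τ f U)
    (hf0 : f 0 = 0) (hW : SeqGrowth a τ (zeroExt U)) (hf : ExpGrowth a f)
    {S : L2 Ω ℝ →L[ℝ] H10 ℝ Ω}
    (hS : ∀ g v, inner ℝ (grad (S g)) (grad v) = inner ℝ g (val v)) (hs : a < s.re)
    {v : H10 ℂ Ω} (hre : mapH10 Complex.reCLM v ∈ Vh) (him : mapH10 Complex.imCLM v ∈ Vh) :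
    inner ℂ (grad v) (lap s fun t => cGrad (grad (residualRep S τ f U t)))
      = inner ℂ (grad v) (lap s fun t => cGrad (grad (delta τ U t))) := by
  have gδ : ExpGrowth a fun t => grad (delta τ U t) :=
    (expGrowth_delta ha hτ hW).clm (grad (𝕜 := ℝ) (Ω := Ω))
  have gR : ExpGrowth a fun t => grad (residualRep S τ f U t) :=
    (expGrowth_residualRep ha hτ hf hW S).clm (grad (𝕜 := ℝ) (Ω := Ω))
  have g0 : ExpGrowth a fun _ : ℝ => (0 : L2 Ω ℝ) := ⟨aestronglyMeasurable_const, 0, by simp⟩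
  have key := lap_relation g0 (gR.sub gδ) hs (fun t ht w hw => by
    rw [inner_zero_left, inner_sub_left, inner_residualRep hS hτ ht,
      residual_apply_of_mem hτ hU hf0 ht hw]
    ring) hre him
  simp only [map_sub, map_zero] at key
  rw [lap_sub (gR.clm (cGrad (Ω := Ω))) (gδ.clm (cGrad (Ω := Ω))) hs, inner_sub_right] at key
  have z : (lap s fun _ => (0 : L2 Ω ℂ)) = 0 := by simp [lap]
  rw [z, inner_zero_right, zero_add] at key
  exact sub_eq_zero.1 key

lemma lap_deltaDot (ha : 0 ≤ a) (hτ : 0 < τ) (hU : IsLeapfrogSolution Vh τ f U)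
    (hW : SeqGrowth a τ (zeroExt U)) (hs : a < s.re) :
    (lap s fun t => cGrad (grad (deltaDot τ U t)))
      = s • lap s fun t => cGrad (grad (delta τ U t)) := by
  let L : H10 ℝ Ω →L[ℝ] L2 Ω (EuclideanSpace ℂ (Fin d)) := cGrad.comp grad
  exact lap_deriv (φ := fun t => L (delta τ U t)) (φ' := fun t => L (deltaDot τ U t))
    ((expGrowth_delta ha hτ hW).clm L) ((expGrowth_deltaDot ha hτ hW).clm L)
    (L.continuous.comp (continuous_delta hτ U)).continuousOn
    (fun t _ => L.hasFDerivAt.comp_hasDerivWithinAt t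
      (by rw [deltaDot_eq hτ]; exact hasDerivWithinAt_delta hτ U t))
    (by simp only [delta_zero hτ hU, map_zero]) hs

/-- Vectors orthogonal to `K` are orthogonal to the values, hence to the integral; the double
orthogonal complement is the closure. -/
lemma lap_mem_topologicalClosure {V : Type} [NormedAddCommGroup V] [InnerProductSpace ℂ V]
    [CompleteSpace V] {K : Submodule ℂ V} {φ : ℝ → V} (h : ExpGrowth a φ) (hs : a < s.re)
    (hK : ∀ t, φ t ∈ K) : lap s φ ∈ K.topologicalClosure := by
  rw [← Submodule.orthogonal_orthogonal_eq_closure]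
  intro z hz
  have := lap_clm h hs (innerSL ℂ z)
  simp only [innerSL_apply_apply] at this
  rw [← this, lap_congr (ψ := fun _ => (0 : ℂ))]
  · simp [lap]
  · intro t _
    exact Submodule.inner_left_of_mem_orthogonal (hK t) hz

end DiscreteFrequency

section LaplaceContinuity

lemma continuous_lap {E : Type} [NormedAddCommGroup E] [NormedSpace ℂ E] {a ρ : ℝ} (ha : a < ρ)
    {φ : ℝ → E} (h : ExpGrowth a φ) :
    Continuous fun ξ : ℝ => lap (ρ + (2 * Real.pi * ξ : ℝ) * Complex.I) φ := by
  have hre : ∀ ξ : ℝ, ((ρ : ℂ) + (2 * Real.pi * ξ : ℝ) * Complex.I).re = ρ := fun ξ => by simp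
  have hInt := (h.integrableOn (s := ρ) (by simpa using ha)).norm
  refine continuous_of_dominated (bound := fun t : ℝ => ‖Complex.exp (-(ρ : ℂ) * t) • φ t‖)
    (fun ξ => (h.integrableOn (by rw [hre]; exact ha)).aestronglyMeasurable)
    (fun ξ => Filter.Eventually.of_forall fun t => ?_) hInt
    (Filter.Eventually.of_forall fun t => by fun_prop)
  rw [norm_smul, norm_smul, norm_cexp_neg_mul, norm_cexp_neg_mul, hre, Complex.ofReal_re]

end LaplaceContinuity

/-! ### The error estimate at one frequency -/

section Main
variable {d : ℕ} {Ω : Set (EuclideanSpace ℝ (Fin d))}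
  {T : Geometry.SimplicialComplex ℝ (EuclideanSpace ℝ (Fin d))} {k : ℕ} {a τ ρ ω : ℝ} {r : ℕ}
  {f : ℝ → L2 Ω ℝ} {u : ℝ → H10 ℝ Ω} {U : ℕ → H10 ℝ Ω}

/-- The time derivative of the error, in `L²(Ω)`. -/
def errDot (τ : ℝ) (u : ℝ → H10 ℝ Ω) (U : ℕ → H10 ℝ Ω) (t : ℝ) : L2 Ω ℝ :=
  timeDeriv 1 (fun t => val (u t)) t - val (wDot τ U t)

lemma timeDeriv_error (hτ : 0 < τ) (hu : IsWaveSolution f u) {t : ℝ} (ht : 0 ≤ t) :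
    timeDeriv 1 (fun t => val (u t - reconL τ U t)) t = errDot τ u U t := by
  refine timeDeriv_one_eq ht ?_
  have h1 : HasDerivWithinAt (fun t => val (reconL τ U t)) (val (wDot τ U t)) (Ici 0) t :=
    ((val (Ω := Ω) (𝕜 := ℝ)).hasFDerivAt.comp_hasDerivAt t
      (hasDerivAt_reconL hτ U t)).hasDerivWithinAt
  have h2 := (hu.hasDerivWithinAt ht).sub h1
  refine h2.congr_of_eventuallyEq ?_ ?_
  · exact Filter.Eventually.of_forall fun t => map_sub _ _ _
  · exact map_sub _ _ _

/-- The hypotheses under which all the Laplace transforms converge for `Re s > a`. -/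
structure GrowthData (a τ : ℝ) (f : ℝ → L2 Ω ℝ) (u : ℝ → H10 ℝ Ω) (U : ℕ → H10 ℝ Ω) :
    Prop where
  pos : 0 < a
  step : 0 < τ
  source : ExpGrowth a f
  sol : ExpGrowth a u
  sol_deriv : ExpGrowth a (timeDeriv 1 fun t => val (u t))
  discrete : SeqGrowth a τ (zeroExt U)

lemma GrowthData.errDot (h : GrowthData a τ f u U) : ExpGrowth a (errDot τ u U) :=
  h.sol_deriv.sub ((expGrowth_wDot h.pos.le h.step h.discrete).clm (val (𝕜 := ℝ) (Ω := Ω)))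

lemma GrowthData.error (h : GrowthData a τ f u U) :
    ExpGrowth a fun t => u t - reconL τ U t :=
  h.sol.sub (expGrowth_reconL h.pos.le h.step h.discrete)

/-- This identifies the term `|s|‖ê‖` of the frequency energy with the transform of `e'`. -/
lemma lap_errDot (h : GrowthData a τ f u U) (hu : IsWaveSolution f u)
    {Vh : Submodule ℝ (H10 ℝ Ω)} (hU : IsLeapfrogSolution Vh τ f U) {s : ℂ} (hs : a < s.re) :
    (lap s fun t => cVal (errDot τ u U t))
      = s • val (lap s fun t => cH10 (u t - reconL τ U t)) := by
  rw [lap_val h.error hs]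
  have hval : ExpGrowth a fun t => val (u t - reconL τ U t) := h.error.clm (val (𝕜 := ℝ) (Ω := Ω))
  have hd : ∀ t ≥ 0, HasDerivWithinAt (fun t => val (u t - reconL τ U t)) (errDot τ u U t)
      (Ici 0) t := by
    intro t ht
    have h1 : HasDerivWithinAt (fun t => val (reconL τ U t)) (val (wDot τ U t)) (Ici 0) t :=
      ((val (Ω := Ω) (𝕜 := ℝ)).hasFDerivAt.comp_hasDerivAt t
        (hasDerivAt_reconL h.step U t)).hasDerivWithinAt
    refine ((hu.hasDerivWithinAt ht).sub h1).congr_of_eventuallyEq ?_ ?_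
    · exact Filter.Eventually.of_forall fun t => map_sub _ _ _
    · exact map_sub _ _ _
  refine lap_deriv (φ := fun t => cVal (val (u t - reconL τ U t)))
    (hval.clm (cVal (Ω := Ω))) (h.errDot.clm (cVal (Ω := Ω)))
    ((cVal (Ω := Ω)).continuous.comp_continuousOn fun t ht => (hd t ht).continuousWithinAt)
    (fun t ht => (cVal (Ω := Ω)).hasFDerivAt.comp_hasDerivWithinAt t
      ((hd t ht).mono (Ici_subset_Ici.2 ht))) ?_ hs
  simp only [hu.initial, reconL_zero h.step hU, map_zero, sub_zero]

lemma exists_adjointSolution {s : ℂ} (hs : 0 < s.re) (g : L2 Ω ℂ) :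
    ∃ χ : H10 ℂ Ω, IsAdjointSolution s g χ :=
  exists_adjoint (V := H10 ℂ Ω) (H := L2 Ω ℂ) (G := L2 Ω (EuclideanSpace ℂ (Fin d)))
    (vl := val (𝕜 := ℂ) (Ω := Ω)) (gr := grad (𝕜 := ℂ) (Ω := Ω)) hs (fun v => norm_sq_H10 v) g

/-- The real-valued form of the best approximation bound that serves as the hypothesis `hdist` of
`low_frequency`. -/
lemma le_toReal_gammaRhoOmega {Vh : Submodule ℂ (H10 ℂ Ω)} {s : ℂ} {ν : ℝ} (hρ : 0 < ρ)
    (hsν : s = ρ + ν * Complex.I) (hν : |ν| ≤ ω) {g : L2 Ω ℂ} {χ : H10 ℂ Ω}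
    (hχ : IsAdjointSolution s g χ) {c : ℝ} (hc : ∀ v ∈ Vh, c ≤ ‖grad (χ - v)‖) :
    c ≤ (gammaRhoOmega Vh ρ ω).toReal * (‖s‖ * ‖g‖) := by
  have hs0 : 0 < s.re := by simpa [hsν] using hρ
  have h1 : ENNReal.ofReal c ≤ ⨅ v ∈ Vh, ‖grad (χ - v)‖ₑ := by
    refine le_iInf₂ fun v hv => ?_
    rw [← ofReal_norm]
    exact ENNReal.ofReal_le_ofReal (hc v hv)
  have h2 : gammaS Vh s ≤ gammaRhoOmega Vh ρ ω := by
    rw [hsν]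
    exact le_iSup₂ (f := fun (ν : ℝ) (_ : |ν| ≤ ω) => gammaS Vh (ρ + ν * Complex.I)) ν hν
  have h3 : ENNReal.ofReal c ≤ gammaRhoOmega Vh ρ ω * ENNReal.ofReal (‖s‖ * ‖g‖) :=
    (h1.trans (iInf_le_gammaS hs0 hχ)).trans (by gcongr)
  rw [← ENNReal.ofReal_toReal (gammaRhoOmega_ne_top (Vh := Vh) (ω := ω) hρ),
    ← ENNReal.ofReal_mul ENNReal.toReal_nonneg] at h3
  exact (ENNReal.ofReal_le_ofReal_iff (by positivity)).1 h3

/-- The error estimate for the transformed problem at `s = ρ + iν`. -/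
lemma transformed_bound {Vh : Submodule ℂ (H10 ℂ Ω)} {s : ℂ} {ν : ℝ} (hρ : 0 < ρ) (hω : 0 < ω)
    (hsν : s = ρ + ν * Complex.I) {û ŵ : H10 ℂ Ω} {F η : L2 Ω ℂ}
    {δ R : L2 Ω (EuclideanSpace ℂ (Fin d))} (r : ℕ)
    (eu : ∀ v : H10 ℂ Ω, s ^ 2 * inner ℂ (val v) (val û) + inner ℂ (grad v) (grad û)
      = inner ℂ (val v) F)
    (ew : ∀ v : H10 ℂ Ω, s ^ 2 * inner ℂ (val v) (val ŵ) + inner ℂ (grad v) (grad ŵ)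
      = inner ℂ (val v) (F - η) - inner ℂ (grad v) R)
    (eo : ∀ v ∈ Vh, inner ℂ (grad v) R = inner ℂ (grad v) δ) (hŵ : ŵ ∈ Vh.topologicalClosure) :
    ‖s‖ ^ 2 * ‖val (û - ŵ)‖ ^ 2 + ‖grad (û - ŵ)‖ ^ 2 ≤
      ‖R‖ ^ 2 + 20 / ρ ^ 2 * (‖s‖ * ‖δ‖) ^ 2
        + 40 * (gammaRhoOmega Vh ρ ω).toReal ^ 2 * ‖R‖ ^ 2 + 11 / ρ ^ 2 * ‖η‖ ^ 2
        + 8 / ρ ^ 2 * (1 / ω ^ (2 * r)) * (‖s‖ ^ r * ‖F‖) ^ 2 := by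
  have hre : s.re = ρ := by simp [hsν]
  have him : s.im = ν := by simp [hsν]
  have hs0 : 0 < s.re := by rwa [hre]
  -- The cut at `ω`: the low-frequency bound lacks the last term of the estimate, the high-frequency
  -- bound lacks both residual terms.
  rcases le_or_gt |ν| ω with hν | hν
  · obtain ⟨χ, hχ⟩ := exists_adjointSolution hs0 (val (û - ŵ))
    have he : ∀ v : H10 ℂ Ω, s ^ 2 * inner ℂ (val v) (val (û - ŵ))
        + inner ℂ (grad v) (grad (û - ŵ)) = inner ℂ (grad v) R + inner ℂ (val v) η := by
      intro v
      have e1 := eu v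
      have e2 := ew v
      rw [inner_sub_right] at e2
      rw [map_sub, map_sub, inner_sub_right, inner_sub_right]
      linear_combination e1 - e2
    have key := low_frequency (vl := val (𝕜 := ℂ) (Ω := Ω)) (gr := grad (𝕜 := ℂ) (Ω := Ω))
      (Vh := Vh) (e := û - ŵ) (χ := χ) (R := R) (δ := δ) (η := η)
      hs0 ENNReal.toReal_nonneg he eo hχ
      (fun c hc => le_toReal_gammaRhoOmega (ω := ω) hρ hsν hν hχ hc)
    rw [hre] at key
    refine key.trans (le_add_of_nonneg_right ?_)
    positivity
  · have key := high_frequency (vl := val (𝕜 := ℂ) (Ω := Ω)) (gr := grad (𝕜 := ℂ) (Ω := Ω))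
      (Vh := Vh) (u := û) (w := ŵ) (δ := δ) (F := F)
      (η := η) hs0 eu hŵ (fun v hv => by rw [ew v, ← eo v hv])
    rw [hre] at key
    have hωs : ω ≤ ‖s‖ := by
      have := Complex.abs_im_le_norm s
      rw [him] at this
      linarith
    -- Above the cut `ω ≤ |s|`, so powers of `ω` may be traded for powers of `s`, that is, for time
    -- derivatives of the source.
    have hF2 : ‖F‖ ^ 2 ≤ 1 / ω ^ (2 * r) * (‖s‖ ^ r * ‖F‖) ^ 2 := by
      rw [one_div, ← div_eq_inv_mul, le_div_iff₀ (by positivity), mul_pow, ← pow_mul, mul_comm r 2,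
        mul_comm]
      gcongr
    have h4 : 8 / ρ ^ 2 * ‖F‖ ^ 2 ≤ 8 / ρ ^ 2 * (1 / ω ^ (2 * r)) * (‖s‖ ^ r * ‖F‖) ^ 2 := by
      rw [mul_assoc]
      gcongr
    have h5 : 0 ≤ ‖R‖ ^ 2 := by positivity
    have h6 : 0 ≤ 40 * (gammaRhoOmega Vh ρ ω).toReal ^ 2 * ‖R‖ ^ 2 := by
      positivity
    linarith

lemma lap_cVal_timeDeriv (hf0 : SupportedAwayFromZero f) (hfr : IsCrb r f) {s : ℂ}
    (hs0 : 0 < s.re) :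
    (lap s fun t => cVal (timeDeriv r f t)) = s ^ r • lap s fun t => cVal (f t) :=
  lap_timeDeriv (cVal (Ω := Ω)) hfr hf0 hs0

set_option maxHeartbeats 1000000 in
/-- The error estimate at the frequency `s`. -/
lemma frequency_bound (h : GrowthData a τ f u U) (hω : 0 < ω) (hf0 : SupportedAwayFromZero f)
    (hfr : IsCrb r f) (hu : IsWaveSolution f u)
    (hU : IsLeapfrogSolution (lagrangeSpace ℝ Ω T k) τ f U) {S : L2 Ω ℝ →L[ℝ] H10 ℝ Ω}
    (hS : ∀ g v, inner ℝ (grad (S g)) (grad v) = inner ℝ g (val v)) (ha : a < ρ) {s : ℂ} {ν : ℝ}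
    (hsν : s = ρ + ν * Complex.I) :
    ‖lap s fun t => cVal (errDot τ u U t)‖ ^ 2
      + ‖lap s fun t => cGrad (grad (u t - reconL τ U t))‖ ^ 2 ≤
    ‖lap s fun t => cGrad (grad (residualRep S τ f U t))‖ ^ 2
      + 20 / ρ ^ 2 * ‖lap s fun t => cGrad (grad (deltaDot τ U t))‖ ^ 2
      + 40 * (gammaRhoOmega (lagrangeSpace ℂ Ω T k) ρ ω).toReal ^ 2
        * ‖lap s fun t => cGrad (grad (residualRep S τ f U t))‖ ^ 2
      + 11 / ρ ^ 2 * ‖lap s fun t => cVal (etaF τ f t)‖ ^ 2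
      + 8 / ρ ^ 2 * (1 / ω ^ (2 * r)) * ‖lap s fun t => cVal (timeDeriv r f t)‖ ^ 2 := by
  have hρ : 0 < ρ := h.pos.trans ha
  have hre : s.re = ρ := by simp [hsν]
  have hs : a < s.re := by rwa [hre]
  have hs0 : 0 < s.re := by rwa [hre]
  have ha0 := h.pos.le
  have hL := expGrowth_reconL ha0 h.step h.discrete
  have he : (lap s fun t => cH10 (u t - reconL τ U t))
      = (lap s fun t => cH10 (u t)) - lap s fun t => cH10 (reconL τ U t) := by
    rw [← lap_sub (h.sol.clm (cH10 (Ω := Ω))) (hL.clm (cH10 (Ω := Ω))) hs]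
    simp only [map_sub]
  have hfτ : (lap s fun t => cVal (fTau τ f t))
      = (lap s fun t => cVal (f t)) - lap s fun t => cVal (etaF τ f t) := by
    have g1 := h.source.clm (cVal (Ω := Ω))
    have g2 := (expGrowth_fTau ha0 h.step h.source).clm (cVal (Ω := Ω))
    have : (lap s fun t => cVal (etaF τ f t))
        = (lap s fun t => cVal (f t)) - lap s fun t => cVal (fTau τ f t) := by
      rw [← lap_sub g1 g2 hs]
      simp only [etaF, map_sub]
    rw [this, sub_sub_cancel]
  have hlhs : ‖lap s fun t => cVal (errDot τ u U t)‖ ^ 2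
      + ‖lap s fun t => cGrad (grad (u t - reconL τ U t))‖ ^ 2
      = ‖s‖ ^ 2 * ‖val ((lap s fun t => cH10 (u t)) - lap s fun t => cH10 (reconL τ U t))‖ ^ 2
        + ‖grad ((lap s fun t => cH10 (u t)) - lap s fun t => cH10 (reconL τ U t))‖ ^ 2 := by
    rw [lap_errDot h hu hU hs, ← lap_grad h.error hs, he, norm_smul, mul_pow]
  rw [hlhs, lap_deltaDot ha0 h.step hU h.discrete hs, norm_smul,
    lap_cVal_timeDeriv hf0 hfr hs0, norm_smul, norm_pow]
  have ew := recon_frequency ha0 h.step hU h.discrete h.source hS hs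
  rw [hfτ] at ew
  exact transformed_bound hρ hω hsν r
    (wave_frequency hu h.sol h.sol_deriv h.source hs) ew
    (fun v hv => residual_frequency ha0 h.step hU hf0.zero h.discrete h.source hS hs
      (mapH10_mem_lagrangeSpace _ hv) (mapH10_mem_lagrangeSpace _ hv))
    (lap_mem_topologicalClosure (hL.clm (cH10 (Ω := Ω))) hs fun t =>
        mapH10_mem_lagrangeSpace _ (reconL_mem hU t))

end Main

/-! ### Return to the time domain and limit in the damping rate -/

section Integration

lemma ExpGrowth.aemeasurable {E : Type} [NormedAddCommGroup E] {a : ℝ} {φ : ℝ → E}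
    (h : ExpGrowth a φ) : AEMeasurable (fun t => ‖φ t‖ₑ ^ 2) (volume.restrict (Ici 0)) := by
  rw [← restrict_Ioi_eq_restrict_Ici]
  exact h.meas.enorm.pow_const 2

/-- A bound of the Laplace transforms on the line `Re s = ρ` carries over to the damped
`L²`-norms. -/
lemma damped_le_of_lap_le {E G : Type} [NormedAddCommGroup E] [InnerProductSpace ℂ E]
    [CompleteSpace E] [NormedAddCommGroup G] [InnerProductSpace ℂ G] [CompleteSpace G] {a ρ : ℝ}
    (ha : a < ρ) {A N Q : ℝ → E} {B R D : ℝ → G} (hA : ExpGrowth a A) (hN : ExpGrowth a N)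
    (hQ : ExpGrowth a Q) (hB : ExpGrowth a B) (hR : ExpGrowth a R) (hD : ExpGrowth a D)
    {b c m q : ℝ} (hb : 0 ≤ b) (hc : 0 ≤ c) (hm : 0 ≤ m) (hq : 0 ≤ q)
    (h : ∀ (s : ℂ) (ν : ℝ), s = ρ + ν * Complex.I → ‖lap s A‖ ^ 2 + ‖lap s B‖ ^ 2 ≤
      ‖lap s R‖ ^ 2 + b * ‖lap s D‖ ^ 2 + c * ‖lap s R‖ ^ 2 + m * ‖lap s N‖ ^ 2
        + q * ‖lap s Q‖ ^ 2) :
    ∫⁻ t in Ici (0 : ℝ), (‖A t‖ₑ ^ 2 + ‖B t‖ₑ ^ 2) * ENNReal.ofReal (Real.exp (-2 * ρ * t)) ≤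
      ∫⁻ t in Ici (0 : ℝ), (‖R t‖ₑ ^ 2 + ENNReal.ofReal b * ‖D t‖ₑ ^ 2
        + ENNReal.ofReal c * ‖R t‖ₑ ^ 2 + ENNReal.ofReal m * ‖N t‖ₑ ^ 2
        + ENNReal.ofReal q * ‖Q t‖ₑ ^ 2) * ENNReal.ofReal (Real.exp (-2 * ρ * t)) := by
  have hfreq : ∫⁻ ξ : ℝ, (‖lap (ρ + (2 * Real.pi * ξ : ℝ) * Complex.I) A‖ₑ ^ 2
        + ‖lap (ρ + (2 * Real.pi * ξ : ℝ) * Complex.I) B‖ₑ ^ 2) ≤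
      ∫⁻ ξ : ℝ, (‖lap (ρ + (2 * Real.pi * ξ : ℝ) * Complex.I) R‖ₑ ^ 2
        + ENNReal.ofReal b * ‖lap (ρ + (2 * Real.pi * ξ : ℝ) * Complex.I) D‖ₑ ^ 2
        + ENNReal.ofReal c * ‖lap (ρ + (2 * Real.pi * ξ : ℝ) * Complex.I) R‖ₑ ^ 2
        + ENNReal.ofReal m * ‖lap (ρ + (2 * Real.pi * ξ : ℝ) * Complex.I) N‖ₑ ^ 2
        + ENNReal.ofReal q * ‖lap (ρ + (2 * Real.pi * ξ : ℝ) * Complex.I) Q‖ₑ ^ 2) := by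
    refine lintegral_mono fun ξ => ?_
    have := ENNReal.ofReal_le_ofReal (h _ (2 * Real.pi * ξ) rfl)
    rw [ENNReal.ofReal_add (by positivity) (by positivity),
      ENNReal.ofReal_add (by positivity) (by positivity),
      ENNReal.ofReal_add (by positivity) (by positivity),
      ENNReal.ofReal_add (by positivity) (by positivity),
      ENNReal.ofReal_add (by positivity) (by positivity), ENNReal.ofReal_mul hb,
      ENNReal.ofReal_mul hc, ENNReal.ofReal_mul hm, ENNReal.ofReal_mul hq] at this
    simp only [ENNReal.ofReal_pow (norm_nonneg _), ofReal_norm] at this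
    exact this
  have mE : ∀ {φ : ℝ → E}, ExpGrowth a φ → Measurable fun ξ : ℝ =>
      ‖lap (ρ + (2 * Real.pi * ξ : ℝ) * Complex.I) φ‖ₑ ^ 2 := fun hφ =>
    (continuous_lap ha hφ).enorm.measurable.pow_const 2
  have mG : ∀ {φ : ℝ → G}, ExpGrowth a φ → Measurable fun ξ : ℝ =>
      ‖lap (ρ + (2 * Real.pi * ξ : ℝ) * Complex.I) φ‖ₑ ^ 2 := fun hφ =>
    (continuous_lap ha hφ).enorm.measurable.pow_const 2
  rw [lintegral_add_left (mE hA), lintegral_add_right _ ((mE hQ).const_mul _),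
    lintegral_add_right _ ((mE hN).const_mul _), lintegral_add_right _ ((mG hR).const_mul _),
    lintegral_add_right _ ((mG hD).const_mul _), lintegral_const_mul _ (mE hQ),
    lintegral_const_mul _ (mE hN), lintegral_const_mul _ (mG hR), lintegral_const_mul _ (mG hD),
    lintegral_enorm_lap ha hA, lintegral_enorm_lap ha hB, lintegral_enorm_lap ha hR,
    lintegral_enorm_lap ha hD, lintegral_enorm_lap ha hN, lintegral_enorm_lap ha hQ] at hfreq
  have mw : AEMeasurable (fun t : ℝ => ENNReal.ofReal (Real.exp (-2 * ρ * t)))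
      (volume.restrict (Ici 0)) := by fun_prop
  have wA := hA.aemeasurable.mul mw
  have wR := hR.aemeasurable.mul mw
  have wD := hD.aemeasurable.mul mw
  have wN := hN.aemeasurable.mul mw
  have wQ := hQ.aemeasurable.mul mw
  simp only [add_mul, mul_assoc]
  simp only [mul_assoc] at hfreq
  simp only [Pi.mul_def, mul_assoc] at wA wR wD wN wQ
  rw [lintegral_add_left' wA, lintegral_add_right' _ (wQ.const_mul _),
    lintegral_add_right' _ (wN.const_mul _), lintegral_add_right' _ (wR.const_mul _),
    lintegral_add_right' _ (wD.const_mul _), lintegral_const_mul'' _ wQ,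
    lintegral_const_mul'' _ wN, lintegral_const_mul'' _ wR, lintegral_const_mul'' _ wD]
  exact hfreq

/-- Passage to the limit in the damping rate. -/
lemma lintegral_damped_le_of_forall_pos {g : ℝ → ℝ≥0∞} {ρ : ℝ} {K : ℝ → ℝ} {C : ℝ≥0∞}
    (hg : AEMeasurable g (volume.restrict (Ici 0))) (hK : ContinuousAt K 0) (hK0 : K 0 = 1)
    (h : ∀ ε > 0, ∫⁻ t in Ici (0 : ℝ), g t * ENNReal.ofReal (Real.exp (-2 * (ρ + ε) * t))
      ≤ ENNReal.ofReal (K ε) * C) :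
    ∫⁻ t in Ici (0 : ℝ), g t * ENNReal.ofReal (Real.exp (-2 * ρ * t)) ≤ C := by
  let e : ℕ → ℝ := fun n => 1 / ((n : ℝ) + 1)
  have he : Filter.Tendsto e Filter.atTop (nhds 0) := tendsto_one_div_add_atTop_nhds_zero_nat
  have hlim : ∀ t : ℝ, Filter.Tendsto
      (fun n => g t * ENNReal.ofReal (Real.exp (-2 * (ρ + e n) * t))) Filter.atTop
      (nhds (g t * ENNReal.ofReal (Real.exp (-2 * ρ * t)))) := by
    intro t
    refine ENNReal.Tendsto.const_mul (ENNReal.tendsto_ofReal ?_) (Or.inl ?_)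
    · have : Continuous fun x : ℝ => Real.exp (-2 * (ρ + x) * t) := by fun_prop
      have h0 := (this.tendsto 0).comp he
      rwa [add_zero] at h0
    · exact (ENNReal.ofReal_pos.2 (Real.exp_pos _)).ne'
  have hright : Filter.Tendsto (fun n => ENNReal.ofReal (K (e n)) * C) Filter.atTop (nhds C) := by
    have h1 : Filter.Tendsto (fun n => ENNReal.ofReal (K (e n))) Filter.atTop (nhds 1) := by
      have := ENNReal.tendsto_ofReal (hK.tendsto.comp he)
      rwa [hK0, ENNReal.ofReal_one] at this
    simpa using ENNReal.Tendsto.mul_const h1 (Or.inl one_ne_zero)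
  calc ∫⁻ t in Ici (0 : ℝ), g t * ENNReal.ofReal (Real.exp (-2 * ρ * t))
      = ∫⁻ t in Ici (0 : ℝ), Filter.liminf
          (fun n => g t * ENNReal.ofReal (Real.exp (-2 * (ρ + e n) * t))) Filter.atTop :=
        lintegral_congr fun t => (hlim t).liminf_eq.symm
    _ ≤ Filter.liminf (fun n => ∫⁻ t in Ici (0 : ℝ),
          g t * ENNReal.ofReal (Real.exp (-2 * (ρ + e n) * t))) Filter.atTop :=
        -- Fatou's lemma: no domination or finiteness of the left-hand side is needed.
        lintegral_liminf_le' fun n => hg.mul (by fun_prop)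
    _ ≤ Filter.liminf (fun n => ENNReal.ofReal (K (e n)) * C) Filter.atTop :=
        Filter.liminf_le_liminf (Filter.Eventually.of_forall fun n => h _ (by positivity))
    _ = C := hright.liminf_eq

end Integration

/-! ### The estimate at a larger damping rate, compared with the rate `ρ` -/

section Final
variable {d : ℕ} {Ω : Set (EuclideanSpace ℝ (Fin d))}
  {T : Geometry.SimplicialComplex ℝ (EuclideanSpace ℝ (Fin d))} {k : ℕ} {a τ ρ ω : ℝ} {r : ℕ}
  {f : ℝ → L2 Ω ℝ} {u : ℝ → H10 ℝ Ω} {U : ℕ → H10 ℝ Ω}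

lemma enorm_cVal (v : L2 Ω ℝ) : ‖cVal v‖ₑ = ‖v‖ₑ := by
  rw [← ofReal_norm, norm_cVal, ofReal_norm]

lemma enorm_cGrad (v : L2 Ω (EuclideanSpace ℝ (Fin d))) : ‖cGrad v‖ₑ = ‖v‖ₑ := by
  rw [← ofReal_norm, norm_cGrad, ofReal_norm]

/-- The error estimate for a damping rate above the growth rate of the data. -/
lemma damped_error_le (h : GrowthData a τ f u U) (hω : 0 < ω) (hf0 : SupportedAwayFromZero f)
    (hfr : IsCrb r f) (hu : IsWaveSolution f u)
    (hU : IsLeapfrogSolution (lagrangeSpace ℝ Ω T k) τ f U) {S : L2 Ω ℝ →L[ℝ] H10 ℝ Ω}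
    (hS : ∀ g v, inner ℝ (grad (S g)) (grad v) = inner ℝ g (val v)) (ha : a < ρ) :
    ∫⁻ t in Ici (0 : ℝ), (‖errDot τ u U t‖ₑ ^ 2 + ‖grad (u t - reconL τ U t)‖ₑ ^ 2)
        * ENNReal.ofReal (Real.exp (-2 * ρ * t)) ≤
      ∫⁻ t in Ici (0 : ℝ), (‖grad (residualRep S τ f U t)‖ₑ ^ 2
        + ENNReal.ofReal (20 / ρ ^ 2) * ‖grad (deltaDot τ U t)‖ₑ ^ 2
        + ENNReal.ofReal (40 * (gammaRhoOmega (lagrangeSpace ℂ Ω T k) ρ ω).toReal ^ 2)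
          * ‖grad (residualRep S τ f U t)‖ₑ ^ 2
        + ENNReal.ofReal (11 / ρ ^ 2) * ‖etaF τ f t‖ₑ ^ 2
        + ENNReal.ofReal (8 / ρ ^ 2 * (1 / ω ^ (2 * r))) * ‖timeDeriv r f t‖ₑ ^ 2)
        * ENNReal.ofReal (Real.exp (-2 * ρ * t)) := by
  have hρ : 0 < ρ := h.pos.trans ha
  have ha0 := h.pos.le
  have hη : ExpGrowth a (etaF τ f) := h.source.sub (expGrowth_fTau ha0 h.step h.source)
  have gg : ∀ {φ : ℝ → H10 ℝ Ω}, ExpGrowth a φ → ExpGrowth a fun t => cGrad (grad (φ t)) :=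
    fun hφ => (hφ.clm (grad (𝕜 := ℝ) (Ω := Ω))).clm (cGrad (Ω := Ω))
  have key := damped_le_of_lap_le (E := L2 Ω ℂ) (G := L2 Ω (EuclideanSpace ℂ (Fin d))) ha
    (h.errDot.clm (cVal (Ω := Ω))) (hη.clm (cVal (Ω := Ω)))
    ((hfr.expGrowth_timeDeriv h.pos).clm (cVal (Ω := Ω))) (gg h.error)
    (gg (expGrowth_residualRep ha0 h.step h.source h.discrete S))
    (gg (expGrowth_deltaDot ha0 h.step h.discrete))
    (b := 20 / ρ ^ 2) (c := 40 * (gammaRhoOmega (lagrangeSpace ℂ Ω T k) ρ ω).toReal ^ 2)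
    (m := 11 / ρ ^ 2) (q := 8 / ρ ^ 2 * (1 / ω ^ (2 * r)))
    (by positivity) (by positivity) (by positivity) (by positivity)
    (fun s ν hsν => frequency_bound h hω hf0 hfr hu hU hS ha hsν)
  simp only [enorm_cVal, enorm_cGrad] at key
  exact key

/-- The factor by which the right-hand side grows when the damping rate changes from `ρ` to
`ρ + ε`. -/
def rateFactor (ρ ε : ℝ) : ℝ := 1 + ε / ρ + ε * (2 + ε / ρ) / ρ

lemma one_le_rateFactor {ε : ℝ} (hρ : 0 < ρ) (hε : 0 ≤ ε) : 1 ≤ rateFactor ρ ε := by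
  have h1 : 0 ≤ ε / ρ := by positivity
  have h2 : 0 ≤ ε * (2 + ε / ρ) / ρ := by positivity
  unfold rateFactor
  linarith

/-- The constants `20/ρ²`, `11/ρ²`, `8/ρ²` and the exponential weight only decrease when `ρ` grows;
the rate factor is needed for the approximation factor alone. -/
lemma estimator_le {Vh : Submodule ℂ (H10 ℂ Ω)} {ε t : ℝ} (hρ : 0 < ρ) (hω : 0 < ω)
    (hε : 0 ≤ ε) (ht : 0 ≤ t) {R R' D N Q : ℝ≥0∞} (hR : R ≤ R') :
    (R ^ 2 + ENNReal.ofReal (20 / (ρ + ε) ^ 2) * D ^ 2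
        + ENNReal.ofReal (40 * (gammaRhoOmega Vh (ρ + ε) ω).toReal ^ 2) * R ^ 2
        + ENNReal.ofReal (11 / (ρ + ε) ^ 2) * N ^ 2
        + ENNReal.ofReal (8 / (ρ + ε) ^ 2 * (1 / ω ^ (2 * r))) * Q ^ 2)
        * ENNReal.ofReal (Real.exp (-2 * (ρ + ε) * t)) ≤
      ENNReal.ofReal (rateFactor ρ ε ^ 2) *
        ((R' ^ 2 + ENNReal.ofReal (20 / ρ ^ 2) * D ^ 2 + 40 * gammaRhoOmega Vh ρ ω ^ 2 * R' ^ 2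
          + ENNReal.ofReal (11 / ρ ^ 2) * N ^ 2
          + ENNReal.ofReal (8 / ρ ^ 2 * (1 / ω ^ (2 * r))) * Q ^ 2)
          * ENNReal.ofReal (Real.exp (-2 * ρ * t))) := by
  have hK : 1 ≤ rateFactor ρ ε := one_le_rateFactor hρ hε
  have hK2 : 1 ≤ ENNReal.ofReal (rateFactor ρ ε ^ 2) := by
    rw [ENNReal.one_le_ofReal]
    exact one_le_pow₀ hK
  have hρε : ρ ≤ ρ + ε := by linarith
  have hpos : 0 < ρ + ε := by linarith
  have hΓ : ENNReal.ofReal (40 * (gammaRhoOmega Vh (ρ + ε) ω).toReal ^ 2) ≤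
      ENNReal.ofReal (rateFactor ρ ε ^ 2) * (40 * gammaRhoOmega Vh ρ ω ^ 2) := by
    rw [ENNReal.ofReal_mul (by norm_num), ENNReal.ofReal_pow ENNReal.toReal_nonneg,
      ENNReal.ofReal_toReal (gammaRhoOmega_ne_top hpos), ENNReal.ofReal_pow (by linarith),
      mul_left_comm, ← mul_pow]
    have := gammaRhoOmega_le_mul (Vh := Vh) (ω := ω) hρ hε
    norm_num
    gcongr
    exact this
  have hle : ∀ x : ℝ≥0∞, x ≤ ENNReal.ofReal (rateFactor ρ ε ^ 2) * x := fun x =>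
    le_mul_of_one_le_left zero_le hK2
  simp only [← mul_assoc, mul_add (ENNReal.ofReal (rateFactor ρ ε ^ 2))]
  gcongr ?_ * ENNReal.ofReal (Real.exp ?_)
  · gcongr ?_ + ?_ + ?_ + ?_ + ?_
    · exact (by gcongr : R ^ 2 ≤ R' ^ 2).trans (hle _)
    · rw [mul_assoc]
      refine le_trans ?_ (hle _)
      gcongr
    · rw [← mul_assoc] at hΓ
      gcongr
    · rw [mul_assoc]
      refine le_trans ?_ (hle _)
      gcongr
    · rw [mul_assoc]
      refine le_trans ?_ (hle _)
      gcongr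
  · nlinarith

end Final

end LeapfrogWave

end

/-! ### Conclusion -/

open LeapfrogWave

theorem theorem4p3 {d : ℕ} (hd : 1 ≤ d) {Ω : Set (EuclideanSpace ℝ (Fin d))}
    (hΩ : IsOpen Ω) (hΩb : Bornology.IsBounded Ω)
    (T : Geometry.SimplicialComplex ℝ (EuclideanSpace ℝ (Fin d))) (hT : IsMesh Ω T)
    (k : ℕ) (hk : 1 ≤ k) (τ ρ ω : ℝ) (hτ : 0 < τ) (hρ : 0 < ρ) (hω : 0 < ω)
    (f : ℝ → L2 Ω ℝ) (hf0 : SupportedAwayFromZero f) (r : ℕ) (hfr : IsCrb r f)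
    (u : ℝ → H10 ℝ Ω) (hu : IsWaveSolution f u)
    (U : ℕ → H10 ℝ Ω) (hU : IsLeapfrogSolution (lagrangeSpace ℝ Ω T k) τ f U) :
    dampedEnergySq ρ (fun t => u t - reconL τ U t) ≤
      ∫⁻ t in Ici (0 : ℝ),
        (dualNorm (residual τ f U t) ^ 2
          + ENNReal.ofReal (20 / ρ ^ 2) * ‖grad (deltaDot τ U t)‖ₑ ^ 2
          + 40 * gammaRhoOmega (lagrangeSpace ℂ Ω T k) ρ ω ^ 2 * dualNorm (residual τ f U t) ^ 2
          + ENNReal.ofReal (11 / ρ ^ 2) * ‖etaF τ f t‖ₑ ^ 2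
          + ENNReal.ofReal (8 / ρ ^ 2 * (1 / ω ^ (2 * r))) * ‖timeDeriv r f t‖ₑ ^ 2)
        * ENNReal.ofReal (Real.exp (-2 * ρ * t)) := by
  set C := ∫⁻ t in Ici (0 : ℝ),
        (dualNorm (residual τ f U t) ^ 2
          + ENNReal.ofReal (20 / ρ ^ 2) * ‖grad (deltaDot τ U t)‖ₑ ^ 2
          + 40 * gammaRhoOmega (lagrangeSpace ℂ Ω T k) ρ ω ^ 2 * dualNorm (residual τ f U t) ^ 2
          + ENNReal.ofReal (11 / ρ ^ 2) * ‖etaF τ f t‖ₑ ^ 2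
          + ENNReal.ofReal (8 / ρ ^ 2 * (1 / ω ^ (2 * r))) * ‖timeDeriv r f t‖ₑ ^ 2)
        * ENNReal.ofReal (Real.exp (-2 * ρ * t)) with hC
  rcases eq_or_ne C ∞ with htop | htop
  · rw [htop]
    exact le_top
  -- Finiteness of the right-hand side is used only here: the `∇δ'` term controls the growth of the
  -- discrete solution, which no CFL condition does.
  have hδ : ∫⁻ t in Ici (0 : ℝ), ‖grad (deltaDot τ U t)‖ₑ ^ 2
      * ENNReal.ofReal (Real.exp (-2 * ρ * t)) ≠ ∞ := by
    intro h
    have hc : ENNReal.ofReal (20 / ρ ^ 2) ≠ 0 := (ENNReal.ofReal_pos.2 (by positivity)).ne'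
    have h1 : ENNReal.ofReal (20 / ρ ^ 2) * ∫⁻ t in Ici (0 : ℝ), ‖grad (deltaDot τ U t)‖ₑ ^ 2
        * ENNReal.ofReal (Real.exp (-2 * ρ * t)) ≤ C := by
      rw [← lintegral_const_mul' _ _ ENNReal.ofReal_ne_top]
      refine lintegral_mono fun t => ?_
      rw [← mul_assoc]
      gcongr ?_ * _
      exact le_add_right (le_add_right (le_add_right le_add_self))
    rw [h, ENNReal.mul_top hc] at h1
    exact htop (top_le_iff.1 h1)
  have hg : ∀ a > 0, ExpGrowth a f := fun a ha => hfr.expGrowth hf0 ha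
  have hfc : ContinuousOn f (Ici 0) := hfr.1.continuousOn
  -- The growth rate obtained is `ρ` itself, whereas the transforms need a strictly larger damping
  -- rate. Hence the passage through `ρ + ε`.
  have hgd : GrowthData ρ τ f u U :=
    ⟨hρ, hτ, hg ρ hρ, hu.expGrowth hd hΩb hfc hg hρ, hu.expGrowth_deriv hfc hg hρ,
      seqGrowth_of_deltaDot hd hΩb hρ hτ hU hδ⟩
  obtain ⟨S, hS⟩ := exists_solution_operator hd hΩb
  have hlhs : dampedEnergySq ρ (fun t => u t - reconL τ U t)
      = ∫⁻ t in Ici (0 : ℝ), (‖errDot τ u U t‖ₑ ^ 2 + ‖grad (u t - reconL τ U t)‖ₑ ^ 2)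
        * ENNReal.ofReal (Real.exp (-2 * ρ * t)) :=
    setLIntegral_congr_fun measurableSet_Ici fun t ht => by
      simp only [timeDeriv_error hτ hu ht]
  rw [hlhs]
  refine lintegral_damped_le_of_forall_pos (K := fun ε => rateFactor ρ ε ^ 2)
    (hgd.errDot.aemeasurable.add (hgd.error.clm (grad (𝕜 := ℝ) (Ω := Ω))).aemeasurable)
    ?_ ?_ fun ε hε => ?_
  · have : Continuous fun ε => rateFactor ρ ε ^ 2 := by
      unfold rateFactor
      fun_prop
    exact this.continuousAt
  · simp [rateFactor]
  · refine (damped_error_le (r := r) hgd hω hf0 hfr hu hU hS (by linarith)).trans ?_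
    rw [hC, ← lintegral_const_mul' _ _ ENNReal.ofReal_ne_top]
    exact setLIntegral_mono' measurableSet_Ici fun t ht =>
      estimator_le hρ hω hε.le ht (enorm_residualRep_le hS hτ ht)
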